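/- Let $k$ be a field, let $C$ be a coalgebra over $k$ with a group-like element $e\in C$, and let $A$ be a unital associative $k$-algebra with a right $C$-coaction $\rho\colon A\to A\otimes C$, $a\mapsto a_{(0)}\otimes a_{(1)}$, such that $\rho(1)=1\otimes e$. Put $$B=\{b\in A\mid \rho(ba)=b\,\rho(a)\ \text{for all } a\in A\},$$ a unital subalgebra of $A$. Assume that $B\subseteq A$ is a $C$-Galois extension, i.e. that $\mathrm{can}\colon A\otimes_BA\to A\otimes C$, $a\otimes a'\mapsto aa'_{(0)}\otimes a'_{(1)}$, is bijective (then $B=\{b\mid \rho(b)=b\otimes e\}$), and that the canonical entwining $\psi\colon C\otimes A\to A\otimes C$, $\psi(c\otimes a)=\mathrm{can}(\mathrm{can}^{-1}(1\otimes c)\,a)$, is bijective. Equip $A$ with the left coaction $a\mapsto\psi^{-1}(a\otimes e)$. Let $\ell\colon C\to A\otimes A$, $\ell(c)=c^{\langle1\rangle}\otimes c^{\langle2\rangle}$, be a strong connection: a linear map that lifts the translation map $c\mapsto\mathrm{can}^{-1}(1\otimes c)$ and is $C$-bicolinear for the left coaction on the left tensor factor and the right coaction on the right one (the normalization $\ell(e)=1\otimes1$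 is not required). Let $n\ge0$. Notation. $\mathrm{Rep}(C)$ is the group completion of the monoid, under $\oplus$, of isomorphism classes of finite-dimensional left $C$-comodules. $\mathrm K_0(B)$ is the group completion of the monoid, under $\oplus$, of isomorphism classes of finitely generated projective left $B$-modules. $C^{\mathrm{tr}}=\{c\in C\mid c_{(1)}\otimes c_{(2)}=c_{(2)}\otimes c_{(1)}\}$. For a comodule $V$ with basis $(v_i)$ and coaction $v_i\mapsto\sum_jc_{ij}\otimes v_j$, the character is $\chi(V)=\sum_ic_{ii}$; it defines a homomorphism $\chi\colon\mathrm{Rep}(C)\to C^{\mathrm{tr}}$. $A\,\square^CV\subseteq A\otimes V$ is the cotensor product, $M=A\,\square^CA$, and $\varepsilon\colon M\to B$ is the restriction of the multiplication of $A$. $\mathrm{HC}_{2n}(B)$ is the homology in degree $2n$ of the total complex $\mathrm{Tot}\,\mathrm{CC}_{\bullet}(B)=\bigoplus_{m=0}^{\bullet}B^{\otimes(m+1)}$ of the cyclic bicomplex (even columns carry $b$, odd columns $-b'$, horizontal maps $1-t$ and $N$). Put $\alpha_m=(-1)^{\lfloor m/2\rfloor}\,m!/\lfloor m/2\rfloor!$.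 Then the following maps are well defined, each of them being the unique map of the indicated kind with the stated property; in particular all the chains below are cycles. 1. The homomorphism $[A\,\square^C-]\colon\mathrm{Rep}(C)\to\mathrm K_0(B)$, $[V]\mapsto[A\,\square^CV]$; in particular each left $B$-module $A\,\square^CV$ is finitely generated projective. 2. The Chern character, a homomorphism $\mathrm{ch}_n\colon\mathrm K_0(B)\to\mathrm{HC}_{2n}(B)$: if $\mathbf e=(e_{ij})$ is an idempotent $N\times N$ matrix over $B$ and $P\cong B^N\mathbf e$ (row vectors), then $\mathrm{ch}_n[P]$ is the class of $$\sum_{m=0}^{2n}\alpha_m\sum_{i_0,\dots,i_m}e_{i_0i_1}\otimes e_{i_1i_2}\otimes\cdots\otimes e_{i_mi_0}.$$ 3. The Chern–Weil map, a $k$-linear map $\mathrm{chw}_n=\mathrm{chw}_n(\ell)\colon C^{\mathrm{tr}}\to\mathrm{HC}_{2n}(B)$: for $c\in C^{\mathrm{tr}}$ the elements $$\mathrm c_m(\ell)(c)=\bigl(c_{(m+1)}{}^{\langle2\rangle}\otimes c_{(1)}{}^{\langle1\rangle}\bigr)\otimes\bigl(c_{(1)}{}^{\langle2\rangle}\otimes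 c_{(2)}{}^{\langle1\rangle}\bigr)\otimes\cdots\otimes\bigl(c_{(m)}{}^{\langle2\rangle}\otimes c_{(m+1)}{}^{\langle1\rangle}\bigr)$$ lie in $M^{\otimes(m+1)}$, and $\mathrm{chw}_n(c)$ is the class of $\sum_{m=0}^{2n}\alpha_m\,\varepsilon^{\otimes(m+1)}\bigl(\mathrm c_m(\ell)(c)\bigr)$. 4. The Chern–Galois character of Brzeziński and Hajac, a homomorphism $\mathrm{chg}_n=\mathrm{chg}_n(\ell)\colon\mathrm{Rep}(C)\to\mathrm{HC}_{2n}(B)$: for every finite-dimensional left comodule $V$ and every basis of $V$, with matrix coefficients $c_{ij}$, the elements $$\sum_{i_1,\dots,i_{m+1}}c_{i_1i_2}{}^{\langle2\rangle}c_{i_2i_3}{}^{\langle1\rangle}\otimes c_{i_2i_3}{}^{\langle2\rangle}c_{i_3i_4}{}^{\langle1\rangle}\otimes\cdots\otimes c_{i_{m+1}i_1}{}^{\langle2\rangle}c_{i_1i_2}{}^{\langle1\rangle}$$ of $A^{\otimes(m+1)}$ lie in $B^{\otimes(m+1)}$, and $\mathrm{chg}_n[V]$ is the class of their sum over $0\le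 m\le2n$ with the coefficients $\alpha_m$. Moreover, the square formed by these maps commutes and the Chern–Galois character is its diagonal: $$\mathrm{ch}_n\circ[A\,\square^C-]\;=\;\mathrm{chg}_n(\ell)\;=\;\mathrm{chw}_n(\ell)\circ\chi\colon\ \mathrm{Rep}(C)\to\mathrm{HC}_{2n}(B).$$ -/

import Mathlib

open scoped TensorProduct

universe u

namespace ChernWeil

noncomputable section

section Coactions

variable {k C : Type u} [Field k] [AddCommGroup C] [Module k C] [Coalgebra k C]

/-- `ρ : A → A ⊗ C` is a right coaction: coassociative and counital. -/
structure IsRightCoaction {A : Type u} [AddCommGroup A] [Module k A]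
    (ρ : A →ₗ[k] A ⊗[k] C) : Prop where
  coassoc : (TensorProduct.assoc k A C C).toLinearMap ∘ₗ ρ.rTensor C ∘ₗ ρ =
    (Coalgebra.comul (R := k) (A := C)).lTensor A ∘ₗ ρ
  counit : (TensorProduct.rid k A).toLinearMap ∘ₗ
    (Coalgebra.counit (R := k) (A := C)).lTensor A ∘ₗ ρ = LinearMap.id

/-- `δ : V → C ⊗ V` is a left coaction: coassociative and counital. -/
structure IsLeftCoaction {V : Type u} [AddCommGroup V] [Module k V]
    (δ : V →ₗ[k] C ⊗[k] V) : Prop where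
  coassoc : (TensorProduct.assoc k C C V).toLinearMap ∘ₗ
    (Coalgebra.comul (R := k) (A := C)).rTensor V ∘ₗ δ = δ.lTensor C ∘ₗ δ
  counit : (TensorProduct.lid k V).toLinearMap ∘ₗ
    (Coalgebra.counit (R := k) (A := C)).rTensor V ∘ₗ δ = LinearMap.id

/-- The cotensor product `A □^C V` as a subspace of `A ⊗ V`. -/
def cotensor {A V : Type u} [AddCommGroup A] [Module k A] [AddCommGroup V] [Module k V]
    (ρ : A →ₗ[k] A ⊗[k] C) (δ : V →ₗ[k] C ⊗[k] V) : Submodule k (A ⊗[k] V) :=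
  LinearMap.eqLocus (ρ.rTensor V)
    ((TensorProduct.assoc k A C V).symm.toLinearMap ∘ₗ δ.lTensor A)

variable (k C) in
/-- The space of cotraces: elements whose coproduct is invariant under the flip. -/
def cotraces : Submodule k C :=
  LinearMap.eqLocus (Coalgebra.comul (R := k) (A := C))
    ((TensorProduct.comm k C C).toLinearMap ∘ₗ Coalgebra.comul)

end Coactions

section Unbundled

variable {k C : Type u} [Field k] [AddCommGroup C] [Module k C]
variable {V W X V' W' : Type u} [AddCommGroup V] [Module k V] [AddCommGroup W] [Module k W]
  [AddCommGroup X] [Module k X] [AddCommGroup V'] [Module k V'] [AddCommGroup W'] [Module k W']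

/-- The direct sum of two left coactions. -/
def sumCoact (δ : V →ₗ[k] C ⊗[k] V) (γ : W →ₗ[k] C ⊗[k] W) : (V × W) →ₗ[k] C ⊗[k] (V × W) :=
  (LinearMap.inl k V W).lTensor C ∘ₗ δ ∘ₗ LinearMap.fst k V W +
    (LinearMap.inr k V W).lTensor C ∘ₗ γ ∘ₗ LinearMap.snd k V W

lemma sumCoact_apply (δ : V →ₗ[k] C ⊗[k] V) (γ : W →ₗ[k] C ⊗[k] W) (p : V × W) :
    sumCoact δ γ p = (LinearMap.inl k V W).lTensor C (δ p.1) +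
      (LinearMap.inr k V W).lTensor C (γ p.2) := rfl

lemma sumCoact_congr {δ : V →ₗ[k] C ⊗[k] V} {γ : W →ₗ[k] C ⊗[k] W}
    {δ' : V' →ₗ[k] C ⊗[k] V'} {γ' : W' →ₗ[k] C ⊗[k] W'} (f : V ≃ₗ[k] V') (g : W ≃ₗ[k] W')
    (hf : δ' ∘ₗ f.toLinearMap = f.toLinearMap.lTensor C ∘ₗ δ)
    (hg : γ' ∘ₗ g.toLinearMap = g.toLinearMap.lTensor C ∘ₗ γ) :
    sumCoact δ' γ' ∘ₗ (LinearEquiv.prodCongr f g).toLinearMap =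
      (LinearEquiv.prodCongr f g).toLinearMap.lTensor C ∘ₗ sumCoact δ γ := by
  refine LinearMap.ext fun p => ?_
  have h1 : δ' (f p.1) = f.toLinearMap.lTensor C (δ p.1) := LinearMap.congr_fun hf p.1
  have h2 : γ' (g p.2) = g.toLinearMap.lTensor C (γ p.2) := LinearMap.congr_fun hg p.2
  change sumCoact δ' γ' (f p.1, g p.2) = _
  rw [LinearMap.comp_apply, sumCoact_apply, sumCoact_apply, h1, h2, map_add]
  simp only [← LinearMap.lTensor_comp_apply]
  have e1 : (LinearEquiv.prodCongr f g).toLinearMap ∘ₗ LinearMap.inl k V W =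
      LinearMap.inl k V' W' ∘ₗ f.toLinearMap :=
    LinearMap.ext fun v => Prod.ext rfl (by simp)
  have e2 : (LinearEquiv.prodCongr f g).toLinearMap ∘ₗ LinearMap.inr k V W =
      LinearMap.inr k V' W' ∘ₗ g.toLinearMap :=
    LinearMap.ext fun v => Prod.ext (by simp) rfl
  rw [← e1, ← e2]

lemma sumCoact_comm (δ : V →ₗ[k] C ⊗[k] V) (γ : W →ₗ[k] C ⊗[k] W) :
    sumCoact γ δ ∘ₗ (LinearEquiv.prodComm k V W).toLinearMap =
      (LinearEquiv.prodComm k V W).toLinearMap.lTensor C ∘ₗ sumCoact δ γ := by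
  refine LinearMap.ext fun p => ?_
  change sumCoact γ δ (p.2, p.1) = _
  rw [LinearMap.comp_apply, sumCoact_apply, sumCoact_apply, map_add, add_comm]
  simp only [← LinearMap.lTensor_comp_apply]
  rfl

lemma sumCoact_assoc (δ : V →ₗ[k] C ⊗[k] V) (γ : W →ₗ[k] C ⊗[k] W) (θ : X →ₗ[k] C ⊗[k] X) :
    sumCoact δ (sumCoact γ θ) ∘ₗ (LinearEquiv.prodAssoc k V W X).toLinearMap =
      (LinearEquiv.prodAssoc k V W X).toLinearMap.lTensor C ∘ₗ
        sumCoact (sumCoact δ γ) θ := by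
  refine LinearMap.ext fun p => ?_
  change sumCoact δ (sumCoact γ θ) (p.1.1, (p.1.2, p.2)) = _
  rw [LinearMap.comp_apply, sumCoact_apply, sumCoact_apply, sumCoact_apply, sumCoact_apply]
  simp only [map_add, ← LinearMap.lTensor_comp_apply, add_assoc]
  rfl

lemma sumCoact_zero (γ : W →ₗ[k] C ⊗[k] W) :
    γ ∘ₗ (LinearEquiv.uniqueProd : (PUnit.{u + 1} × W) ≃ₗ[k] W).toLinearMap =
      (LinearEquiv.uniqueProd : (PUnit.{u + 1} × W) ≃ₗ[k] W).toLinearMap.lTensor C ∘ₗ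
        sumCoact 0 γ := by
  refine LinearMap.ext fun p => ?_
  change γ p.2 = _
  rw [LinearMap.comp_apply, sumCoact_apply, LinearMap.zero_apply, map_zero, zero_add,
    ← LinearMap.lTensor_comp_apply]
  have e : (LinearEquiv.uniqueProd : (PUnit.{u + 1} × W) ≃ₗ[k] W).toLinearMap ∘ₗ
    LinearMap.inr k PUnit.{u + 1} W = LinearMap.id := rfl
  rw [e, LinearMap.lTensor_id, LinearMap.id_apply]

/-- The matrix coefficients `c i j` of a coaction in a basis: `v i ↦ ∑ j, c i j ⊗ v j`. -/
def matCoeff (δ : V →ₗ[k] C ⊗[k] V) {ι : Type*} (b : Module.Basis ι k V) (i j : ι) : C :=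
  TensorProduct.rid k C ((b.coord j).lTensor C (δ (b i)))

lemma matCoeff_sum_inl (δ : V →ₗ[k] C ⊗[k] V) (γ : W →ₗ[k] C ⊗[k] W) {ι κ : Type*}
    (b : Module.Basis ι k V) (b' : Module.Basis κ k W) (i : ι) :
    matCoeff (sumCoact δ γ) (b.prod b') (Sum.inl i) (Sum.inl i) = matCoeff δ b i i := by
  have e : (b.prod b').coord (Sum.inl i) ∘ₗ LinearMap.inl k V W = b.coord i := by
    ext v
    simp
  simp [matCoeff, sumCoact_apply, Module.Basis.prod_apply, ← e, LinearMap.lTensor_comp_apply]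

lemma matCoeff_sum_inr (δ : V →ₗ[k] C ⊗[k] V) (γ : W →ₗ[k] C ⊗[k] W) {ι κ : Type*}
    (b : Module.Basis ι k V) (b' : Module.Basis κ k W) (i : κ) :
    matCoeff (sumCoact δ γ) (b.prod b') (Sum.inr i) (Sum.inr i) = matCoeff γ b' i i := by
  have e : (b.prod b').coord (Sum.inr i) ∘ₗ LinearMap.inr k V W = b'.coord i := by
    ext v
    simp
  simp [matCoeff, sumCoact_apply, Module.Basis.prod_apply, ← e, LinearMap.lTensor_comp_apply]

end Unbundled

/-! ### Finite-dimensional comodules and their characters -/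

section Rep

variable (k C : Type u) [Field k] [AddCommGroup C] [Module k C] [Coalgebra k C]

/-- A finite-dimensional left `C`-comodule. -/
structure Comod where
  carrier : Type u
  [grp : AddCommGroup carrier]
  [mod : Module k carrier]
  [fin : Module.Finite k carrier]
  coact : carrier →ₗ[k] C ⊗[k] carrier
  isCoact : IsLeftCoaction coact

attribute [instance] Comod.grp Comod.mod Comod.fin

variable {k C}

namespace Comod

instance : CoeSort (Comod k C) (Type u) := ⟨Comod.carrier⟩

/-- Two comodules are isomorphic if there is a colinear bijection between them. -/
def Iso (V W : Comod k C) : Prop :=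
  ∃ f : V ≃ₗ[k] W, W.coact ∘ₗ f.toLinearMap = f.toLinearMap.lTensor C ∘ₗ V.coact

lemma Iso.refl (V : Comod k C) : Iso V V :=
  ⟨LinearEquiv.refl k V, by ext; simp⟩

lemma Iso.symm {V W : Comod k C} (h : Iso V W) : Iso W V := by
  obtain ⟨f, hf⟩ := h
  refine ⟨f.symm, ?_⟩
  ext w
  have h1 := LinearMap.congr_fun hf (f.symm w)
  simp only [LinearMap.comp_apply, LinearEquiv.coe_coe, LinearEquiv.apply_symm_apply] at h1
  simp only [LinearMap.comp_apply, LinearEquiv.coe_coe, h1, ← LinearMap.lTensor_comp_apply]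
  simp

lemma Iso.trans {V W X : Comod k C} (h : Iso V W) (h' : Iso W X) : Iso V X := by
  obtain ⟨f, hf⟩ := h
  obtain ⟨g, hg⟩ := h'
  refine ⟨f.trans g, ?_⟩
  ext v
  have h1 := LinearMap.congr_fun hf v
  have h2 := LinearMap.congr_fun hg (f v)
  simp only [LinearMap.comp_apply, LinearEquiv.coe_coe] at h1 h2
  simp only [LinearMap.comp_apply, LinearEquiv.coe_coe, LinearEquiv.trans_apply, h2, h1,
    ← LinearMap.lTensor_comp_apply]
  congr 2

/-- The zero comodule. -/
def zero : Comod k C where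
  carrier := PUnit
  coact := 0
  isCoact := ⟨by simp, by ext⟩

lemma coassoc_of_colinear {V X : Type u} [AddCommGroup V] [Module k V] [AddCommGroup X]
    [Module k X] {δ : V →ₗ[k] C ⊗[k] V} {γ : X →ₗ[k] C ⊗[k] X} (h : IsLeftCoaction δ)
    (f : V →ₗ[k] X) (hf : γ ∘ₗ f = f.lTensor C ∘ₗ δ) (v : V) :
    ((TensorProduct.assoc k C C X).toLinearMap ∘ₗ
      (Coalgebra.comul (R := k) (A := C)).rTensor X ∘ₗ γ) (f v) = (γ.lTensor C ∘ₗ γ) (f v) := by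
  have h1 : γ (f v) = f.lTensor C (δ v) := LinearMap.congr_fun hf v
  have h2 : (TensorProduct.assoc k C C X).toLinearMap ∘ₗ
      (Coalgebra.comul (R := k) (A := C)).rTensor X ∘ₗ f.lTensor C =
      (f.lTensor C).lTensor C ∘ₗ (TensorProduct.assoc k C C V).toLinearMap ∘ₗ
        (Coalgebra.comul (R := k) (A := C)).rTensor V := by
    ext c w
    simp only [TensorProduct.AlgebraTensorModule.curry_apply, LinearMap.restrictScalars_self,
      TensorProduct.curry_apply, LinearMap.comp_apply, LinearMap.lTensor_tmul,
      LinearMap.rTensor_tmul, LinearEquiv.coe_coe]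
    induction Coalgebra.comul (R := k) c with
    | zero => simp
    | tmul x y => simp
    | add x y hx hy => simp [TensorProduct.add_tmul, hx, hy]
  have h3 := LinearMap.congr_fun h2 (δ v)
  have h4 := LinearMap.congr_fun h.coassoc v
  simp only [LinearMap.comp_apply] at h3 h4 ⊢
  rw [h1, h3, h4, ← LinearMap.lTensor_comp_apply, ← LinearMap.lTensor_comp_apply, hf]

lemma counit_of_colinear {V X : Type u} [AddCommGroup V] [Module k V] [AddCommGroup X]
    [Module k X] {δ : V →ₗ[k] C ⊗[k] V} {γ : X →ₗ[k] C ⊗[k] X} (h : IsLeftCoaction δ)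
    (f : V →ₗ[k] X) (hf : γ ∘ₗ f = f.lTensor C ∘ₗ δ) (v : V) :
    ((TensorProduct.lid k X).toLinearMap ∘ₗ
      (Coalgebra.counit (R := k) (A := C)).rTensor X ∘ₗ γ) (f v) = f v := by
  have h1 : γ (f v) = f.lTensor C (δ v) := LinearMap.congr_fun hf v
  have h2 : (TensorProduct.lid k X).toLinearMap ∘ₗ
      (Coalgebra.counit (R := k) (A := C)).rTensor X ∘ₗ f.lTensor C =
      f ∘ₗ (TensorProduct.lid k V).toLinearMap ∘ₗ
        (Coalgebra.counit (R := k) (A := C)).rTensor V := by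
    ext c w
    simp
  have h3 := LinearMap.congr_fun h2 (δ v)
  have h4 := LinearMap.congr_fun h.counit v
  simp only [LinearMap.comp_apply] at h3 h4 ⊢
  rw [h1, h3, h4, LinearMap.id_apply]

/-- The direct sum of two comodules. -/
def sum (V W : Comod k C) : Comod k C where
  carrier := V × W
  coact := sumCoact V.coact W.coact
  isCoact := by
    constructor <;> apply LinearMap.prod_ext <;> apply LinearMap.ext <;> intro v
    · exact coassoc_of_colinear V.isCoact (LinearMap.inl k V W) (by ext; simp [sumCoact]) v
    · exact coassoc_of_colinear W.isCoact (LinearMap.inr k V W) (by ext; simp [sumCoact]) v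
    · exact counit_of_colinear V.isCoact (LinearMap.inl k V W) (by ext; simp [sumCoact]) v
    · exact counit_of_colinear W.isCoact (LinearMap.inr k V W) (by ext; simp [sumCoact]) v

lemma Iso.sum {V V' W W' : Comod k C} : Iso V V' → Iso W W' → Iso (V.sum W) (V'.sum W') :=
  fun ⟨f, hf⟩ ⟨g, hg⟩ => ⟨LinearEquiv.prodCongr f g, sumCoact_congr f g hf hg⟩

lemma sum_comm (V W : Comod k C) : Iso (V.sum W) (W.sum V) :=
  ⟨LinearEquiv.prodComm k V W, sumCoact_comm V.coact W.coact⟩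

lemma sum_assoc (V W X : Comod k C) : Iso ((V.sum W).sum X) (V.sum (W.sum X)) :=
  ⟨LinearEquiv.prodAssoc k V W X, sumCoact_assoc V.coact W.coact X.coact⟩

lemma zero_sum (V : Comod k C) : Iso (Comod.zero.sum V) V :=
  ⟨(LinearEquiv.uniqueProd : (PUnit.{u + 1} × V) ≃ₗ[k] V), sumCoact_zero V.coact⟩

instance setoid : Setoid (Comod k C) where
  r := Iso
  iseqv := ⟨Iso.refl, Iso.symm, Iso.trans⟩

variable (k C) in
/-- Isomorphism classes of finite-dimensional left `C`-comodules. -/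
def IsoClass : Type (u + 1) := Quotient (setoid (k := k) (C := C))

instance : Zero (IsoClass k C) := ⟨Quotient.mk _ Comod.zero⟩

instance : Add (IsoClass k C) :=
  ⟨Quotient.map₂ Comod.sum fun _ _ h _ _ h' => Iso.sum h h'⟩

instance : AddCommMonoid (IsoClass k C) where
  add_assoc := by
    rintro ⟨V⟩ ⟨W⟩ ⟨X⟩
    exact Quotient.sound (sum_assoc V W X)
  add_comm := by
    rintro ⟨V⟩ ⟨W⟩
    exact Quotient.sound (sum_comm V W)
  zero_add := by
    rintro ⟨V⟩
    exact Quotient.sound (zero_sum V)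
  add_zero := by
    rintro ⟨V⟩
    exact Quotient.sound ((sum_comm V zero).trans (zero_sum V))
  nsmul := nsmulRec

/-- The matrix coefficients of a comodule in a basis. -/
abbrev coeff (V : Comod k C) {ι : Type*} (b : Module.Basis ι k V) (i j : ι) : C :=
  matCoeff V.coact b i j

/-- The character `∑ i, c i i` of a comodule (see `char_eq` for the independence of the basis). -/
def char (V : Comod k C) : C :=
  ∑ i, V.coeff (Module.finBasis k V) i i

lemma dual_sum_coeff (V : Comod k C) {ι : Type*} [Fintype ι] [DecidableEq ι]
    (b : Module.Basis ι k V) (ξ : Module.Dual k C) :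
    ξ (∑ i, V.coeff b i i) =
      LinearMap.trace k V ((TensorProduct.lid k V).toLinearMap ∘ₗ ξ.rTensor V ∘ₗ V.coact) := by
  rw [LinearMap.trace_eq_matrix_trace k b, Matrix.trace, map_sum]
  refine Finset.sum_congr rfl fun i _ => ?_
  rw [Matrix.diag_apply, LinearMap.toMatrix_apply, ← b.coord_apply, coeff, matCoeff]
  simp only [LinearMap.comp_apply, LinearEquiv.coe_coe]
  induction V.coact (b i) with
  | zero => simp
  | tmul x y => simp [mul_comm]
  | add x y hx hy => simp [hx, hy]

lemma char_eq (V : Comod k C) {ι : Type*} [Fintype ι] (b : Module.Basis ι k V) :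
    V.char = ∑ i, V.coeff b i i := by
  classical
  rw [← sub_eq_zero, ← Module.forall_dual_apply_eq_zero_iff k]
  intro ξ
  rw [map_sub, char, dual_sum_coeff, dual_sum_coeff, sub_self]

lemma char_iso {V W : Comod k C} (h : Iso V W) : V.char = W.char := by
  obtain ⟨f, hf⟩ := h
  rw [W.char_eq ((Module.finBasis k V).map f), char]
  refine Finset.sum_congr rfl fun i _ => ?_
  have h1 := LinearMap.congr_fun hf (Module.finBasis k V i)
  simp only [LinearMap.comp_apply, LinearEquiv.coe_coe] at h1
  rw [coeff, coeff, matCoeff, matCoeff, Module.Basis.map_apply, h1, ← LinearMap.lTensor_comp_apply]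
  congr 3
  ext v
  simp

lemma char_sum (V W : Comod k C) : (V.sum W).char = V.char + W.char := by
  refine ((V.sum W).char_eq ((Module.finBasis k V).prod (Module.finBasis k W))).trans ?_
  rw [Fintype.sum_sum_type]
  exact congrArg₂ _ (Finset.sum_congr rfl fun i _ => matCoeff_sum_inl _ _ _ _ i)
    (Finset.sum_congr rfl fun i _ => matCoeff_sum_inr _ _ _ _ i)

lemma coact_eq_sum (V : Comod k C) {ι : Type*} [Fintype ι] (b : Module.Basis ι k V) (i : ι) :
    V.coact (b i) = ∑ j, V.coeff b i j ⊗ₜ[k] b j := by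
  simp only [coeff, matCoeff]
  induction V.coact (b i) with
  | zero => simp
  | tmul x y =>
    simp only [LinearMap.lTensor_tmul, TensorProduct.rid_tmul, Module.Basis.coord_apply,
      TensorProduct.smul_tmul]
    rw [← TensorProduct.tmul_sum, b.sum_repr]
  | add x y hx hy => simp [TensorProduct.add_tmul, Finset.sum_add_distrib, ← hx, ← hy]

lemma comul_coeff (V : Comod k C) {ι : Type*} [Fintype ι] (b : Module.Basis ι k V) (i l : ι) :
    Coalgebra.comul (R := k) (V.coeff b i l) = ∑ j, V.coeff b i j ⊗ₜ[k] V.coeff b j l := by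
  classical
  have h := LinearMap.congr_fun V.isCoact.coassoc (b i)
  have h' := congrArg ((TensorProduct.rid k C).toLinearMap.lTensor C ∘ₗ
    ((b.coord l).lTensor C).lTensor C) h
  have key : ∀ (t : C ⊗[k] C) (r : ι), (TensorProduct.rid k C).toLinearMap.lTensor C
      (((b.coord l).lTensor C).lTensor C (TensorProduct.assoc k C C V (t ⊗ₜ[k] b r))) =
      if r = l then t else 0 := by
    intro t r
    induction t with
    | zero => simp
    | tmul x y => by_cases hr : r = l <;> simp [hr]
    | add x y hx hy =>
      simp only [TensorProduct.add_tmul, map_add, hx, hy]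
      split_ifs <;> simp
  simp only [LinearMap.comp_apply, coact_eq_sum V b, map_sum, LinearMap.lTensor_tmul,
    LinearMap.rTensor_tmul, LinearEquiv.coe_coe, TensorProduct.tmul_sum, key,
    Finset.sum_ite_eq', Finset.mem_univ, if_true] at h'
  refine h'.trans (Finset.sum_congr rfl fun j _ => ?_)
  rw [Finset.sum_eq_single l]
  · simp
  · intro r _ hr
    simp [hr]
  · simp

lemma char_mem (V : Comod k C) : V.char ∈ cotraces k C := by
  simp only [cotraces, LinearMap.mem_eqLocus, LinearMap.comp_apply, char, map_sum, comul_coeff,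
    LinearEquiv.coe_coe, TensorProduct.comm_tmul]
  exact Finset.sum_comm

end Comod

variable (k C) in
/-- `Rep(C)`: the group completion of the monoid of (isomorphism classes of) finite-dimensional
left `C`-comodules under direct sum. -/
abbrev Rep : Type (u + 1) := Algebra.GrothendieckAddGroup (Comod.IsoClass k C)

/-- The class `[V]` in `Rep(C)`. -/
def Rep.mk (V : Comod k C) : Rep k C :=
  Algebra.GrothendieckAddGroup.of (Quotient.mk _ V : Comod.IsoClass k C)

variable (k C) in
/-- The character as an additive map on isomorphism classes. -/
def charHom : Comod.IsoClass k C →+ cotraces k C where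
  toFun := Quotient.lift (fun V => (⟨V.char, V.char_mem⟩ : cotraces k C))
    fun _ _ h => Subtype.ext (Comod.char_iso h)
  map_zero' := by
    apply Subtype.ext
    let b : Module.Basis (Fin 0) k (PUnit.{u + 1}) := Module.Basis.empty _
    change Comod.char Comod.zero = 0
    rw [Comod.char_eq Comod.zero b, Fintype.sum_empty]
  map_add' := by
    rintro ⟨V⟩ ⟨W⟩
    exact Subtype.ext (Comod.char_sum V W)

variable (k C) in
/-- The character map `χ : Rep(C) → C^tr`, `[V] ↦ χ(V)`. -/
def chi : Rep k C →+ cotraces k C :=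
  Algebra.GrothendieckAddGroup.lift (charHom k C)

lemma chi_mk (V : Comod k C) : (chi k C (Rep.mk V) : C) = V.char := by
  have h := DFunLike.congr_fun (Algebra.GrothendieckAddGroup.lift.symm_apply_apply (charHom k C))
    (Quotient.mk _ V : Comod.IsoClass k C)
  exact congrArg Subtype.val h

end Rep

/-! ### The group `K₀` -/

section KZero

/-- A finitely generated projective left module over a ring `B`. -/
structure FGProj (B : Type u) [Ring B] where
  carrier : Type u
  [grp : AddCommGroup carrier]
  [mod : Module B carrier]
  [fin : Module.Finite B carrier]
  [proj : Module.Projective B carrier]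

attribute [instance] FGProj.grp FGProj.mod FGProj.fin FGProj.proj

variable {B : Type u} [Ring B]

namespace FGProj

instance : CoeSort (FGProj B) (Type u) := ⟨FGProj.carrier⟩

instance setoid : Setoid (FGProj B) where
  r P Q := Nonempty (P ≃ₗ[B] Q)
  iseqv := ⟨fun P => ⟨LinearEquiv.refl B P⟩, fun ⟨f⟩ => ⟨f.symm⟩,
    fun ⟨f⟩ ⟨g⟩ => ⟨f.trans g⟩⟩

variable (B) in
/-- Isomorphism classes of finitely generated projective left `B`-modules. -/
def IsoClass : Type (u + 1) := Quotient (setoid (B := B))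

instance : Zero (IsoClass B) := ⟨Quotient.mk _ ⟨PUnit⟩⟩

instance : Add (IsoClass B) :=
  ⟨Quotient.map₂ (fun P Q => ⟨P × Q⟩)
    fun _ _ ⟨f⟩ _ _ ⟨g⟩ => ⟨LinearEquiv.prodCongr f g⟩⟩

instance : AddCommMonoid (IsoClass B) where
  add_assoc := by
    rintro ⟨P⟩ ⟨Q⟩ ⟨R⟩
    exact Quotient.sound ⟨LinearEquiv.prodAssoc B P Q R⟩
  add_comm := by
    rintro ⟨P⟩ ⟨Q⟩
    exact Quotient.sound ⟨LinearEquiv.prodComm B P Q⟩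
  zero_add := by
    rintro ⟨P⟩
    exact Quotient.sound ⟨(LinearEquiv.uniqueProd : (PUnit.{u + 1} × P) ≃ₗ[B] P)⟩
  add_zero := by
    rintro ⟨P⟩
    exact Quotient.sound ⟨(LinearEquiv.prodUnique : (P × PUnit.{u + 1}) ≃ₗ[B] P)⟩
  nsmul := nsmulRec

end FGProj

variable (B) in
/-- `K₀(B)`: the group completion of the monoid of (isomorphism classes of) finitely generated
projective left `B`-modules under direct sum. -/
abbrev KZero : Type (u + 1) := Algebra.GrothendieckAddGroup (FGProj.IsoClass B)

/-- The class `[P]` in `K₀(B)`. -/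
def KZero.mk (P : FGProj B) : KZero B :=
  Algebra.GrothendieckAddGroup.of (Quotient.mk _ P : FGProj.IsoClass B)

end KZero

/-! ### Cyclic homology -/

section Cyclic

variable (k : Type u) [Field k]

/-- The tensor power `B^{⊗(m+1)}` over `k`. -/
abbrev TPow (B : Type u) [AddCommGroup B] [Module k B] (m : ℕ) : Type u :=
  ⨂[k] (_ : Fin (m + 1)), B

variable (B : Type u) [Ring B] [Algebra k B]

/-- The unsigned rotation `b₀ ⊗ ⋯ ⊗ bₘ ↦ bₘ ⊗ b₀ ⊗ ⋯ ⊗ bₘ₋₁`. -/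
def rot (m : ℕ) : TPow k B m →ₗ[k] TPow k B m :=
  (PiTensorProduct.reindex k (fun _ : Fin (m + 1) => B) (finRotate (m + 1))).toLinearMap

lemma rot_tprod (m : ℕ) (b : Fin (m + 1) → B) :
    rot k B m (PiTensorProduct.tprod k b) = PiTensorProduct.tprod k fun i => b (i - 1) := by
  rw [rot, LinearEquiv.coe_coe, PiTensorProduct.reindex_tprod]
  congr 1
  funext i
  congr 1
  rw [Equiv.symm_apply_eq, finRotate_apply, sub_add_cancel]

/-- The cyclic operator `t(b₀ ⊗ ⋯ ⊗ bₘ) = (-1)^m bₘ ⊗ b₀ ⊗ ⋯ ⊗ bₘ₋₁`. -/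
def cyc (m : ℕ) : TPow k B m →ₗ[k] TPow k B m := (-1 : k) ^ m • rot k B m

/-- The norm operator `N = 1 + t + ⋯ + t^m`. -/
def cyclicNorm (m : ℕ) : TPow k B m →ₗ[k] TPow k B m := ∑ j ∈ Finset.range (m + 1), cyc k B m ^ j

variable {B} in
lemma contractNth_update (m : ℕ) (i : Fin (m + 1)) (b : Fin (m + 2) → B) (p : Fin (m + 2)) :
    ∃ (q : Fin (m + 1)) (f : B →ₗ[k] B), ∀ v,
      Fin.contractNth i.castSucc (· * ·) (Function.update b p v) =
        Function.update (Fin.contractNth i.castSucc (· * ·) b) q (f v) := by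
  rcases lt_trichotomy (p : ℕ) i with h | h | h
  · refine ⟨⟨p, by omega⟩, LinearMap.id, fun v => funext fun r => ?_⟩
    simp only [Fin.contractNth, Function.update_apply, Fin.ext_iff, Fin.val_castSucc,
      Fin.val_succ, LinearMap.id_apply]
    split_ifs <;> first | rfl | omega
  · refine ⟨i, LinearMap.mulRight k (b i.succ), fun v => funext fun r => ?_⟩
    by_cases hr : r = i
    · subst hr
      simp [Fin.contractNth, Function.update_apply, Fin.ext_iff, h]
    · have hr' : (r : ℕ) ≠ i := fun h' => hr (Fin.ext h')
      simp only [Fin.contractNth, Function.update_apply, Fin.ext_iff, Fin.val_castSucc,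
        Fin.val_succ]
      split_ifs <;> first | rfl | omega
  · by_cases hp : (p : ℕ) = i + 1
    · refine ⟨i, LinearMap.mulLeft k (b i.castSucc), fun v => funext fun r => ?_⟩
      by_cases hr : r = i
      · subst hr
        simp [Fin.contractNth, Function.update_apply, Fin.ext_iff, hp]
      · have hr' : (r : ℕ) ≠ i := fun h' => hr (Fin.ext h')
        simp only [Fin.contractNth, Function.update_apply, Fin.ext_iff, Fin.val_castSucc,
          Fin.val_succ]
        split_ifs <;> first | rfl | omega
    · refine ⟨⟨p - 1, by omega⟩, LinearMap.id, fun v => funext fun r => ?_⟩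
      simp only [Fin.contractNth, Function.update_apply, Fin.ext_iff, Fin.val_castSucc,
        Fin.val_succ, LinearMap.id_apply]
      split_ifs <;> first | rfl | omega

/-- The face operator `b₀ ⊗ ⋯ ⊗ bₘ₊₁ ↦ b₀ ⊗ ⋯ ⊗ bᵢbᵢ₊₁ ⊗ ⋯ ⊗ bₘ₊₁`, `0 ≤ i ≤ m`. -/
def face (m : ℕ) (i : Fin (m + 1)) : TPow k B (m + 1) →ₗ[k] TPow k B m :=
  PiTensorProduct.lift (MultilinearMap.mk'
    (fun b : Fin (m + 2) → B =>
      PiTensorProduct.tprod k (Fin.contractNth i.castSucc (· * ·) b))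
    (fun b p v w => by
      obtain ⟨q, f, h⟩ := contractNth_update k m i b p
      rw [h, h, h, map_add, MultilinearMap.map_update_add])
    (fun b p c v => by
      obtain ⟨q, f, h⟩ := contractNth_update k m i b p
      rw [h, h, map_smul, MultilinearMap.map_update_smul]))

/-- The bar differential `b' = ∑_{i=0}^{m} (-1)^i dᵢ`. -/
def barDiff (m : ℕ) : TPow k B (m + 1) →ₗ[k] TPow k B m :=
  ∑ i : Fin (m + 1), (-1 : k) ^ (i : ℕ) • face k B m i

/-- The Hochschild differential `b = b' + (-1)^{m+1} dₘ₊₁`, where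
`dₘ₊₁(b₀ ⊗ ⋯ ⊗ bₘ₊₁) = bₘ₊₁b₀ ⊗ b₁ ⊗ ⋯ ⊗ bₘ`. -/
def hochDiff (m : ℕ) : TPow k B (m + 1) →ₗ[k] TPow k B m :=
  barDiff k B m + (-1 : k) ^ (m + 1) • (face k B m 0 ∘ₗ rot k B (m + 1))

/-- `Tot CC_d(B) = ⨁_{m=0}^{d} B^{⊗(m+1)}`; the `m`-th summand sits in column `d - m`. -/
abbrev Tot (d : ℕ) : Type u := (m : Fin (d + 1)) → TPow k B m

/-- The differential of the total complex of the cyclic bicomplex: even columns carry `b`, odd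
columns carry `-b'`, the horizontal maps are `1 - t` out of odd columns and `N` out of positive
even columns. -/
def totDiff (d : ℕ) : Tot k B (d + 1) →ₗ[k] Tot k B d :=
  LinearMap.pi fun m =>
    if Even (d - (m : ℕ)) then
      hochDiff k B m ∘ₗ LinearMap.proj m.succ +
        (LinearMap.id - cyc k B m) ∘ₗ LinearMap.proj m.castSucc
    else
      cyclicNorm k B m ∘ₗ LinearMap.proj m.castSucc - barDiff k B m ∘ₗ LinearMap.proj m.succ

/-- Cycles of degree `d` in `Tot CC(B)`. -/
def cycles : (d : ℕ) → Submodule k (Tot k B d)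
  | 0 => ⊤
  | d + 1 => LinearMap.ker (totDiff k B d)

/-- The cyclic homology `HC_d(B)`: cycles modulo boundaries. -/
abbrev HC (d : ℕ) : Type u :=
  cycles k B d ⧸ (LinearMap.range (totDiff k B d)).submoduleOf (cycles k B d)

variable {k B} in
/-- The chain `z` is a cycle whose homology class is `h`. -/
def Represents {d : ℕ} (z : Tot k B d) (h : HC k B d) : Prop :=
  ∃ hz : z ∈ cycles k B d, h = Submodule.Quotient.mk ⟨z, hz⟩

/-- The coefficient `(-1)^⌊m/2⌋ m! / ⌊m/2⌋!` (an integer). -/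
def chernCoeff (m : ℕ) : ℤ := (-1) ^ (m / 2) * (m.factorial / (m / 2).factorial : ℕ)

variable {k B} in
/-- The chain `∑_{m=0}^{2n} (-1)^⌊m/2⌋ m!/⌊m/2⌋! xₘ` attached to a sequence `xₘ ∈ B^{⊗(m+1)}`. -/
def chernChain (n : ℕ) (x : (m : ℕ) → TPow k B m) : Tot k B (2 * n) :=
  fun m => (chernCoeff m : k) • x m

variable {B} in
/-- The generalized trace `tr(e ⊗ ⋯ ⊗ e) = ∑ e_{i₀i₁} ⊗ e_{i₁i₂} ⊗ ⋯ ⊗ e_{iₘi₀}`. -/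
def idemTrace {N : ℕ} (e : Matrix (Fin N) (Fin N) B) (m : ℕ) : TPow k B m :=
  ∑ i : Fin (m + 1) → Fin N, PiTensorProduct.tprod k fun r => e (i r) (i (r + 1))

variable {k B} in
/-- `ch` is the Chern character `ch_n : K₀(B) → HC_{2n}(B)`: on the class of a module isomorphic to
`B^N e` (row vectors), with `e` an idempotent matrix, it is the homology class of
`∑ₘ (-1)^⌊m/2⌋ m!/⌊m/2⌋! tr(e^{⊗(m+1)})`. -/
def IsChernCharacter (n : ℕ) (ch : KZero B →+ HC k B (2 * n)) : Prop :=
  ∀ (N : ℕ) (e : Matrix (Fin N) (Fin N) B), e * e = e → ∀ P : FGProj B,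
    Nonempty (P ≃ₗ[B] LinearMap.range e.vecMulLinear) →
      Represents (chernChain n (idemTrace k e)) (ch (KZero.mk P))

end Cyclic

/-! ### Coalgebra-Galois extensions -/

section Galois

variable {k C A : Type u} [Field k] [AddCommGroup C] [Module k C] [Ring A] [Algebra k A]

/-- The subalgebra `{b | ρ(ba) = bρ(a) for all a}`. For a coalgebra-Galois extension this is
`{b | ρ(b) = b ⊗ e}`, see `GaloisExt.mem_inv_iff`. -/
def coinv (ρ : A →ₗ[k] A ⊗[k] C) : Subalgebra k A where
  carrier := {b | ∀ a, ρ (b * a) = b • ρ a}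
  mul_mem' := by
    intro b b' hb hb' a
    rw [mul_assoc, hb, hb', mul_smul]
  add_mem' := by
    intro b b' hb hb' a
    rw [add_mul, map_add, hb, hb', add_smul]
  algebraMap_mem' := by
    intro r a
    rw [← Algebra.smul_def, map_smul, algebraMap_smul]

/-- The relations `ab ⊗ a' = a ⊗ ba'`, `b ∈ B`. -/
def balancedRel (B : Subalgebra k A) : Submodule k (A ⊗[k] A) :=
  Submodule.span k {t | ∃ (a a' : A) (b : B), t = (a * b) ⊗ₜ[k] a' - a ⊗ₜ[k] (b * a')}

/-- The tensor product `A ⊗_B A` over a (noncommutative) subalgebra `B`. -/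
abbrev BalTensor (B : Subalgebra k A) : Type u := (A ⊗[k] A) ⧸ balancedRel B

/-- `A ⊗ A → A ⊗ C`, `a ⊗ a' ↦ a a'₍₀₎ ⊗ a'₍₁₎`. -/
def preCan (ρ : A →ₗ[k] A ⊗[k] C) : A ⊗[k] A →ₗ[k] A ⊗[k] C :=
  (LinearMap.mul' k A).rTensor C ∘ₗ (TensorProduct.assoc k A A C).symm.toLinearMap ∘ₗ
    ρ.lTensor A

lemma preCan_tmul (ρ : A →ₗ[k] A ⊗[k] C) (a a' : A) :
    preCan ρ (a ⊗ₜ[k] a') = a • ρ a' := by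
  simp only [preCan, LinearMap.comp_apply, LinearMap.lTensor_tmul, LinearEquiv.coe_coe]
  induction ρ a' with
  | zero => simp
  | tmul x y => simp [TensorProduct.smul_tmul']
  | add x y hx hy => simp [TensorProduct.tmul_add, hx, hy]

/-- The canonical map `can : A ⊗_B A → A ⊗ C`. -/
def can (ρ : A →ₗ[k] A ⊗[k] C) : BalTensor (coinv ρ) →ₗ[k] A ⊗[k] C :=
  (balancedRel (coinv ρ)).liftQ (preCan ρ) (by
    refine Submodule.span_le.2 ?_
    rintro _ ⟨a, a', b, rfl⟩
    simp only [SetLike.mem_coe, LinearMap.mem_ker, map_sub, preCan_tmul, b.2 a', mul_smul,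
      sub_self])

/-- The right action of `A` on `A ⊗_B A`. -/
def balRight (B : Subalgebra k A) : BalTensor B →ₗ[k] A →ₗ[k] BalTensor B :=
  (balancedRel B).liftQ
    (((LinearMap.mul k (A ⊗[k] A)).compl₂ (TensorProduct.mk k A A 1)).compr₂
      (balancedRel B).mkQ) (by
    refine Submodule.span_le.2 ?_
    rintro _ ⟨a, a', b, rfl⟩
    refine LinearMap.mem_ker.2 (LinearMap.ext fun c => ?_)
    simp only [LinearMap.compr₂_apply, LinearMap.compl₂_apply, LinearMap.mul_apply',
      TensorProduct.mk_apply, sub_mul, Algebra.TensorProduct.tmul_mul_tmul, mul_one,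
      LinearMap.zero_apply, Submodule.mkQ_apply, mul_assoc]
    rw [Submodule.Quotient.mk_eq_zero]
    exact Submodule.subset_span ⟨a, a' * c, b, rfl⟩)

lemma can_mk (ρ : A →ₗ[k] A ⊗[k] C) (t : A ⊗[k] A) :
    can ρ (Submodule.Quotient.mk t) = preCan ρ t := rfl

lemma balRight_mk (B : Subalgebra k A) (t : A ⊗[k] A) (a : A) :
    balRight B (Submodule.Quotient.mk t) a = Submodule.Quotient.mk (t * (1 ⊗ₜ[k] a)) := rfl

lemma preCan_smul (ρ : A →ₗ[k] A ⊗[k] C) (a : A) (t : A ⊗[k] A) :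
    preCan ρ ((a ⊗ₜ[k] 1) * t) = a • preCan ρ t := by
  induction t with
  | zero => simp
  | tmul x y => simp [preCan_tmul, mul_smul]
  | add x y hx hy => simp [mul_add, hx, hy]

/-- The translation map `τ(c) = can⁻¹(1 ⊗ c)`. -/
def translation (ρ : A →ₗ[k] A ⊗[k] C) (h : Function.Bijective (can ρ)) :
    C →ₗ[k] BalTensor (coinv ρ) :=
  (LinearEquiv.ofBijective (can ρ) h).symm.toLinearMap ∘ₗ TensorProduct.mk k A C 1

/-- The canonical entwining `ψ(c ⊗ a) = can(can⁻¹(1 ⊗ c) a)`. -/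
def entwining (ρ : A →ₗ[k] A ⊗[k] C) (h : Function.Bijective (can ρ)) :
    C ⊗[k] A →ₗ[k] A ⊗[k] C :=
  can ρ ∘ₗ TensorProduct.lift (balRight (coinv ρ) ∘ₗ translation ρ h)

lemma mulAssoc_tmul (a : A) (z : A ⊗[k] C) :
    (LinearMap.mul' k A).rTensor C ((TensorProduct.assoc k A A C).symm (a ⊗ₜ[k] z)) = a • z := by
  induction z with
  | zero => simp
  | tmul x y => simp [TensorProduct.smul_tmul']
  | add x y hx hy => simp [TensorProduct.tmul_add, hx, hy]

variable [Coalgebra k C]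

variable (k C A) in
/-- A `C`-Galois extension `B ⊆ A` with bijective canonical entwining, for a coalgebra `C` with a
group-like element `e`. -/
structure GaloisExt where
  ρ : A →ₗ[k] A ⊗[k] C
  isCoact : IsRightCoaction ρ
  e : C
  e_groupLike : IsGroupLikeElem k e
  ρ_one : ρ 1 = 1 ⊗ₜ[k] e
  can_bijective : Function.Bijective (can ρ)
  entwining_bijective : Function.Bijective (entwining ρ can_bijective)

namespace GaloisExt

variable (E : GaloisExt k C A)

/-- The subalgebra `B = A^{co C}` of coaction invariants. -/
abbrev inv : Subalgebra k A := coinv E.ρ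

/-- The canonical entwining. -/
abbrev ψ : C ⊗[k] A →ₗ[k] A ⊗[k] C := entwining E.ρ E.can_bijective

/-- The left coaction `a ↦ ψ⁻¹(a ⊗ e)` on `A`. -/
def leftCoact : A →ₗ[k] C ⊗[k] A :=
  (LinearEquiv.ofBijective E.ψ E.entwining_bijective).symm.toLinearMap ∘ₗ
    (TensorProduct.mk k A C).flip E.e

lemma ψ_leftCoact (a : A) : E.ψ (E.leftCoact a) = a ⊗ₜ[k] E.e :=
  (LinearEquiv.ofBijective E.ψ E.entwining_bijective).apply_symm_apply _

lemma mem_inv_iff (b : A) : b ∈ E.inv ↔ E.ρ b = b ⊗ₜ[k] E.e := by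
  constructor
  · intro h
    have h1 := h 1
    rwa [mul_one, E.ρ_one, TensorProduct.smul_tmul', smul_eq_mul, mul_one] at h1
  · intro h a
    have h1 : can E.ρ (Submodule.Quotient.mk (1 ⊗ₜ[k] b)) =
        can E.ρ (Submodule.Quotient.mk (b ⊗ₜ[k] 1)) := by
      rw [can_mk, can_mk, preCan_tmul, preCan_tmul, E.ρ_one, h]
      simp [TensorProduct.smul_tmul']
    have h2 := E.can_bijective.1 h1
    have h3 := congrArg (fun t => can E.ρ (balRight E.inv t a)) h2
    simpa only [balRight_mk, can_mk, Algebra.TensorProduct.tmul_mul_tmul, preCan_tmul, one_mul,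
      mul_one, one_smul] using h3

/-- The map `A ⊗ C ⊗ A → A ⊗ C`, `a ⊗ c ⊗ a' ↦ a ψ(c ⊗ a')`. -/
def entwiningMul : (A ⊗[k] C) ⊗[k] A →ₗ[k] A ⊗[k] C :=
  (LinearMap.mul' k A).rTensor C ∘ₗ (TensorProduct.assoc k A A C).symm.toLinearMap ∘ₗ
    E.ψ.lTensor A ∘ₗ (TensorProduct.assoc k A C A).toLinearMap

lemma entwiningMul_tmul (a : A) (c : C) (a' : A) :
    E.entwiningMul ((a ⊗ₜ[k] c) ⊗ₜ[k] a') = a • E.ψ (c ⊗ₜ[k] a') := by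
  simp only [entwiningMul, LinearMap.comp_apply, LinearEquiv.coe_coe, TensorProduct.assoc_tmul,
    LinearMap.lTensor_tmul, mulAssoc_tmul]

lemma entwiningMul_aux (z : A ⊗[k] C) : ∃ s, preCan E.ρ s = z ∧
    ∀ a', E.entwiningMul (z ⊗ₜ[k] a') = preCan E.ρ (s * (1 ⊗ₜ[k] a')) := by
  induction z with
  | zero => exact ⟨0, by simp⟩
  | tmul a c =>
    obtain ⟨s, hs⟩ := Submodule.Quotient.mk_surjective _ (translation E.ρ E.can_bijective c)
    have hc : can E.ρ (translation E.ρ E.can_bijective c) = 1 ⊗ₜ[k] c :=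
      (LinearEquiv.ofBijective (can E.ρ) E.can_bijective).apply_symm_apply _
    refine ⟨(a ⊗ₜ[k] 1) * s, ?_, fun a' => ?_⟩
    · rw [preCan_smul, ← can_mk, hs, hc, TensorProduct.smul_tmul', smul_eq_mul, mul_one]
    · rw [entwiningMul_tmul, mul_assoc, preCan_smul, ← can_mk, ← balRight_mk, hs]
      rfl
  | add x y hx hy =>
    obtain ⟨s, h1, h2⟩ := hx
    obtain ⟨s', h1', h2'⟩ := hy
    exact ⟨s + s', by rw [map_add, h1, h1'], fun a' => by
      rw [TensorProduct.add_tmul, map_add, h2, h2', add_mul, map_add]⟩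

lemma entwiningMul_preCan (s : A ⊗[k] A) (a' : A) :
    E.entwiningMul (preCan E.ρ s ⊗ₜ[k] a') = preCan E.ρ (s * (1 ⊗ₜ[k] a')) := by
  obtain ⟨s', h1, h2⟩ := E.entwiningMul_aux (preCan E.ρ s)
  rw [← can_mk, ← can_mk] at h1
  rw [h2, ← can_mk, ← can_mk, ← balRight_mk, ← balRight_mk, E.can_bijective.1 h1]

lemma entwiningMul_rTensor (t : A ⊗[k] A) :
    E.entwiningMul (E.ρ.rTensor A t) = E.ρ (LinearMap.mul' k A t) := by
  induction t with
  | zero => simp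
  | tmul a a' =>
    have h : E.ρ a = preCan E.ρ (1 ⊗ₜ[k] a) := by rw [preCan_tmul, one_smul]
    rw [LinearMap.rTensor_tmul, h, entwiningMul_preCan, Algebra.TensorProduct.tmul_mul_tmul,
      preCan_tmul, one_mul, one_smul, LinearMap.mul'_apply]
  | add x y hx hy => simp only [map_add, hx, hy]

lemma entwiningMul_lTensor (t : A ⊗[k] A) :
    E.entwiningMul ((TensorProduct.assoc k A C A).symm (E.leftCoact.lTensor A t)) =
      LinearMap.mul' k A t ⊗ₜ[k] E.e := by
  induction t with
  | zero => simp
  | tmul a a' =>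
    simp only [entwiningMul, LinearMap.comp_apply, LinearEquiv.coe_coe,
      LinearEquiv.apply_symm_apply, LinearMap.lTensor_tmul, mulAssoc_tmul, ψ_leftCoact,
      TensorProduct.smul_tmul', smul_eq_mul, LinearMap.mul'_apply]
  | add x y hx hy => simp only [map_add, hx, hy, TensorProduct.add_tmul]

/-- The Ehresmann–Schauenburg space `M = A □^C A`. -/
abbrev M : Submodule k (A ⊗[k] A) := cotensor E.ρ E.leftCoact

lemma mul_mem_inv (t : A ⊗[k] A) (ht : t ∈ E.M) : LinearMap.mul' k A t ∈ E.inv := by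
  rw [mem_inv_iff, ← entwiningMul_rTensor, LinearMap.mem_eqLocus.1 ht]
  exact E.entwiningMul_lTensor t

/-- The augmentation `ε : M → B`, `∑ aᵢ ⊗ a'ᵢ ↦ ∑ aᵢa'ᵢ`. -/
def aug : E.M →ₗ[k] E.inv :=
  ((LinearMap.mul' k A).comp E.M.subtype).codRestrict E.inv.toSubmodule
    fun t => E.mul_mem_inv t t.2

/-- The left `B`-module `A □^C V` associated with a finite-dimensional left comodule `V`. -/
def assocModule (V : Comod k C) : Submodule E.inv (A ⊗[k] V) where
  carrier := cotensor E.ρ V.coact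
  add_mem' := (cotensor E.ρ V.coact).add_mem
  zero_mem' := (cotensor E.ρ V.coact).zero_mem
  smul_mem' := by
    intro b x hx
    have h1 : ∀ y : A ⊗[k] V, E.ρ.rTensor V ((b : A) • y) = (b : A) • E.ρ.rTensor V y := by
      intro y
      induction y with
      | zero => simp
      | tmul a v =>
        rw [TensorProduct.smul_tmul', LinearMap.rTensor_tmul, LinearMap.rTensor_tmul,
          TensorProduct.smul_tmul']
        exact congrArg (· ⊗ₜ[k] v) (b.2 a)
      | add y z hy hz => simp only [smul_add, map_add, hy, hz]
    have h2 : ∀ y : A ⊗[k] V, V.coact.lTensor A ((b : A) • y) = (b : A) • V.coact.lTensor A y := by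
      intro y
      induction y with
      | zero => simp
      | tmul a v => simp only [TensorProduct.smul_tmul', LinearMap.lTensor_tmul]
      | add y z hy hz => simp only [smul_add, map_add, hy, hz]
    have h3 : ∀ y : A ⊗[k] (C ⊗[k] V), (TensorProduct.assoc k A C V).symm ((b : A) • y) =
        (b : A) • (TensorProduct.assoc k A C V).symm y := by
      intro y
      induction y with
      | zero => simp
      | tmul a w =>
        induction w with
        | zero => simp
        | tmul c v => simp only [TensorProduct.smul_tmul', TensorProduct.assoc_symm_tmul]
        | add w z hw hz => simp only [TensorProduct.tmul_add, smul_add, map_add, hw, hz]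
      | add y z hy hz => simp only [smul_add, map_add, hy, hz]
    have hx' := LinearMap.mem_eqLocus.1 hx
    refine LinearMap.mem_eqLocus.2 ?_
    simp only [LinearMap.comp_apply, LinearEquiv.coe_coe] at hx' ⊢
    rw [Subalgebra.smul_def, h1, h2, h3, hx']

end GaloisExt
end Galois

/-! ### Strong connections and the maps of the diagram -/

section Shift

variable {k A : Type u} [Field k] [Ring A] [Algebra k A]

lemma list_prod_mul {ι R : Type*} [Monoid R] (l : List ι) (f g : ι → R)
    (h : ∀ i j, Commute (f i) (g j)) :
    (l.map fun i => f i * g i).prod = (l.map f).prod * (l.map g).prod := by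
  induction l with
  | nil => simp
  | cons a l ih =>
    have hc : Commute (l.map f).prod (g a) := Commute.list_prod_left _ _ (by
      intro x hx
      obtain ⟨i, _, rfl⟩ := List.mem_map.1 hx
      exact h i a)
    simp only [List.map_cons, List.prod_cons, ih]
    rw [mul_assoc, ← mul_assoc (g a), ← hc.eq]
    simp only [mul_assoc]

lemma list_prod_eq {ι R : Type*} [Monoid R] (l : List ι) (hl : l.Nodup) (s : ι) (hs : s ∈ l)
    (f : ι → R) (h : ∀ i, i ≠ s → f i = 1) : (l.map f).prod = f s := by
  induction l with
  | nil => simp at hs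
  | cons a l ih =>
    rw [List.map_cons, List.prod_cons]
    rw [List.nodup_cons] at hl
    by_cases ha : a = s
    · subst ha
      have : (l.map f).prod = 1 := List.prod_eq_one (by
        intro x hx
        obtain ⟨i, hi, rfl⟩ := List.mem_map.1 hx
        exact h i fun e => hl.1 (e ▸ hi))
      rw [this, mul_one]
    · rw [h a ha, one_mul, ih hl.2]
      exact (List.mem_cons.1 hs).resolve_left fun e => ha e.symm

variable {S : Type u} [Ring S] [Algebra k S]

/-- The part of `regroup` coming from the `r`-th factor: it puts `g x` into the `r`-th factor and
`f y` into the `(r+1)`-st factor. -/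
def regroupFactor (f g : A →ₗ[k] S) (m : ℕ) (r : Fin (m + 1)) : A ⊗[k] A →ₗ[k] TPow k S m :=
  TensorProduct.lift ((LinearMap.mul k (TPow k S m)).compl₁₂
    ((PiTensorProduct.singleAlgHom (R := k) (A := fun _ : Fin (m + 1) => S) r).toLinearMap ∘ₗ g)
    ((PiTensorProduct.singleAlgHom (R := k) (A := fun _ : Fin (m + 1) => S)
      (r + 1)).toLinearMap ∘ₗ f))

/-- `(x₀ ⊗ y₀) ⊗ ⋯ ⊗ (xₘ ⊗ yₘ) ↦ f(yₘ)g(x₀) ⊗ f(y₀)g(x₁) ⊗ ⋯ ⊗ f(yₘ₋₁)g(xₘ)`, when the images of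
`f` and `g` commute. -/
def regroup (f g : A →ₗ[k] S) (m : ℕ) : TPow k (A ⊗[k] A) m →ₗ[k] TPow k S m :=
  PiTensorProduct.lift
    ((MultilinearMap.mkPiAlgebraFin k (m + 1) (TPow k S m)).compLinearMap (regroupFactor f g m))

lemma regroup_tprod (f g : A →ₗ[k] S) (hfg : ∀ x y, Commute (f x) (g y)) (m : ℕ)
    (x y : Fin (m + 1) → A) :
    regroup f g m (PiTensorProduct.tprod k fun r => x r ⊗ₜ[k] y r) =
      PiTensorProduct.tprod k fun r => f (y (r - 1)) * g (x r) := by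
  have h1 : ∀ r, regroupFactor f g m r (x r ⊗ₜ[k] y r) =
      PiTensorProduct.tprodMonoidHom k (A := fun _ : Fin (m + 1) => S)
        (Pi.mulSingle r (g (x r)) * Pi.mulSingle (r + 1) (f (y r))) := by
    intro r
    rw [map_mul]
    rfl
  rw [regroup, PiTensorProduct.lift.tprod, MultilinearMap.compLinearMap_apply,
    MultilinearMap.mkPiAlgebraFin_apply, List.ofFn_eq_map]
  simp only [h1]
  rw [← Function.comp_def (PiTensorProduct.tprodMonoidHom k (A := fun _ : Fin (m + 1) => S)),
    ← List.map_map, ← map_list_prod]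
  change PiTensorProduct.tprod k _ = _
  congr 1
  funext s
  have h2 := map_list_prod (Pi.evalMonoidHom (fun _ : Fin (m + 1) => S) s)
    ((List.finRange (m + 1)).map fun r : Fin (m + 1) =>
      (Pi.mulSingle r (g (x r)) * Pi.mulSingle (r + 1) (f (y r)) : Fin (m + 1) → S))
  rw [List.map_map] at h2
  refine h2.trans ?_
  have hc : ∀ i j : Fin (m + 1), Commute (Pi.mulSingle (M := fun _ => S) i (g (x i)) s)
      (Pi.mulSingle (M := fun _ => S) (j + 1) (f (y j)) s) := by
    intro i j
    rw [Pi.mulSingle_apply, Pi.mulSingle_apply]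
    split_ifs
    · exact (hfg _ _).symm
    · exact Commute.one_right _
    · exact Commute.one_left _
    · exact Commute.one_left _
  refine (list_prod_mul (List.finRange (m + 1)) _ _ hc).trans ?_
  rw [list_prod_eq _ (List.nodup_finRange _) s (List.mem_finRange s) _
      (fun i hi => Pi.mulSingle_eq_of_ne hi.symm _),
    list_prod_eq _ (List.nodup_finRange _) (s - 1) (List.mem_finRange _) _
      (fun i hi => Pi.mulSingle_eq_of_ne (fun e => hi (by rw [e, add_sub_cancel_right])) _)]
  rw [Pi.mulSingle_eq_same, (hfg _ _).eq]
  congr 1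
  simp only [Pi.mulSingle_apply, sub_add_cancel, if_true]

variable (k A) in
/-- The regrouping map
`(x₀ ⊗ y₀) ⊗ ⋯ ⊗ (xₘ ⊗ yₘ) ↦ (yₘ ⊗ x₀) ⊗ (y₀ ⊗ x₁) ⊗ ⋯ ⊗ (yₘ₋₁ ⊗ xₘ)`, see `shift_tprod`. -/
def shift (m : ℕ) : TPow k (A ⊗[k] A) m →ₗ[k] TPow k (A ⊗[k] A) m :=
  regroup ((TensorProduct.mk k A A).flip 1) (TensorProduct.mk k A A 1) m

lemma shift_tprod (m : ℕ) (x y : Fin (m + 1) → A) :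
    shift k A m (PiTensorProduct.tprod k fun r => x r ⊗ₜ[k] y r) =
      PiTensorProduct.tprod k fun r => y (r - 1) ⊗ₜ[k] x r := by
  refine (regroup_tprod _ _ (fun x y => by simp [Commute, SemiconjBy]) m x y).trans ?_
  simp

end Shift

section Maps

variable {k C A : Type u} [Field k] [AddCommGroup C] [Module k C] [Coalgebra k C]
  [Ring A] [Algebra k A]

variable (k C) in
/-- The iterated coproduct `c ↦ c₍₁₎ ⊗ ⋯ ⊗ c₍ₘ₊₁₎`. -/
def iterComul : (m : ℕ) → C →ₗ[k] TPow k C m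
  | 0 => (PiTensorProduct.subsingletonEquiv (R := k) (s := fun _ : Fin 1 => C) 0).symm.toLinearMap
  | m + 1 => (TensorPower.mulEquiv (R := k) (M := C) (n := m + 1) (m := 1)).toLinearMap ∘ₗ
      TensorProduct.map (iterComul m)
        (PiTensorProduct.subsingletonEquiv (R := k) (s := fun _ : Fin 1 => C) 0).symm.toLinearMap ∘ₗ
      Coalgebra.comul

namespace GaloisExt

variable (E : GaloisExt k C A)

/-- A strong connection: a bicolinear lifting `ℓ : C → A ⊗ A` of the translation map. -/
structure IsStrongConnection (ℓ : C →ₗ[k] A ⊗[k] A) : Prop where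
  lift : (balancedRel E.inv).mkQ ∘ₗ ℓ = translation E.ρ E.can_bijective
  left_colinear : E.leftCoact.rTensor A ∘ₗ ℓ =
    (TensorProduct.assoc k C A A).symm.toLinearMap ∘ₗ ℓ.lTensor C ∘ₗ Coalgebra.comul
  right_colinear : E.ρ.lTensor A ∘ₗ ℓ =
    (TensorProduct.assoc k A A C).toLinearMap ∘ₗ ℓ.rTensor C ∘ₗ Coalgebra.comul

/-- `F : Rep(C) → K₀(B)` is the map `[V] ↦ [A □^C V]`; in particular each `A □^C V` is a finitely
generated projective left `B`-module. -/
def IsAssociated (F : Rep k C →+ KZero E.inv) : Prop :=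
  ∀ V : Comod k C, ∃ P : FGProj E.inv,
    Nonempty (P ≃ₗ[E.inv] E.assocModule V) ∧ F (Rep.mk V) = KZero.mk P

/-- The element `cₘ(ℓ)(c) = (c₍ₘ₊₁₎⟨2⟩ ⊗ c₍₁₎⟨1⟩) ⊗ (c₍₁₎⟨2⟩ ⊗ c₍₂₎⟨1⟩) ⊗ ⋯ ⊗ (c₍ₘ₎⟨2⟩ ⊗ c₍ₘ₊₁₎⟨1⟩)`
of `(A ⊗ A)^{⊗(m+1)}`. -/
def weilElement (ℓ : C →ₗ[k] A ⊗[k] A) (m : ℕ) : C →ₗ[k] TPow k (A ⊗[k] A) m :=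
  shift k A m ∘ₗ PiTensorProduct.map (fun _ => ℓ) ∘ₗ iterComul k C m

/-- `chw` is the Chern-Weil map `chw_n(ℓ) : C^tr → HC_{2n}(B)`: for `c ∈ C^tr` the elements
`cₘ(ℓ)(c)` lie in `M^{⊗(m+1)}`, and `chw c` is the class of the cycle
`∑ₘ (-1)^⌊m/2⌋ m!/⌊m/2⌋! ε^{⊗(m+1)}(cₘ(ℓ)(c))`. -/
def IsChernWeil (ℓ : C →ₗ[k] A ⊗[k] A) (n : ℕ)
    (chw : cotraces k C →ₗ[k] HC k E.inv (2 * n)) : Prop :=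
  ∀ c : cotraces k C, ∃ x : (m : ℕ) → TPow k E.M m,
    (∀ m, PiTensorProduct.map (fun _ => E.M.subtype) (x m) = weilElement ℓ m c) ∧
    Represents (chernChain n fun m => PiTensorProduct.map (fun _ => E.aug) (x m)) (chw c)

/-- `∑ c_{i₁i₂}⟨2⟩c_{i₂i₃}⟨1⟩ ⊗ c_{i₂i₃}⟨2⟩c_{i₃i₄}⟨1⟩ ⊗ ⋯ ⊗ c_{iₘ₊₁i₁}⟨2⟩c_{i₁i₂}⟨1⟩`, an element
of `A^{⊗(m+1)}`. -/
def galoisElement (ℓ : C →ₗ[k] A ⊗[k] A) (V : Comod k C) {N : ℕ}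
    (b : Module.Basis (Fin N) k V) (m : ℕ) : TPow k A m :=
  ∑ i : Fin (m + 1) → Fin N, PiTensorProduct.map (fun _ => LinearMap.mul' k A)
    (shift k A m (PiTensorProduct.tprod k fun r => ℓ (V.coeff b (i (r + 1)) (i (r + 2)))))

/-- `chg` is the Chern-Galois character `chg_n(ℓ) : Rep(C) → HC_{2n}(B)`: for every basis of a
representation `V`, the elements `galoisElement` lie in `B^{⊗(m+1)}`, and `chg [V]` is the class of
the cycle formed by them with the coefficients `(-1)^⌊m/2⌋ m!/⌊m/2⌋!`. -/
def IsChernGalois (ℓ : C →ₗ[k] A ⊗[k] A) (n : ℕ)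
    (chg : Rep k C →+ HC k E.inv (2 * n)) : Prop :=
  ∀ (V : Comod k C) (N : ℕ) (b : Module.Basis (Fin N) k V),
    ∃ x : (m : ℕ) → TPow k E.inv m,
      (∀ m, PiTensorProduct.map (fun _ => E.inv.val.toLinearMap) (x m) =
        galoisElement ℓ V b m) ∧
      Represents (chernChain n x) (chg (Rep.mk V))

end GaloisExt
end Maps

end

end ChernWeil

/-! Everything rests on one kind of sequence: tensors `x m` in `B^{⊗(m+1)}` that are invariant under
the unsigned rotation and such that every face of `x (m+1)` is `x m`. Weighted by α_m they form a
cycle, because the differential of the bicomplex then reads α_{m+1} = (m+1)α_m for even m and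
α_{m+1} = -2α_m for odd m, and α satisfies both (`chernChain_mem_cycles`).

Two such cycles are homologous when both come from constant words in one family of tensors indexed
by words, compatible with deletion and rotation of letters. The free module on words is contracted
by prefixing a letter, so the difference of two constant words is the boundary of an explicit chain
(`boundary_wordHomotopy`), and the family carries this chain to `B`
(`IsWordFamily.chernChain_sub_mem`). If a module P is split off a free module in several ways (i_a,
s_a), the matrices G_ab of i_b ∘ s_a satisfy G_ab G_bc = G_ac, so their cyclic traces along words
are such a family (`isWordFamily_wordTrace`). Hence the Chern class depends only on P.

For a comodule V, the strong connection splits as ℓ(c_ij) = ∑ z_it ⊗ β_tj with β_t in A □ V and z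
left colinear (`exists_splitting`). Since multiplication after ℓ is the counit, the matrix with
entries ∑ β_si z_it over B is an idempotent presenting A □ V, and its traces are exactly the
Chern-Galois elements (`map_matTrace_splittingMatrix`). This gives finite generation, projectivity
and one half of the square.

For a cotrace c, symmetry of the coproduct makes the iterated coproduct rotation invariant
(`rot_iterComul`). Bicolinearity and coassociativity put one factor of c_m(ℓ)(c) into M, rotation
does the same for the others, and over a field this places the whole tensor in M^{⊗(m+1)}
(`exists_retraction`). The counit makes the faces lower m, so the Chern-Weil chain is again of the
kind above. The iterated coproduct of a character is a sum over closed paths of indices, so the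
Chern-Weil chain of χ(V) is the Chern-Galois chain of V (`galoisElement_eq`). Both halves thus
commute on chains for suitable representatives; homology enters only in the independence of the
presentation. -/

namespace ChernWeil

noncomputable section

/-! ### Precyclic modules -/

section Precyclic

variable (k : Type*) [Field k] (X : ℕ → Type*) [∀ m, AddCommGroup (X m)] [∀ m, Module k (X m)]

/-- The data of a precyclic module: face operators (all but the last) and unsigned rotations. -/
structure Precyclic where
  face : ∀ m, Fin (m + 1) → X (m + 1) →ₗ[k] X m
  rot : ∀ m, X m →ₗ[k] X m

namespace Precyclic

variable {k X} (S : Precyclic k X)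

/-- The signed rotation. -/
def cyc (m : ℕ) : X m →ₗ[k] X m := (-1 : k) ^ m • S.rot m

/-- The norm operator. -/
def norm (m : ℕ) : X m →ₗ[k] X m := ∑ j ∈ Finset.range (m + 1), S.cyc m ^ j

/-- The bar differential. -/
def bar (m : ℕ) : X (m + 1) →ₗ[k] X m := ∑ i : Fin (m + 1), (-1 : k) ^ (i : ℕ) • S.face m i

/-- The Hochschild differential. -/
def hoch (m : ℕ) : X (m + 1) →ₗ[k] X m :=
  S.bar m + (-1 : k) ^ (m + 1) • (S.face m 0 ∘ₗ S.rot (m + 1))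

lemma cyc_apply (m : ℕ) (x : X m) : S.cyc m x = (-1 : k) ^ m • S.rot m x := rfl

lemma bar_apply (m : ℕ) (x : X (m + 1)) :
    S.bar m x = ∑ i : Fin (m + 1), (-1 : k) ^ (i : ℕ) • S.face m i x := by
  simp [bar]

lemma hoch_apply (m : ℕ) (x : X (m + 1)) :
    S.hoch m x = S.bar m x + (-1 : k) ^ (m + 1) • S.face m 0 (S.rot (m + 1) x) := rfl

lemma norm_apply (m : ℕ) (x : X m) :
    S.norm m x = ∑ j ∈ Finset.range (m + 1), (S.cyc m ^ j) x := by
  simp [norm]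

/-- The precyclic identities. -/
structure IsCyclic : Prop where
  face_rot : ∀ (m : ℕ) (i : Fin m) (x : X (m + 1)),
    S.face m i.succ (S.rot (m + 1) x) = S.rot m (S.face m i.castSucc x)
  face_rot_rot : ∀ (m : ℕ) (x : X (m + 1)),
    S.face m 0 (S.rot (m + 1) (S.rot (m + 1) x)) = S.rot m (S.face m (Fin.last m) x)
  rot_pow : ∀ m, S.rot m ^ (m + 1) = 1

variable {S}

lemma neg_one_pow_mul_self (m : ℕ) : ((-1 : k) ^ m) * (-1) ^ m = 1 := by
  rw [← mul_pow]; simp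

/-- The relation b(1 - t) = (1 - t)b'. Moving t past the faces shifts their index by one; the face
d₀t left over is the last Hochschild face and cancels against the one in b. -/
lemma hoch_cyc (h : S.IsCyclic) (m : ℕ) (x : X (m + 1)) :
    S.hoch m (x - S.cyc (m + 1) x) = S.bar m x - S.cyc m (S.bar m x) := by
  have key : S.hoch m (S.cyc (m + 1) x) =
      (-1 : k) ^ (m + 1) • S.face m 0 (S.rot (m + 1) x) + S.cyc m (S.bar m x) := by
    rw [hoch_apply, S.bar_apply m (S.cyc (m + 1) x), S.bar_apply m x, Fin.sum_univ_succ,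
      Fin.sum_univ_castSucc (n := m)]
    simp only [cyc_apply, map_smul, map_add, map_sum, h.face_rot, h.face_rot_rot, smul_smul,
      Fin.val_succ, Fin.val_castSucc, Fin.val_last,
      neg_one_pow_mul_self, one_smul, Fin.val_zero, pow_zero, one_mul]
    rw [add_assoc]
    congr 2
    refine Finset.sum_congr rfl fun i _ => ?_
    congr 1
    ring
  rw [map_sub, key, hoch_apply]
  abel

lemma cyc_pow (h : S.IsCyclic) (m : ℕ) : S.cyc m ^ (m + 1) = 1 := by
  have e : ((-1 : k) ^ m) ^ (m + 1) = 1 := by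
    rw [← pow_mul]
    exact (Nat.even_mul_succ_self m).neg_one_pow
  rw [cyc, smul_pow, h.rot_pow, e, one_smul]

lemma cyc_norm (h : S.IsCyclic) (m : ℕ) : S.cyc m * S.norm m = S.norm m := by
  rw [norm, Finset.mul_sum]
  simp only [← pow_succ']
  rw [Finset.sum_range_succ, Finset.sum_range_succ', cyc_pow h, pow_zero]

lemma norm_cyc (h : S.IsCyclic) (m : ℕ) : S.norm m * S.cyc m = S.norm m := by
  rw [norm, Finset.sum_mul]
  simp only [← pow_succ]
  rw [Finset.sum_range_succ, Finset.sum_range_succ', cyc_pow h, pow_zero]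

lemma norm_cyc_apply (h : S.IsCyclic) (m : ℕ) (x : X m) : S.norm m (S.cyc m x) = S.norm m x :=
  LinearMap.congr_fun (norm_cyc h m) x

lemma cyc_norm_apply (h : S.IsCyclic) (m : ℕ) (x : X m) : S.cyc m (S.norm m x) = S.norm m x :=
  LinearMap.congr_fun (cyc_norm h m) x

/-- The norm is fixed by the signed rotation, so d_{i+1} rot = rot d_i makes each face of `N x` a
signed rotation of the preceding one. -/
lemma face_norm (h : S.IsCyclic) (m : ℕ) (x : X (m + 1)) (i : ℕ) (hi : i < m + 1) :
    (-1 : k) ^ i • S.face m ⟨i, hi⟩ (S.norm (m + 1) x) =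
      (S.cyc m ^ i) (S.face m 0 (S.norm (m + 1) x)) := by
  induction i with
  | zero => simp
  | succ i ih =>
    rw [pow_succ' (S.cyc m), Module.End.mul_apply, ← ih (by omega)]
    have h1 := h.face_rot m ⟨i, by omega⟩ (S.norm (m + 1) x)
    have h2 := cyc_norm_apply h (m + 1) x
    rw [cyc_apply] at h2
    have h3 : S.rot (m + 1) (S.norm (m + 1) x) = (-1 : k) ^ (m + 1) • S.norm (m + 1) x := by
      conv_rhs => rw [← h2, smul_smul, neg_one_pow_mul_self, one_smul]
    rw [h3, map_smul] at h1
    simp only [Fin.succ_mk, Fin.castSucc_mk] at h1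
    rw [cyc_apply, map_smul, ← h1, smul_smul, smul_smul]
    congr 1
    have := neg_one_pow_mul_self (k := k) m
    rw [pow_succ, pow_succ]
    linear_combination (-1 : k) ^ i * this

/-- Dual to `face_norm`: an outer N absorbs rotations, so every face can be traded for d₀ after a
power of t. The base case is the last face, where d₀t² = t d_m gives the exponent 2. -/
lemma norm_face (h : S.IsCyclic) (m : ℕ) (x : X (m + 1)) (j : ℕ) (i : Fin (m + 1))
    (hi : i + j = m) :
    (-1 : k) ^ (i : ℕ) • S.norm m (S.face m i x) =
      S.norm m (S.face m 0 ((S.cyc (m + 1) ^ (j + 2)) x)) := by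
  have hN : ∀ y : X m, S.norm m (S.rot m y) = (-1 : k) ^ m • S.norm m y := by
    intro y
    conv_rhs => rw [← norm_cyc_apply h, cyc_apply, map_smul, smul_smul, neg_one_pow_mul_self,
      one_smul]
  induction j generalizing i x with
  | zero =>
    obtain rfl : i = Fin.last m := Fin.ext hi
    simp only [zero_add, pow_two, Module.End.mul_apply, cyc_apply, map_smul, h.face_rot_rot, hN,
      smul_smul, neg_one_pow_mul_self, one_mul, Fin.val_last]
  | succ j ih =>
    have h1 := h.face_rot m ⟨i, by omega⟩ x
    have h2 := ih (S.cyc (m + 1) x) (Fin.succ ⟨i, by omega⟩) (by simp; omega)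
    rw [← Module.End.mul_apply, ← pow_succ, cyc_apply] at h2
    rw [show j + 1 + 2 = j + 2 + 1 by ring, ← h2, map_smul, map_smul, h1, hN, smul_smul, smul_smul]
    congr 1
    simp only [Fin.val_succ]
    rw [pow_succ, pow_succ, mul_assoc, mul_assoc]
    have := neg_one_pow_mul_self (k := k) m
    linear_combination -(-1 : k) ^ (i : ℕ) * this

/-- The relation b'N = Nb. Both sides become N d₀ applied to the sum of all powers of t over one
full cycle. -/
lemma bar_norm (h : S.IsCyclic) (m : ℕ) (x : X (m + 1)) :
    S.bar m (S.norm (m + 1) x) = S.norm m (S.hoch m x) := by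
  have h1 : S.bar m (S.norm (m + 1) x) = S.norm m (S.face m 0 (S.norm (m + 1) x)) := by
    rw [bar_apply, S.norm_apply m, ← Fin.sum_univ_eq_sum_range
      (fun i => (S.cyc m ^ i) (S.face m 0 (S.norm (m + 1) x)))]
    exact Finset.sum_congr rfl fun i _ => face_norm h m x i i.2
  have h2 : S.norm m (S.bar m x) =
      ∑ j ∈ Finset.range (m + 1), S.norm m (S.face m 0 ((S.cyc (m + 1) ^ (j + 2)) x)) := by
    rw [← Finset.sum_range_reflect, ← Fin.sum_univ_eq_sum_range
      (fun j => S.norm m (S.face m 0 ((S.cyc (m + 1) ^ (m + 1 - 1 - j + 2)) x))), bar_apply,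
      map_sum]
    refine Finset.sum_congr rfl fun i _ => ?_
    rw [map_smul, norm_face h m x (m + 1 - 1 - i) i (by omega)]
  have h3 : (-1 : k) ^ (m + 1) • S.face m 0 (S.rot (m + 1) x) =
      S.face m 0 ((S.cyc (m + 1) ^ 1) x) := by
    rw [pow_one, cyc_apply, map_smul]
  -- On the left the exponents run over 0, …, m+1, on the right over 1, …, m+2; periodicity
  -- identifies the two ends.
  have h4 : (S.cyc (m + 1) ^ 0) x = (S.cyc (m + 1) ^ (m + 2)) x := by
    rw [cyc_pow h (m + 1)]; rfl
  rw [h1, hoch_apply, map_add, h2, h3, S.norm_apply (m + 1), map_sum, map_sum,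
    Finset.sum_range_succ', Finset.sum_range_succ', Finset.sum_range_succ _ m]
  rw [h4]
  abel

/-- Identities for a sequence fixed by rotation and compatible with the faces. -/
lemma bar_of_face {m : ℕ} {x : X (m + 1)} {y : X m} (h : ∀ i, S.face m i x = y) :
    S.bar m x = if Even m then y else 0 := by
  rw [bar_apply]
  simp only [h, ← Finset.sum_smul]
  rw [Fin.sum_univ_eq_sum_range (fun i => (-1 : k) ^ i), neg_one_geom_sum]
  by_cases hm : Even m
  · rw [if_neg (by rw [Nat.even_add_one]; simpa using hm), if_pos hm, one_smul]
  · rw [if_pos (by rw [Nat.even_add_one]; simpa using hm), if_neg hm, zero_smul]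

end Precyclic

end Precyclic

/-! ### The standard precyclic module on a set -/

section Words

variable (k : Type*) [Field k] (I : Type*)

/-- The free module on words of length `m + 1`, with deletions of letters as faces. -/
def wordModule : Precyclic k (fun m => (Fin (m + 1) → I) →₀ k) where
  face m i := Finsupp.lmapDomain k k fun f : Fin (m + 2) → I => f ∘ i.castSucc.succAbove
  rot m := Finsupp.lmapDomain k k fun f : Fin (m + 1) → I => fun r => f (r - 1)

variable {k I}

lemma wordModule_face (m : ℕ) (i : Fin (m + 1)) (f : Fin (m + 2) → I) (c : k) :
    (wordModule k I).face m i (Finsupp.single f c) =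
      Finsupp.single (f ∘ i.castSucc.succAbove) c := by
  simp [wordModule]

lemma wordModule_rot (m : ℕ) (f : Fin (m + 1) → I) (c : k) :
    (wordModule k I).rot m (Finsupp.single f c) = Finsupp.single (fun r => f (r - 1)) c := by
  simp [wordModule]

lemma fin_succ_sub_one (n : ℕ) (s : Fin n) : s.succ - 1 = s.castSucc := by
  rw [sub_eq_iff_eq_add, Fin.coeSucc_eq_succ]

/-- Index form of d_{i+1} rot = rot d_i on words; `zero_succAbove_sub_one_sub_one` is likewise the
index form of d₀ rot² = rot d_m. -/
lemma succAbove_succ_sub_one (m : ℕ) (i : Fin m) (r : Fin (m + 1)) :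
    i.succ.castSucc.succAbove r - 1 = i.castSucc.castSucc.succAbove (r - 1) := by
  refine Fin.cases ?_ (fun r => ?_) r
  · have h : (0 : Fin (m + 1)) - 1 = Fin.last m := by
      rw [sub_eq_iff_eq_add]; simp
    rw [h, ← Fin.succ_castSucc, Fin.succ_succAbove_zero, zero_sub,
      Fin.succAbove_of_le_castSucc]
    · rw [Fin.succ_last, eq_comm, ← sub_eq_zero, sub_neg_eq_add,
        Fin.last_add_one]
    · simp [Fin.le_def]
  · have fin_succ_sub_one : ∀ (n : ℕ) (s : Fin n), s.succ - 1 = s.castSucc := by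
      intro n s
      rw [sub_eq_iff_eq_add, Fin.coeSucc_eq_succ]
    rw [← Fin.succ_castSucc, Fin.succ_succAbove_succ, fin_succ_sub_one, fin_succ_sub_one]
    rw [Fin.castSucc_succAbove_castSucc]

lemma zero_succAbove_sub_one_sub_one (m : ℕ) (r : Fin (m + 1)) :
    (Fin.castSucc (0 : Fin (m + 1))).succAbove r - 1 - 1 =
      (Fin.last m).castSucc.succAbove (r - 1) := by
  rw [Fin.castSucc_zero, Fin.zero_succAbove, fin_succ_sub_one]
  refine Fin.cases ?_ (fun r => ?_) r
  · have h : (0 : Fin (m + 1)) - 1 = Fin.last m := by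
      rw [sub_eq_iff_eq_add]; simp
    rw [h, Fin.castSucc_zero, zero_sub, Fin.succAbove_of_le_castSucc _ _ le_rfl, Fin.succ_last,
      eq_comm, ← sub_eq_zero, sub_neg_eq_add,
        Fin.last_add_one]
  · rw [fin_succ_sub_one, ← Fin.succ_castSucc, fin_succ_sub_one, Fin.succAbove_of_castSucc_lt]
    simp [Fin.lt_def]

lemma rotFun_pow (m : ℕ) (f : Fin (m + 1) → I) (j : ℕ) (c : k) :
    ((wordModule k I).rot m ^ j) (Finsupp.single f c) =
      Finsupp.single (fun r => f (r - j • (1 : Fin (m + 1)))) c := by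
  induction j with
  | zero => simp
  | succ j ih =>
    rw [pow_succ', Module.End.mul_apply, ih, wordModule_rot]
    congr 1
    funext r
    congr 1
    rw [succ_nsmul', sub_sub]

lemma wordModule_isCyclic : (wordModule k I).IsCyclic where
  face_rot m i x := by
    induction x using Finsupp.induction_linear with
    | zero => simp
    | add x y hx hy => simp only [map_add, hx, hy]
    | single f c =>
      rw [wordModule_rot, wordModule_face, wordModule_face, wordModule_rot]
      congr 1
      funext r
      simp only [Function.comp_apply, succAbove_succ_sub_one]
  face_rot_rot m x := by
    induction x using Finsupp.induction_linear with
    | zero => simp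
    | add x y hx hy => simp only [map_add, hx, hy]
    | single f c =>
      rw [wordModule_rot, wordModule_rot, wordModule_face, wordModule_face, wordModule_rot]
      congr 1
      funext r
      simp only [Function.comp_apply, zero_succAbove_sub_one_sub_one]
  rot_pow m := by
    refine LinearMap.ext fun x => ?_
    induction x using Finsupp.induction_linear with
    | zero => simp
    | add x y hx hy => simp only [map_add, hx, hy]
    | single f c =>
      have h : (m + 1) • (1 : Fin (m + 1)) = 0 := by
        simpa using card_nsmul_eq_zero' (x := (1 : Fin (m + 1)))
      rw [rotFun_pow, h]
      simp

/-- The contraction of the standard precyclic module: adding a letter in front. -/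
def consLetter (a : I) (m : ℕ) : ((Fin (m + 1) → I) →₀ k) →ₗ[k] ((Fin (m + 2) → I) →₀ k) :=
  Finsupp.lmapDomain k k fun f => Fin.cons a f

lemma consLetter_single (a : I) (m : ℕ) (f : Fin (m + 1) → I) (c : k) :
    consLetter a m (Finsupp.single f c) = Finsupp.single (Fin.cons a f : Fin (m + 2) → I) c := by
  simp [consLetter]

lemma face_zero_consLetter (a : I) (m : ℕ) (x : (Fin (m + 1) → I) →₀ k) :
    (wordModule k I).face m 0 (consLetter a m x) = x := by
  induction x using Finsupp.induction_linear with
  | zero => simp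
  | add x y hx hy => simp only [map_add, hx, hy]
  | single f c =>
    rw [consLetter_single, wordModule_face]
    congr 1

lemma face_succ_consLetter (a : I) (m : ℕ) (i : Fin (m + 1)) (x : (Fin (m + 2) → I) →₀ k) :
    (wordModule k I).face (m + 1) i.succ (consLetter a (m + 1) x) =
      consLetter a m ((wordModule k I).face m i x) := by
  induction x using Finsupp.induction_linear with
  | zero => simp
  | add x y hx hy => simp only [map_add, hx, hy]
  | single f c =>
    rw [consLetter_single, wordModule_face, wordModule_face, consLetter_single]
    congr 1
    funext r
    refine Fin.cases ?_ (fun r => ?_) r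
    · simp only [Function.comp_apply, ← Fin.succ_castSucc, Fin.succ_succAbove_zero, Fin.cons_zero]
    · simp only [Function.comp_apply, ← Fin.succ_castSucc, Fin.succ_succAbove_succ, Fin.cons_succ]

lemma face_rot_consLetter (a : I) (m : ℕ) (x : (Fin (m + 2) → I) →₀ k) :
    (wordModule k I).face (m + 1) 0 ((wordModule k I).rot (m + 2) (consLetter a (m + 1) x)) =
      consLetter a m ((wordModule k I).face m 0 ((wordModule k I).rot (m + 1) x)) := by
  induction x using Finsupp.induction_linear with
  | zero => simp
  | add x y hx hy => simp only [map_add, hx, hy]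
  | single f c =>
    rw [consLetter_single, wordModule_rot, wordModule_rot, wordModule_face, wordModule_face,
      consLetter_single]
    congr 1
    funext r
    simp only [Function.comp_apply, Fin.castSucc_zero, Fin.zero_succAbove, fin_succ_sub_one]
    refine Fin.cases ?_ (fun r => ?_) r
    · simp
    · simp only [← Fin.succ_castSucc, Fin.cons_succ, Function.comp_apply, Fin.zero_succAbove,
        fin_succ_sub_one]

/-- Prefixing a letter contracts the bar complex: d₀ removes the new letter, and the later faces do
not see it. -/
lemma bar_consLetter (a : I) (m : ℕ) (x : (Fin (m + 2) → I) →₀ k) :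
    (wordModule k I).bar (m + 1) (consLetter a (m + 1) x) =
      x - consLetter a m ((wordModule k I).bar m x) := by
  rw [Precyclic.bar_apply, Fin.sum_univ_succ, Precyclic.bar_apply, map_sum, face_zero_consLetter]
  simp only [face_succ_consLetter, map_smul, Fin.val_zero, pow_zero, one_smul, Fin.val_succ,
    sub_eq_add_neg, ← Finset.sum_neg_distrib]
  congr 1
  refine Finset.sum_congr rfl fun i _ => ?_
  rw [pow_succ, mul_neg_one, neg_smul]

/-- The extra Hochschild face deletes the last letter, which in positive degree is also independent
of the prefix, so the same contraction works for b. -/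
lemma hoch_consLetter (a : I) (m : ℕ) (x : (Fin (m + 2) → I) →₀ k) :
    (wordModule k I).hoch (m + 1) (consLetter a (m + 1) x) =
      x - consLetter a m ((wordModule k I).hoch m x) := by
  rw [Precyclic.hoch_apply, bar_consLetter, Precyclic.hoch_apply, map_add, face_rot_consLetter,
    map_smul, pow_succ _ (m + 1), mul_neg_one, neg_smul]
  abel

/-- In degree zero, deleting the last letter leaves the prefix `a` alone. This error does not depend
on the word and cancels in differences, which is why two constant words are compared. -/
lemma hoch_consLetter_zero (a b c : I) :
    (wordModule k I).hoch 0 (consLetter a 0 (Finsupp.single (fun _ => b) 1 -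
      Finsupp.single (fun _ => c) 1)) =
      Finsupp.single (fun _ => b) 1 - Finsupp.single (fun _ => c) 1 := by
  rw [Precyclic.hoch_apply, Precyclic.bar_apply, Fin.sum_univ_one, face_zero_consLetter]
  have h : ∀ d : I, (wordModule k I).face 0 0 ((wordModule k I).rot (0 + 1)
      (consLetter a 0 (Finsupp.single (fun _ => d) 1))) = Finsupp.single (fun _ => a) 1 := by
    intro d
    rw [consLetter_single, wordModule_rot, wordModule_face]
    congr 1
    funext r
    obtain rfl : r = 0 := Subsingleton.elim (α := Fin 1) r 0
    rfl
  simp only [map_sub, h, sub_self, smul_zero, add_zero, Fin.val_zero, pow_zero, one_smul]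

end Words


/-! ### Chern coefficients and constant sequences in a precyclic module -/

section ChernCycles

/-- The integer division in `chernCoeff` is exact, since ⌊m/2⌋! divides m!; the recursions therefore
hold over ℤ and pass to a field of any characteristic. -/
lemma chernCoeff_even (j : ℕ) :
    chernCoeff (2 * j + 1) = (2 * j + 1) * chernCoeff (2 * j) := by
  have h1 : (2 * j + 1) / 2 = j := by omega
  have h2 : (2 * j) / 2 = j := by omega
  have h3 : (2 * j + 1).factorial / j.factorial =
      (2 * j + 1) * ((2 * j).factorial / j.factorial) := by
    rw [Nat.factorial_succ, Nat.mul_div_assoc]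
    exact Nat.factorial_dvd_factorial (by omega)
  rw [chernCoeff, chernCoeff, h1, h2, h3]
  push_cast
  ring

lemma chernCoeff_odd (j : ℕ) :
    chernCoeff (2 * j + 2) = -2 * chernCoeff (2 * j + 1) := by
  have h1 : (2 * j + 1) / 2 = j := by omega
  have h2 : (2 * j + 2) / 2 = j + 1 := by omega
  have h3 : (2 * j + 2).factorial / (j + 1).factorial =
      2 * ((2 * j + 1).factorial / j.factorial) := by
    rw [Nat.factorial_succ (2 * j + 1), Nat.factorial_succ j,
      show (2 * j + 1 + 1) * (2 * j + 1).factorial = (j + 1) * (2 * (2 * j + 1).factorial) by ring,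
      Nat.mul_div_mul_left _ _ (Nat.succ_pos j), Nat.mul_div_assoc]
    exact Nat.factorial_dvd_factorial (by omega)
  rw [chernCoeff, chernCoeff, h1, h2, h3, pow_succ]
  push_cast
  ring

variable {k : Type*} [Field k]

lemma chernCoeff_of_even {m : ℕ} (hm : Even m) :
    (chernCoeff (m + 1) : k) = (m + 1 : ℕ) * chernCoeff m := by
  obtain ⟨j, rfl⟩ := hm
  rw [← two_mul, chernCoeff_even]
  push_cast
  ring

lemma chernCoeff_of_odd {m : ℕ} (hm : ¬ Even m) :
    (chernCoeff (m + 1) : k) = -2 * chernCoeff m := by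
  obtain ⟨j, rfl⟩ := Nat.not_even_iff_odd.1 hm
  rw [chernCoeff_odd]
  push_cast
  ring

namespace Precyclic

variable {X : ℕ → Type*} [∀ m, AddCommGroup (X m)] [∀ m, Module k (X m)] {S : Precyclic k X}

/-- A sequence of elements which is fixed by all faces and rotations. -/
structure IsConstant (S : Precyclic k X) (x : ∀ m, X m) : Prop where
  face : ∀ m i, S.face m i (x (m + 1)) = x m
  rot : ∀ m, S.rot m (x m) = x m

lemma IsConstant.sub {x y : ∀ m, X m} (hx : S.IsConstant x) (hy : S.IsConstant y) :
    S.IsConstant fun m => x m - y m where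
  face m i := by rw [map_sub, hx.face, hy.face]
  rot m := by rw [map_sub, hx.rot, hy.rot]

lemma IsConstant.cyc {x : ∀ m, X m} (hx : S.IsConstant x) (m : ℕ) :
    S.cyc m (x m) = (-1 : k) ^ m • x m := by
  rw [cyc_apply, hx.rot]

lemma IsConstant.norm {x : ∀ m, X m} (hx : S.IsConstant x) {m : ℕ} (hm : Even m) :
    S.norm m (x m) = ((m + 1 : ℕ) : k) • x m := by
  have h : ∀ j : ℕ, (S.cyc m ^ j) (x m) = x m := by
    intro j
    induction j with
    | zero => simp
    | succ j ih => rw [pow_succ, Module.End.mul_apply, hx.cyc, hm.neg_one_pow, one_smul, ih]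
  rw [norm_apply]
  simp only [h, Finset.sum_const, Finset.card_range, Nat.cast_smul_eq_nsmul]

/-- For even m, b' is an alternating sum with an odd number of equal terms and leaves one copy of `x
m`, while t acts as the identity and N as multiplication by m+1. -/
lemma IsConstant.bar_chern {x : ∀ m, X m} (hx : S.IsConstant x) {m : ℕ} (hm : Even m) :
    S.bar m ((chernCoeff (m + 1) : k) • x (m + 1)) = S.norm m ((chernCoeff m : k) • x m) := by
  rw [map_smul, map_smul, hx.norm hm, bar_of_face (hx.face m), if_pos hm, smul_smul,
    chernCoeff_of_even hm, mul_comm]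

/-- For odd m, the terms of b' cancel in pairs and only the last face survives, while t = -1 makes 1
- t multiplication by 2; the coefficient -2 balances them. -/
lemma IsConstant.hoch_chern {x : ∀ m, X m} (hx : S.IsConstant x) {m : ℕ} (hm : ¬ Even m) :
    S.hoch m ((chernCoeff (m + 1) : k) • x (m + 1)) +
      ((chernCoeff m : k) • x m - S.cyc m ((chernCoeff m : k) • x m)) = 0 := by
  rw [map_smul, map_smul, hx.cyc, hoch_apply, bar_of_face (hx.face m), if_neg hm, hx.rot, hx.face,
    chernCoeff_of_odd hm, (Nat.not_even_iff_odd.1 hm).neg_one_pow,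
    (Nat.even_add_one.2 hm).neg_one_pow]
  module

end Precyclic

/-! ### The homotopy between two constant sequences of words -/

variable {I : Type*}

variable (k) in
/-- The difference of the constant words on `b` and `c`, with the coefficients of the Chern
character. -/
def wordChain (b c : I) (m : ℕ) : (Fin (m + 1) → I) →₀ k :=
  (chernCoeff m : k) • (Finsupp.single (fun _ => b) 1 - Finsupp.single (fun _ => c) 1)

lemma wordModule_isConstant (b : I) :
    (wordModule k I).IsConstant fun _ => Finsupp.single (fun _ => b) 1 where
  face m i := by rw [wordModule_face]; rfl
  rot m := by rw [wordModule_rot]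

open scoped Classical in
variable (k) in
/-- A chain whose boundary is `wordChain k b c`. -/
def wordHomotopy (b c : I) : (m : ℕ) → ((Fin (m + 1) → I) →₀ k)
  | 0 => 0
  | m + 1 =>
    if Even m then
      consLetter b m (wordChain k b c m -
        (wordHomotopy b c m - (wordModule k I).cyc m (wordHomotopy b c m)))
    else
      consLetter b m ((wordModule k I).norm m (wordHomotopy b c m) - wordChain k b c m)

lemma wordHomotopy_even (b c : I) {m : ℕ} (hm : Even m) : wordHomotopy k b c (m + 1) =
      consLetter b m (wordChain k b c m -
        (wordHomotopy k b c m - (wordModule k I).cyc m (wordHomotopy k b c m))) := by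
  rw [wordHomotopy, if_pos hm]

lemma wordHomotopy_odd (b c : I) {m : ℕ} (hm : ¬ Even m) : wordHomotopy k b c (m + 1) =
      consLetter b m ((wordModule k I).norm m (wordHomotopy k b c m) - wordChain k b c m) := by
  rw [wordHomotopy, if_neg hm]

/-- Each new term solves the equation in its degree by the contraction, up to prefixing the b- or
b'-boundary of the contracted element. That boundary vanishes by the cycle relations for
`wordChain`, the equation one degree lower, and (1 - t)N = 0 or N(1 - t) = 0. The solution does not
depend on the total degree. -/
lemma boundary_wordHomotopy (b c : I) (m : ℕ) :
    (Even m → (wordModule k I).hoch m (wordHomotopy k b c (m + 1)) +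
      (wordHomotopy k b c m - (wordModule k I).cyc m (wordHomotopy k b c m)) =
        wordChain k b c m) ∧
    (¬ Even m → (wordModule k I).norm m (wordHomotopy k b c m) -
      (wordModule k I).bar m (wordHomotopy k b c (m + 1)) = wordChain k b c m) := by
  have hS := wordModule_isCyclic (k := k) (I := I)
  have hz := (wordModule_isConstant (k := k) b).sub (wordModule_isConstant c)
  induction m with
  | zero =>
    refine ⟨fun h => ?_, fun h => absurd Even.zero h⟩
    rw [wordHomotopy_even b c h, wordHomotopy]
    simp only [map_zero, sub_zero, add_zero]
    rw [wordChain, map_smul, map_smul, hoch_consLetter_zero]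
  | succ m ih =>
    refine ⟨fun h => ?_, fun h => ?_⟩
    · have hm : ¬ Even m := Nat.even_add_one.1 h
      have h1 := ih.2 hm
      rw [wordHomotopy_even b c h, hoch_consLetter, map_sub, Precyclic.hoch_cyc hS]
      rw [sub_eq_iff_eq_add, ← sub_eq_iff_eq_add'] at h1
      have h2 : (wordModule k I).hoch m (wordChain k b c (m + 1)) =
          -(wordChain k b c m - (wordModule k I).cyc m (wordChain k b c m)) :=
        eq_neg_of_add_eq_zero_left (hz.hoch_chern hm)
      -- The boundary of the contracted element is now -(1 - t)N of the preceding term of the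
      -- homotopy.
      rw [h2, ← h1]
      simp only [map_sub, map_neg, Precyclic.cyc_norm_apply hS]
      abel
    · have hm : Even m := by rwa [Nat.even_add_one, not_not] at h
      have h1 := ih.1 hm
      rw [wordHomotopy_odd b c h, bar_consLetter, map_sub, Precyclic.bar_norm hS]
      rw [← eq_sub_iff_add_eq] at h1
      have h2 : (wordModule k I).bar m (wordChain k b c (m + 1)) =
          (wordModule k I).norm m (wordChain k b c m) := hz.bar_chern hm
      rw [h2, h1]
      simp only [map_sub, Precyclic.norm_cyc_apply hS]
      abel

end ChernCycles

/-! ### Cyclic families in the cyclic bicomplex of an algebra -/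

section Families

variable (k : Type u) [Field k] (B : Type u) [Ring B] [Algebra k B]

/-- The precyclic module of an algebra. -/
def tensorModule : Precyclic k (TPow k B) where
  face := face k B
  rot := rot k B


variable {k B}

lemma totDiff_apply_even (d : ℕ) (z : Tot k B (d + 1)) (m : Fin (d + 1)) (h : Even (d - (m : ℕ))) :
    totDiff k B d z m = (tensorModule k B).hoch m (z m.succ) +
      (LinearMap.id - (tensorModule k B).cyc m : TPow k B m →ₗ[k] TPow k B m) (z m.castSucc) := by
  rw [totDiff, LinearMap.pi_apply, if_pos h]
  rfl

lemma totDiff_apply_odd (d : ℕ) (z : Tot k B (d + 1)) (m : Fin (d + 1)) (h : ¬ Even (d - (m : ℕ))) :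
    totDiff k B d z m = (tensorModule k B).norm m (z m.castSucc) -
      (tensorModule k B).bar m (z m.succ) := by
  rw [totDiff, LinearMap.pi_apply, if_neg h]
  rfl

lemma chernChain_mem_cycles {x : ∀ m, TPow k B m} (hx : (tensorModule k B).IsConstant x) (n : ℕ) :
    chernChain n x ∈ cycles k B (2 * n) := by
  cases n with
  | zero => exact Submodule.mem_top
  | succ n =>
    change chernChain (n + 1) x ∈ LinearMap.ker (totDiff k B (2 * n + 1))
    rw [LinearMap.mem_ker]
    funext m
    by_cases hm : Even (m : ℕ)
    -- The boundary has odd total degree 2n+1, so an even tensor degree sits in an odd column.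
    · rw [totDiff_apply_odd (2 * n + 1) _ m]
      · exact sub_eq_zero.2 (hx.bar_chern hm).symm
      · rw [Nat.even_sub (by omega)]
        simp [hm]
    · rw [totDiff_apply_even (2 * n + 1) _ m]
      · exact hx.hoch_chern hm
      · rw [Nat.even_sub (by omega)]
        simp [hm]

variable (k B) in
/-- A family of tensors indexed by words, compatible with deletions and rotations of words. -/
structure IsWordFamily {I : Type*} (T : ∀ m, (Fin (m + 1) → I) → TPow k B m) : Prop where
  face : ∀ m (i : Fin (m + 1)) (f : Fin (m + 2) → I),
    face k B m i (T (m + 1) f) = T m (f ∘ i.castSucc.succAbove)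
  rot : ∀ m (f : Fin (m + 1) → I), rot k B m (T m f) = T m fun r => f (r - 1)

namespace IsWordFamily

variable {I : Type*} {T : ∀ m, (Fin (m + 1) → I) → TPow k B m}

lemma isConstant (hT : IsWordFamily k B T) (b : I) :
    (tensorModule k B).IsConstant fun m => T m fun _ => b where
  face m i := hT.face m i _
  rot m := hT.rot m _

variable (T) in
/-- The linear extension of a family of tensors indexed by words. -/
def extend (m : ℕ) : ((Fin (m + 1) → I) →₀ k) →ₗ[k] TPow k B m :=
  Finsupp.linearCombination k (T m)

lemma extend_face (hT : IsWordFamily k B T) (m : ℕ) (i : Fin (m + 1))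
    (x : (Fin (m + 2) → I) →₀ k) :
    extend T m ((wordModule k I).face m i x) =
      (tensorModule k B).face m i (extend T (m + 1) x) := by
  induction x using Finsupp.induction_linear with
  | zero => simp
  | add x y hx hy => simp only [map_add, hx, hy]
  | single f c =>
    rw [wordModule_face, extend, extend, Finsupp.linearCombination_single,
      Finsupp.linearCombination_single, map_smul]
    exact congrArg _ (hT.face m i f).symm

lemma extend_rot (hT : IsWordFamily k B T) (m : ℕ) (x : (Fin (m + 1) → I) →₀ k) :
    extend T m ((wordModule k I).rot m x) = (tensorModule k B).rot m (extend T m x) := by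
  induction x using Finsupp.induction_linear with
  | zero => simp
  | add x y hx hy => simp only [map_add, hx, hy]
  | single f c =>
    rw [wordModule_rot, extend, Finsupp.linearCombination_single,
      Finsupp.linearCombination_single, map_smul]
    exact congrArg _ (hT.rot m f).symm

lemma extend_cyc (hT : IsWordFamily k B T) (m : ℕ) (x : (Fin (m + 1) → I) →₀ k) :
    extend T m ((wordModule k I).cyc m x) = (tensorModule k B).cyc m (extend T m x) := by
  rw [Precyclic.cyc_apply, Precyclic.cyc_apply, map_smul, hT.extend_rot]

lemma extend_norm (hT : IsWordFamily k B T) (m : ℕ) (x : (Fin (m + 1) → I) →₀ k) :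
    extend T m ((wordModule k I).norm m x) = (tensorModule k B).norm m (extend T m x) := by
  have h : ∀ j : ℕ, extend T m (((wordModule k I).cyc m ^ j) x) =
      ((tensorModule k B).cyc m ^ j) (extend T m x) := by
    intro j
    induction j with
    | zero => simp
    | succ j ih => rw [pow_succ', Module.End.mul_apply, hT.extend_cyc, ih, pow_succ',
        Module.End.mul_apply]
  rw [Precyclic.norm_apply, Precyclic.norm_apply, map_sum]
  exact Finset.sum_congr rfl fun j _ => h j

lemma extend_bar (hT : IsWordFamily k B T) (m : ℕ) (x : (Fin (m + 2) → I) →₀ k) :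
    extend T m ((wordModule k I).bar m x) = (tensorModule k B).bar m (extend T (m + 1) x) := by
  rw [Precyclic.bar_apply, Precyclic.bar_apply, map_sum]
  simp only [map_smul, hT.extend_face]

lemma extend_hoch (hT : IsWordFamily k B T) (m : ℕ) (x : (Fin (m + 2) → I) →₀ k) :
    extend T m ((wordModule k I).hoch m x) = (tensorModule k B).hoch m (extend T (m + 1) x) := by
  rw [Precyclic.hoch_apply, Precyclic.hoch_apply, map_add, map_smul, hT.extend_bar,
    hT.extend_face, hT.extend_rot]

/-- The linear extension of T commutes with all operators of the bicomplex, so it sends the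
universal homotopy on words to one in B. -/
lemma chernChain_sub_mem (hT : IsWordFamily k B T) (n : ℕ) (b c : I) :
    chernChain n (fun m => T m fun _ => b) - chernChain n (fun m => T m fun _ => c) ∈
      LinearMap.range (totDiff k B (2 * n)) := by
  refine ⟨fun m => extend T m (wordHomotopy k b c m), ?_⟩
  funext m
  have hz : extend T m (wordChain k b c m) =
      (chernCoeff m : k) • T m (fun _ => b) - (chernCoeff m : k) • T m (fun _ => c) := by
    rw [wordChain, map_smul, map_sub, extend, Finsupp.linearCombination_single,
      Finsupp.linearCombination_single, one_smul, one_smul, smul_sub]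
  refine Eq.trans ?_ hz
  by_cases hm : Even (m : ℕ)
  · rw [totDiff_apply_even (2 * n) _ m, ← (boundary_wordHomotopy b c (m : ℕ)).1 hm, map_add,
      map_sub,
      hT.extend_cyc, hT.extend_hoch]
    · rfl
    · rw [Nat.even_sub (by omega)]
      simp [hm]
  · rw [totDiff_apply_odd (2 * n) _ m, ← (boundary_wordHomotopy b c (m : ℕ)).2 hm, map_sub,
      hT.extend_norm, hT.extend_bar]
    · rfl
    · rw [Nat.even_sub (by omega)]
      simp [hm]

end IsWordFamily

end Families


/-! ### Traces of cyclic products of matrices -/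

section MatTrace

variable (k : Type u) [Field k] {B : Type u} [Ring B] [Algebra k B]

lemma fin_zero_sub_one (m : ℕ) : (0 : Fin (m + 1)) - 1 = Fin.last m := by
  rw [sub_eq_iff_eq_add]; simp

/-- Deleting place i preserves cyclic predecessors except at i itself, where two factors are merged;
that case is `succAbove_self_sub_one`. -/
lemma succAbove_sub_one (m : ℕ) (i r : Fin (m + 1)) (h : r ≠ i) :
    i.castSucc.succAbove (r - 1) = i.castSucc.succAbove r - 1 := by
  induction r using Fin.cases with
  | zero =>
    have hi : (0 : Fin (m + 1)) < i := Fin.pos_of_ne_zero (Ne.symm h)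
    rw [fin_zero_sub_one, Fin.succAbove_of_castSucc_lt _ 0 (Fin.castSucc_lt_castSucc_iff.2 hi),
      Fin.succAbove_of_le_castSucc _ _ (Fin.castSucc_le_castSucc_iff.2 (Fin.le_last i)),
      Fin.castSucc_zero, fin_zero_sub_one, Fin.succ_last]
  | succ s =>
    rw [fin_succ_sub_one]
    rcases lt_or_gt_of_ne h with h | h
    · rw [Fin.succAbove_of_castSucc_lt _ _ (Fin.castSucc_lt_castSucc_iff.2 h),
        Fin.succAbove_of_castSucc_lt _ _ (by simp [Fin.lt_def] at h ⊢; omega),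
        ← Fin.succ_castSucc, fin_succ_sub_one]
    · rw [Fin.succAbove_of_le_castSucc _ _ (by simp [Fin.lt_def, Fin.le_def] at h ⊢; omega),
        Fin.succAbove_of_le_castSucc _ _ (by simp [Fin.lt_def, Fin.le_def] at h ⊢; omega),
        fin_succ_sub_one, Fin.succ_castSucc]

lemma succAbove_self_sub_one (m : ℕ) (i : Fin (m + 1)) :
    i.castSucc.succAbove (i - 1) = i.castSucc - 1 := by
  induction i using Fin.cases with
  | zero =>
    rw [fin_zero_sub_one, Fin.succAbove_of_le_castSucc _ _ (by simp), Fin.castSucc_zero,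
      fin_zero_sub_one, Fin.succ_last]
  | succ s =>
    rw [fin_succ_sub_one, Fin.succAbove_of_castSucc_lt _ _ (by simp [Fin.lt_def]),
      ← Fin.succ_castSucc, fin_succ_sub_one]

lemma face_tprod (m : ℕ) (i : Fin (m + 1)) (b : Fin (m + 2) → B) :
    face k B m i (PiTensorProduct.tprod k b) =
      PiTensorProduct.tprod k (Function.update (fun r => b (i.castSucc.succAbove r)) i
        (b i.castSucc * b i.succ)) := by
  rw [face, PiTensorProduct.lift.tprod]
  change PiTensorProduct.tprod k _ = _
  congr 1
  funext r
  by_cases h : r = i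
  · subst h
    rw [Function.update_self, Fin.contractNth_apply_of_eq _ _ _ _ rfl]
  · rw [Function.update_of_ne h, Fin.contractNth_apply_of_ne]
    simpa [Fin.ext_iff, eq_comm] using h

variable {κ : Type*} [Fintype κ]

/-- The trace of a cyclic product of matrices indexed by a word. -/
def wordTrace {I : Type*} (G : I → I → Matrix κ κ B) (m : ℕ) (f : Fin (m + 1) → I) : TPow k B m :=
  ∑ p : Fin (m + 1) → κ, PiTensorProduct.tprod k fun r => G (f (r - 1)) (f r) (p (r - 1)) (p r)

/-- Multiplying two neighbouring factors and summing over their common index is matrix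
multiplication, and G a b * G b c = G a c deletes the letter b. -/
lemma isWordFamily_wordTrace {I : Type*} (G : I → I → Matrix κ κ B)
    (hG : ∀ a b c, G a b * G b c = G a c) : IsWordFamily k B (wordTrace k G) where
  face m i f := by
    -- Factor r has letter r on its right, so face i joins factors i and i+1 across letter i. The
    -- index at place i occurs only in these two factors and is split off from the sum.
    rw [wordTrace, map_sum, wordTrace, ← (Fin.insertNthEquiv (fun _ => κ) i.castSucc).sum_comp,
      Fintype.sum_prod_type_right]
    refine Finset.sum_congr rfl fun q _ => ?_
    have h : ∀ s : κ, face k B m i (PiTensorProduct.tprod k fun r =>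
        G (f (r - 1)) (f r) (Fin.insertNth (α := fun _ => κ) i.castSucc s q (r - 1))
          (Fin.insertNth (α := fun _ => κ) i.castSucc s q r)) =
        PiTensorProduct.tprod k (Function.update (fun r =>
          G (f (i.castSucc.succAbove (r - 1))) (f (i.castSucc.succAbove r)) (q (r - 1)) (q r)) i
          (G (f (i.castSucc - 1)) (f i.castSucc) (q (i - 1)) s *
            G (f i.castSucc) (f i.succ) s (q i))) := by
      intro s
      rw [face_tprod]
      congr 1
      funext r
      by_cases hr : r = i
      · subst hr
        rw [Function.update_self, Function.update_self, fin_succ_sub_one, Fin.insertNth_apply_same,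
          ← succAbove_self_sub_one, Fin.insertNth_apply_succAbove]
        congr 2
        conv_lhs => rw [← Fin.succAbove_castSucc_self]
        exact Fin.insertNth_apply_succAbove (α := fun _ => κ) _ _ _ _
      · rw [Function.update_of_ne hr, Function.update_of_ne hr, ← succAbove_sub_one _ _ _ hr,
          Fin.insertNth_apply_succAbove, Fin.insertNth_apply_succAbove]
    simp only [Fin.insertNthEquiv_apply, h]
    rw [← MultilinearMap.map_update_sum]
    congr 1
    rw [Function.update_eq_iff]
    refine ⟨?_, fun r hr => rfl⟩
    rw [← Matrix.mul_apply, hG, Function.comp_apply, Function.comp_apply, succAbove_self_sub_one,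
      Fin.succAbove_castSucc_self]
  rot m f := by
    rw [wordTrace, map_sum, wordTrace]
    refine (Finset.sum_congr rfl fun p _ => ?_).trans
      (Equiv.sum_comp (Equiv.arrowCongr (Equiv.addRight (1 : Fin (m + 1))) (Equiv.refl κ)) _)
    rw [rot_tprod]
    simp [Equiv.arrowCongr, sub_eq_add_neg]

/-- The generalized trace `∑ e_{i₀i₁} ⊗ e_{i₁i₂} ⊗ ⋯ ⊗ e_{iₘi₀}`. -/
def matTrace (e : Matrix κ κ B) (m : ℕ) : TPow k B m :=
  ∑ i : Fin (m + 1) → κ, PiTensorProduct.tprod k fun r => e (i r) (i (r + 1))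

lemma wordTrace_const {I : Type*} (G : I → I → Matrix κ κ B) (m : ℕ) (a : I) :
    (wordTrace k G m fun _ => a) = matTrace k (G a a) m := by
  rw [wordTrace, matTrace,
    ← (Equiv.arrowCongr (Equiv.subRight (1 : Fin (m + 1))) (Equiv.refl κ)).sum_comp]
  refine Finset.sum_congr rfl fun p _ => ?_
  congr 1
  funext r
  simp [Equiv.arrowCongr]

variable {k} in
lemma matTrace_isConstant {e : Matrix κ κ B} (he : e * e = e) :
    (tensorModule k B).IsConstant (matTrace k e) := by
  have h := (isWordFamily_wordTrace k (fun _ _ : Unit => e) fun _ _ _ => he).isConstant ()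
  simpa only [wordTrace_const] using h

/-- A closed path of indices either stays in one block or crosses between the blocks somewhere, and
a crossing contributes a zero factor. -/
lemma matTrace_fromBlocks {κ' : Type*} [Fintype κ'] (e : Matrix κ κ B) (e' : Matrix κ' κ' B)
    (m : ℕ) :
    matTrace k (Matrix.fromBlocks e 0 0 e') m = matTrace k e m + matTrace k e' m := by
  classical
  symm
  refine (Fintype.sum_sum_type (Sum.elim
    (fun p : Fin (m + 1) → κ => PiTensorProduct.tprod k fun r => e (p r) (p (r + 1)))
    fun p : Fin (m + 1) → κ' => PiTensorProduct.tprod k fun r => e' (p r) (p (r + 1)))).symm.trans ?_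
  refine Fintype.sum_of_injective (Sum.elim (fun p r => Sum.inl (p r)) fun p r => Sum.inr (p r))
    ?_ _ _ ?_ ?_
  · rintro (p | p) (q | q) h
    · exact congrArg _ (funext fun r => Sum.inl_injective (congrFun h r))
    · exact absurd (congrFun h 0) Sum.inl_ne_inr
    · exact absurd (congrFun h 0) Sum.inr_ne_inl
    · exact congrArg _ (funext fun r => Sum.inr_injective (congrFun h r))
  · intro p hp
    by_cases h : ∀ r, (p r).isLeft = (p (r + 1)).isLeft
    · refine absurd ?_ hp
      have h0 : ∀ r, (p r).isLeft = (p 0).isLeft := by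
        intro r
        induction r using Fin.induction with
        | zero => rfl
        | succ r ih => rw [← ih, h r.castSucc, Fin.coeSucc_eq_succ]
      rcases hc : p 0 with a | a
      · have h1 : ∀ r, ∃ b, p r = Sum.inl b := fun r => by
          have := h0 r
          rw [hc, Sum.isLeft_inl, Sum.isLeft_iff] at this
          exact this
        choose q hq using h1
        exact ⟨Sum.inl q, funext fun r => (hq r).symm⟩
      · have h1 : ∀ r, ∃ b, p r = Sum.inr b := fun r => by
          have := h0 r
          rw [hc, Sum.isLeft_inr, Sum.isLeft_eq_false, Sum.isRight_iff] at this
          exact this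
        choose q hq using h1
        exact ⟨Sum.inr q, funext fun r => (hq r).symm⟩
    · push Not at h
      obtain ⟨r, hr⟩ := h
      refine MultilinearMap.map_coord_zero _ r ?_
      rcases h1 : p r with a | a <;> rcases h2 : p (r + 1) with b | b <;> simp [h1, h2] at hr ⊢
  · rintro (p | p) <;> rfl

end MatTrace


/-! ### Homology classes of chains, and maps out of group completions -/

section Represents

variable {k : Type u} [Field k] {B : Type u} [Ring B] [Algebra k B] {d : ℕ}

lemma Represents.unique {z : Tot k B d} {h h' : HC k B d} (H : Represents z h)
    (H' : Represents z h') : h = h' := by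
  obtain ⟨_, rfl⟩ := H
  obtain ⟨_, rfl⟩ := H'
  rfl

lemma Represents.add {z z' : Tot k B d} {h h' : HC k B d} (H : Represents z h)
    (H' : Represents z' h') : Represents (z + z') (h + h') := by
  obtain ⟨hz, rfl⟩ := H
  obtain ⟨hz', rfl⟩ := H'
  exact ⟨add_mem hz hz', rfl⟩

lemma Represents.of_sub_mem {z z' : Tot k B d} {h : HC k B d} (H : Represents z h)
    (hz' : z' ∈ cycles k B d) (hs : z - z' ∈ LinearMap.range (totDiff k B d)) :
    Represents z' h := by
  obtain ⟨hz, rfl⟩ := H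
  refine ⟨hz', ?_⟩
  rw [Submodule.Quotient.eq]
  exact hs

lemma exists_represents {z : Tot k B d} (hz : z ∈ cycles k B d) : ∃ h, Represents z h :=
  ⟨_, hz, rfl⟩

lemma chernChain_add (n : ℕ) (x y : (m : ℕ) → TPow k B m) :
    chernChain n (fun m => x m + y m) = chernChain n x + chernChain n y :=
  funext fun _ => smul_add _ _ _

lemma chernChain_smul (n : ℕ) (c : k) (x : (m : ℕ) → TPow k B m) :
    chernChain n (fun m => c • x m) = c • chernChain n x :=
  funext fun _ => smul_comm _ _ _

end Represents

lemma grothendieck_hom_ext {M G : Type*} [AddCommMonoid M] [AddCommGroup G]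
    {f g : Algebra.GrothendieckAddGroup M →+ G}
    (h : ∀ x, f (Algebra.GrothendieckAddGroup.of x) = g (Algebra.GrothendieckAddGroup.of x)) :
    f = g :=
  Algebra.GrothendieckAddGroup.lift.symm.injective (AddMonoidHom.ext h)

lemma grothendieck_lift_of {M G : Type*} [AddCommMonoid M] [AddCommGroup G] (f : M →+ G) (x : M) :
    Algebra.GrothendieckAddGroup.lift f (Algebra.GrothendieckAddGroup.of x) = f x :=
  DFunLike.congr_fun (Algebra.GrothendieckAddGroup.lift.symm_apply_apply f) x

/-! ### Presentations of modules by idempotent matrices and independence of the Chern class -/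

section Presented

variable {B : Type u} [Ring B] {P Q : Type u} [AddCommGroup P] [Module B P]
  [AddCommGroup Q] [Module B Q] {κ κ' : Type} [Fintype κ] [Fintype κ']

variable (P) in
/-- The module `P` is the image of the idempotent matrix `e` acting on row vectors. -/
def IsPresented (e : Matrix κ κ B) : Prop :=
  ∃ (i : P →ₗ[B] (κ → B)) (s : (κ → B) →ₗ[B] P), s ∘ₗ i = LinearMap.id ∧ i ∘ₗ s = e.vecMulLinear

lemma vecMulLinear_injective {ι ι' : Type*} [Fintype ι] {e e' : Matrix ι ι' B}
    (h : e.vecMulLinear = e'.vecMulLinear) :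
    e = e' := by
  classical
  exact Matrix.toLinearMapRight'.injective h

lemma IsPresented.idem {e : Matrix κ κ B} (h : IsPresented P e) : e * e = e := by
  obtain ⟨i, s, h1, h2⟩ := h
  refine vecMulLinear_injective (LinearMap.ext fun x => ?_)
  rw [Matrix.vecMulLinear_apply, ← Matrix.vecMul_vecMul, ← Matrix.vecMulLinear_apply,
    ← Matrix.vecMulLinear_apply, ← h2, LinearMap.comp_apply, LinearMap.comp_apply,
    ← LinearMap.comp_apply s i, h1, LinearMap.id_apply]

lemma IsPresented.congr {e : Matrix κ κ B} (h : IsPresented P e) (f : P ≃ₗ[B] Q) :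
    IsPresented Q e := by
  obtain ⟨i, s, h1, h2⟩ := h
  refine ⟨i ∘ₗ f.symm.toLinearMap, f.toLinearMap ∘ₗ s, LinearMap.ext fun x => ?_,
    LinearMap.ext fun x => ?_⟩
  · simp [show s (i (f.symm x)) = f.symm x from LinearMap.congr_fun h1 _]
  · simp [← h2]

lemma isPresented_of_range {e : Matrix κ κ B} (he : e * e = e)
    (f : P ≃ₗ[B] LinearMap.range e.vecMulLinear) : IsPresented P e := by
  refine IsPresented.congr ⟨(LinearMap.range e.vecMulLinear).subtype,
    e.vecMulLinear.rangeRestrict, ?_, rfl⟩ f.symm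
  refine LinearMap.ext fun ⟨x, y, hy⟩ => Subtype.ext ?_
  change e.vecMulLinear x = x
  rw [← hy, Matrix.vecMulLinear_apply, Matrix.vecMulLinear_apply, Matrix.vecMul_vecMul, he]

lemma IsPresented.equivRange {e : Matrix κ κ B} (h : IsPresented P e) :
    Nonempty (P ≃ₗ[B] LinearMap.range e.vecMulLinear) := by
  obtain ⟨i, s, h1, h2⟩ := h
  have hi : Function.Injective i := Function.LeftInverse.injective (LinearMap.congr_fun h1)
  have hs : Function.Surjective s := Function.RightInverse.surjective (LinearMap.congr_fun h1)
  rw [← h2, LinearMap.range_comp_of_range_eq_top i (LinearMap.range_eq_top.2 hs)]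
  exact ⟨LinearEquiv.ofInjective i hi⟩

lemma IsPresented.prod {e : Matrix κ κ B} {e' : Matrix κ' κ' B} (h : IsPresented P e)
    (h' : IsPresented Q e') : IsPresented (P × Q) (Matrix.fromBlocks e 0 0 e') := by
  obtain ⟨i, s, h1, h2⟩ := h
  obtain ⟨i', s', h1', h2'⟩ := h'
  let φ := (LinearEquiv.sumArrowLequivProdArrow κ κ' B B)
  refine ⟨φ.symm.toLinearMap ∘ₗ i.prodMap i', s.prodMap s' ∘ₗ φ.toLinearMap,
    LinearMap.ext fun x => ?_, LinearMap.ext fun x => ?_⟩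
  · have e1 := LinearMap.congr_fun h1 x.1
    have e2 := LinearMap.congr_fun h1' x.2
    simp only [LinearMap.comp_apply, LinearMap.id_apply] at e1 e2
    simp [e1, e2]
  · have e1 := LinearMap.congr_fun h2 (x ∘ Sum.inl)
    have e2 := LinearMap.congr_fun h2' (x ∘ Sum.inr)
    rw [Matrix.vecMulLinear_apply, Matrix.vecMul_fromBlocks, Matrix.vecMul_zero, Matrix.vecMul_zero,
      add_zero, zero_add, ← Matrix.vecMulLinear_apply, ← Matrix.vecMulLinear_apply, ← e1, ← e2]
    funext r
    rcases r with r | r <;> rfl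

lemma isPresented_punit : IsPresented PUnit.{u + 1} (0 : Matrix κ κ B) :=
  ⟨0, 0, Subsingleton.elim _ _, LinearMap.ext fun x => by simp⟩

lemma exists_isPresented [Module.Finite B P] [Module.Projective B P] :
    ∃ (N : ℕ) (e : Matrix (Fin N) (Fin N) B), IsPresented P e := by
  obtain ⟨N, s, hs⟩ := Module.Finite.exists_fin' B P
  obtain ⟨i, hi⟩ := Module.projective_lifting_property s LinearMap.id hs
  exact ⟨N, LinearMap.toMatrixRight' (i ∘ₗ s), i, s, hi,
    (Matrix.toLinearMapRight'.apply_symm_apply (i ∘ₗ s)).symm⟩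

variable {k : Type u} [Field k] [Algebra k B]

lemma chernChain_matTrace_mem {e : Matrix κ κ B} (h : IsPresented P e) (n : ℕ) :
    chernChain n (matTrace k e) ∈ cycles k B (2 * n) :=
  chernChain_mem_cycles (matTrace_isConstant h.idem) n

/-- The two splittings serve as the letters of a two-letter alphabet; the constant words give the
two Chern chains and the mixed words supply the homotopy. -/
lemma chernChain_matTrace_sub_mem_aux {e e' : Matrix κ κ B} (h : IsPresented P e)
    (h' : IsPresented P e') (n : ℕ) :
    chernChain n (matTrace k e) - chernChain n (matTrace k e') ∈
      LinearMap.range (totDiff k B (2 * n)) := by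
  classical
  obtain ⟨i, s, h1, h2⟩ := h
  obtain ⟨i', s', h1', h2'⟩ := h'
  let ii : Bool → (P →ₗ[B] (κ → B)) := fun a => bif a then i else i'
  let ss : Bool → ((κ → B) →ₗ[B] P) := fun a => bif a then s else s'
  -- Row vectors reverse composition: G a b * G b c is i_c ∘ s_b ∘ i_b ∘ s_a, which collapses
  -- because s_b ∘ i_b = id.
  let G : Bool → Bool → Matrix κ κ B := fun a b => LinearMap.toMatrixRight' (ii b ∘ₗ ss a)
  have hs : ∀ a, ss a ∘ₗ ii a = LinearMap.id := by
    rintro (_ | _)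
    · exact h1'
    · exact h1
  have hG : ∀ a b c, G a b * G b c = G a c := by
    intro a b c
    rw [← LinearMap.toMatrixRight'_comp, LinearMap.comp_assoc, ← LinearMap.comp_assoc (ss a), hs,
      LinearMap.id_comp]
  have e1 : G true true = e := vecMulLinear_injective
    ((Matrix.toLinearMapRight'.apply_symm_apply (i ∘ₗ s)).trans h2)
  have e2 : G false false = e' := vecMulLinear_injective
    ((Matrix.toLinearMapRight'.apply_symm_apply (i' ∘ₗ s')).trans h2')
  have := (isWordFamily_wordTrace k G hG).chernChain_sub_mem n true false
  simpa only [wordTrace_const, e1, e2] using this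

lemma matTrace_zero (m : ℕ) : matTrace k (0 : Matrix κ κ B) m = 0 :=
  Finset.sum_eq_zero fun _ _ => MultilinearMap.map_coord_zero _ 0 rfl

/-- Padding with zero blocks gives both matrices the same index type without changing the module or
the traces. -/
lemma chernChain_matTrace_sub_mem {e : Matrix κ κ B} {e' : Matrix κ' κ' B} (h : IsPresented P e)
    (h' : IsPresented P e') (n : ℕ) :
    chernChain n (matTrace k e) - chernChain n (matTrace k e') ∈
      LinearMap.range (totDiff k B (2 * n)) := by
  have H := (h.prod (isPresented_punit (κ := κ'))).congr
    (LinearEquiv.prodUnique : (P × PUnit.{u + 1}) ≃ₗ[B] P)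
  have H' := ((isPresented_punit (κ := κ)).prod h').congr
    (LinearEquiv.uniqueProd : (PUnit.{u + 1} × P) ≃ₗ[B] P)
  have e1 : matTrace k (Matrix.fromBlocks e 0 0 (0 : Matrix κ' κ' B)) = matTrace k e :=
    funext fun m => by rw [matTrace_fromBlocks, matTrace_zero, add_zero]
  have e2 : matTrace k (Matrix.fromBlocks (0 : Matrix κ κ B) 0 0 e') = matTrace k e' :=
    funext fun m => by rw [matTrace_fromBlocks, matTrace_zero, zero_add]
  simpa only [e1, e2] using chernChain_matTrace_sub_mem_aux (k := k) H H' n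

variable (P) in
/-- The class `h` is the `n`-th Chern class of the module `P`. -/
def IsChernClass (n : ℕ) (h : HC k B (2 * n)) : Prop :=
  ∀ (κ : Type) [Fintype κ] (e : Matrix κ κ B), IsPresented P e →
    Represents (chernChain n (matTrace k e)) h

lemma isChernClass_of_represents {e : Matrix κ κ B} (he : IsPresented P e) {n : ℕ}
    {h : HC k B (2 * n)} (H : Represents (chernChain n (matTrace k e)) h) : IsChernClass P n h :=
  fun _ _ _ he' => H.of_sub_mem (chernChain_matTrace_mem he' n)
    (chernChain_matTrace_sub_mem he he' n)

end Presented

/-! ### The Chern character on K₀ -/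

section ChernCharacter

variable {k : Type u} [Field k] {B : Type u} [Ring B] [Algebra k B]

lemma exists_isChernClass (P : FGProj B) (n : ℕ) : ∃ h : HC k B (2 * n), IsChernClass P n h := by
  obtain ⟨N, e, he⟩ := exists_isPresented (B := B) (P := P)
  obtain ⟨h, H⟩ := exists_represents (chernChain_matTrace_mem (k := k) he n)
  exact ⟨h, isChernClass_of_represents he H⟩

lemma IsChernClass.unique {P : FGProj B} {n : ℕ} {h h' : HC k B (2 * n)} (H : IsChernClass P n h)
    (H' : IsChernClass P n h') : h = h' := by
  obtain ⟨N, e, he⟩ := exists_isPresented (B := B) (P := P)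
  exact (H _ e he).unique (H' _ e he)

variable (k) in
/-- The `n`-th Chern class of a finitely generated projective module. -/
def chernClass (n : ℕ) (P : FGProj B) : HC k B (2 * n) :=
  Classical.choose (exists_isChernClass (k := k) P n)

lemma isChernClass_chernClass (n : ℕ) (P : FGProj B) : IsChernClass P n (chernClass k n P) :=
  Classical.choose_spec (exists_isChernClass P n)

variable (k B) in
/-- The Chern class on isomorphism classes of modules. -/
def chernClassHom (n : ℕ) : FGProj.IsoClass B →+ HC k B (2 * n) where
  toFun := Quotient.lift (chernClass k n) fun P Q ⟨f⟩ =>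
    IsChernClass.unique (isChernClass_chernClass n P)
      fun κ _ e he => isChernClass_chernClass n Q κ e (he.congr f)
  map_zero' := by
    have h := isChernClass_chernClass (k := k) n ⟨PUnit⟩ (Fin 0) (0 : Matrix _ _ B)
      isPresented_punit
    have e : chernChain n (matTrace k (0 : Matrix (Fin 0) (Fin 0) B)) = 0 :=
      funext fun m => by
        rw [chernChain, matTrace_zero, smul_zero]
        rfl
    rw [e] at h
    exact h.unique ⟨zero_mem _, rfl⟩
  map_add' := by
    rintro ⟨P⟩ ⟨Q⟩
    obtain ⟨N, e, he⟩ := exists_isPresented (B := B) (P := P)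
    obtain ⟨N', e', he'⟩ := exists_isPresented (B := B) (P := Q)
    have h1 := isChernClass_chernClass (k := k) n P _ e he
    have h2 := isChernClass_chernClass (k := k) n Q _ e' he'
    have h3 := isChernClass_chernClass (k := k) n ⟨P × Q⟩ _ _ (he.prod he')
    have h4 : matTrace k (Matrix.fromBlocks e 0 0 e') = fun m => matTrace k e m + matTrace k e' m :=
      funext (matTrace_fromBlocks k e e')
    rw [h4, chernChain_add] at h3
    exact h3.unique (h1.add h2)

lemma isChernCharacter_lift (n : ℕ) :
    IsChernCharacter n (Algebra.GrothendieckAddGroup.lift (chernClassHom k B n)) := by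
  intro N e he P ⟨f⟩
  rw [show Algebra.GrothendieckAddGroup.lift (chernClassHom k B n) (KZero.mk P) = chernClass k n P
    from grothendieck_lift_of (chernClassHom k B n) _]
  -- Over `Fin N`, `matTrace` unfolds to `idemTrace`.
  exact isChernClass_chernClass n P _ e (isPresented_of_range he f)

lemma IsChernCharacter.isChernClass {n : ℕ} {ch : KZero B →+ HC k B (2 * n)}
    (h : IsChernCharacter n ch) (P : FGProj B) : IsChernClass P n (ch (KZero.mk P)) := by
  obtain ⟨N, e, he⟩ := exists_isPresented (B := B) (P := P)
  exact isChernClass_of_represents he (h N e he.idem P he.equivRange)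

theorem existsUnique_chernCharacter (n : ℕ) :
    ∃! ch : KZero B →+ HC k B (2 * n), IsChernCharacter n ch := by
  refine ⟨_, isChernCharacter_lift n, fun ch h => grothendieck_hom_ext ?_⟩
  rintro ⟨P⟩
  exact (h.isChernClass P).unique ((isChernCharacter_lift n).isChernClass P)

end ChernCharacter


/-! ### Finite expansions in tensor products -/

section Finiteness

variable {k : Type u} [Field k] {X Y : Type u} [AddCommGroup X] [Module k X]
  [AddCommGroup Y] [Module k Y]

/-- The expansion is valid for every larger finite set, so that one set can serve finitely many
tensors at once. -/
lemma exists_tensor_expansion {ι : Type*} (x : Module.Basis ι k X) (t : X ⊗[k] Y) :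
    ∃ F : Finset ι, ∀ F', F ⊆ F' →
      t = ∑ s ∈ F', x s ⊗ₜ[k] TensorProduct.lid k Y ((x.coord s).rTensor Y t) := by
  classical
  induction t with
  | zero => exact ⟨∅, by simp⟩
  | add t t' h h' =>
    obtain ⟨F, h⟩ := h
    obtain ⟨F', h'⟩ := h'
    refine ⟨F ∪ F', fun G hG => ?_⟩
    simp only [map_add, TensorProduct.tmul_add, Finset.sum_add_distrib]
    rw [← h G (Finset.union_subset_left hG), ← h' G (Finset.union_subset_right hG)]
  | tmul a y =>
    refine ⟨(x.repr a).support, fun G hG => ?_⟩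
    conv_lhs => rw [← x.linearCombination_repr a, Finsupp.linearCombination_apply,
      Finsupp.sum_of_support_subset _ hG _ (by simp), TensorProduct.sum_tmul]
    refine Finset.sum_congr rfl fun s _ => ?_
    simp [TensorProduct.smul_tmul]

/-- The coordinates on the span of the `w i` are extended to functionals on all of X. They can then
be applied to arbitrary vectors of A ⊗ V, which `exists_splitting` requires. -/
lemma exists_finite_expansion {ι : Type*} [Finite ι] (P : Submodule k X) (w : ι → X)
    (hw : ∀ i, w i ∈ P) : ∃ (n : ℕ) (β : Fin n → P) (γ : Fin n → Module.Dual k X),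
      ∀ i, w i = ∑ t, γ t (w i) • (β t : X) := by
  let U := Submodule.span k (Set.range w)
  have hU : U ≤ P := Submodule.span_le.2 (by rintro _ ⟨i, rfl⟩; exact hw i)
  have : Module.Finite k U := Module.Finite.span_of_finite k (Set.finite_range w)
  let v := Module.finBasis k U
  choose γ hγ using fun t => LinearMap.exists_extend (v.coord t)
  refine ⟨_, fun t => ⟨v t, hU (v t).2⟩, γ, fun i => ?_⟩
  have h1 : w i ∈ U := Submodule.subset_span ⟨i, rfl⟩
  have h2 : ∀ t, γ t (w i) = v.repr ⟨w i, h1⟩ t := fun t => LinearMap.congr_fun (hγ t) ⟨w i, h1⟩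
  have h3 := congrArg U.subtype (v.sum_repr ⟨w i, h1⟩)
  simp only [map_sum, map_smul, Submodule.subtype_apply] at h3
  simp only [h2, h3]

end Finiteness

namespace Comod

variable {k C : Type u} [Field k] [AddCommGroup C] [Module k C] [Coalgebra k C]

lemma counit_coeff (V : Comod k C) {ι : Type*} [Fintype ι] [DecidableEq ι]
    (b : Module.Basis ι k V) (i j : ι) :
    Coalgebra.counit (R := k) (V.coeff b i j) = if i = j then 1 else 0 := by
  have h := LinearMap.congr_fun V.isCoact.counit (b i)
  have h' := congrArg (b.coord j) h
  simp only [LinearMap.comp_apply, coact_eq_sum V b, map_sum, LinearMap.rTensor_tmul,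
    LinearEquiv.coe_coe, TensorProduct.lid_tmul, map_smul, LinearMap.id_apply,
    Module.Basis.coord_apply, Module.Basis.repr_self, smul_eq_mul] at h'
  rw [Finset.sum_eq_single j] at h'
  · rw [Finsupp.single_eq_same, mul_one] at h'
    rw [h', Finsupp.single_apply]
  · intro r _ hr
    rw [Finsupp.single_eq_of_ne hr.symm, mul_zero]
  · simp

end Comod

/-! ### Coordinates in A ⊗ V and functoriality of the cotensor product -/

namespace GaloisExt

variable {k C A : Type u} [Field k] [AddCommGroup C] [Module k C] [Coalgebra k C]
  [Ring A] [Algebra k A] {E : GaloisExt k C A}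

section Strong

variable {ℓ : C →ₗ[k] A ⊗[k] A}

lemma IsStrongConnection.preCan (hℓ : E.IsStrongConnection ℓ) (c : C) :
    preCan E.ρ (ℓ c) = 1 ⊗ₜ[k] c := by
  rw [← can_mk, show Submodule.Quotient.mk (ℓ c) = translation E.ρ E.can_bijective c from
    LinearMap.congr_fun hℓ.lift c]
  exact (LinearEquiv.ofBijective (can E.ρ) E.can_bijective).apply_symm_apply _

lemma counit_preCan (E : GaloisExt k C A) (t : A ⊗[k] A) :
    TensorProduct.rid k A
        ((Coalgebra.counit (R := k) (A := C)).lTensor A (ChernWeil.preCan E.ρ t)) =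
      LinearMap.mul' k A t := by
  induction t with
  | zero => simp
  | add x y hx hy => simp only [map_add, hx, hy]
  | tmul a a' =>
    have h := LinearMap.congr_fun E.isCoact.counit a'
    simp only [LinearMap.comp_apply, LinearEquiv.coe_coe, LinearMap.id_apply] at h
    rw [preCan_tmul, LinearMap.mul'_apply]
    conv_rhs => rw [← h]
    induction E.ρ a' with
    | zero => simp
    | add x y hx hy => simp only [smul_add, map_add, hx, hy, mul_add]
    | tmul x y => simp [TensorProduct.smul_tmul']

/-- Applying the counit to the C-factor of the canonical map turns it into multiplication; on ℓ(c),
which lifts the translation map, its value is 1 ⊗ c. -/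
lemma IsStrongConnection.mul (hℓ : E.IsStrongConnection ℓ) (c : C) :
    LinearMap.mul' k A (ℓ c) = Coalgebra.counit (R := k) c • (1 : A) := by
  rw [← counit_preCan E, hℓ.preCan]
  simp

end Strong

section Comp

variable (V : Comod k C) {ι : Type*} [Fintype ι] (b : Module.Basis ι k V)

variable (A) {V} in
/-- The coefficients in `A` of an element of `A ⊗ V` with respect to a basis of `V`. -/
def comp (i : ι) : A ⊗[k] V →ₗ[k] A :=
  (TensorProduct.rid k A).toLinearMap ∘ₗ (b.coord i).lTensor A

lemma sum_comp_tmul (p : A ⊗[k] V) : ∑ i, comp A b i p ⊗ₜ[k] b i = p := by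
  induction p with
  | zero => simp
  | add x y hx hy => simp only [map_add, TensorProduct.add_tmul, Finset.sum_add_distrib, hx, hy]
  | tmul a v =>
    simp only [comp, LinearMap.comp_apply, LinearMap.lTensor_tmul, LinearEquiv.coe_coe,
      TensorProduct.rid_tmul, TensorProduct.smul_tmul, Module.Basis.coord_apply]
    rw [← TensorProduct.tmul_sum, b.sum_repr]

lemma comp_sum_tmul (a : ι → A) (i : ι) : comp A b i (∑ j, a j ⊗ₜ[k] b j) = a i := by
  classical
  simp [comp, map_sum, Finsupp.single_apply]

lemma mem_cotensor_iff (p : A ⊗[k] V) : p ∈ cotensor E.ρ V.coact ↔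
    ∀ j, E.ρ (comp A b j p) = ∑ i, comp A b i p ⊗ₜ[k] V.coeff b i j := by
  classical
  have h1 : E.ρ.rTensor V p = ∑ j, E.ρ (comp A b j p) ⊗ₜ[k] b j := by
    conv_lhs => rw [← sum_comp_tmul V b p]
    simp only [map_sum, LinearMap.rTensor_tmul]
  have h2 : (TensorProduct.assoc k A C V).symm (V.coact.lTensor A p) =
      ∑ j, (∑ i, comp A b i p ⊗ₜ[k] V.coeff b i j) ⊗ₜ[k] b j := by
    conv_lhs => rw [← sum_comp_tmul V b p]
    simp only [map_sum, LinearMap.lTensor_tmul, Comod.coact_eq_sum V b, TensorProduct.tmul_sum,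
      TensorProduct.assoc_symm_tmul, TensorProduct.sum_tmul]
    exact Finset.sum_comm
  have h3 : ∀ (z : ι → A ⊗[k] C) (l : ι), TensorProduct.rid k (A ⊗[k] C)
      ((b.coord l).lTensor (A ⊗[k] C) (∑ j, z j ⊗ₜ[k] b j)) = z l := by
    intro z l
    simp [map_sum, Finsupp.single_apply]
  rw [cotensor, LinearMap.mem_eqLocus, LinearMap.comp_apply, LinearEquiv.coe_coe, h1, h2]
  constructor
  · intro h j
    rw [← h3 (fun j => E.ρ (comp A b j p)) j, h, h3]
  · intro h
    exact Finset.sum_congr rfl fun j _ => by rw [h]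

end Comp

lemma comp_smul (V : Comod k C) {ι : Type*} (b : Module.Basis ι k V) (i : ι) (a : A)
    (p : A ⊗[k] V) : comp A b i (a • p) = a * comp A b i p := by
  induction p with
  | zero => simp
  | add x y hx hy => simp only [smul_add, map_add, hx, hy, mul_add]
  | tmul x v => simp [comp, TensorProduct.smul_tmul']

section Functorial

variable (E)

/-- A colinear map `V → W` induces a `B`-linear map `A □^C V → A □^C W`. -/
def assocMap {V W : Comod k C} (f : V →ₗ[k] W) (hf : W.coact ∘ₗ f = f.lTensor C ∘ₗ V.coact) :
    E.assocModule V →ₗ[E.inv] E.assocModule W where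
  toFun p := ⟨f.lTensor A p.1, by
    have hp : E.ρ.rTensor V p.1 = (TensorProduct.assoc k A C V).symm (V.coact.lTensor A p.1) := p.2
    have h1 : E.ρ.rTensor W (f.lTensor A p.1) = f.lTensor (A ⊗[k] C) (E.ρ.rTensor V p.1) := by
      rw [← LinearMap.comp_apply, ← LinearMap.comp_apply, LinearMap.rTensor_comp_lTensor,
        LinearMap.lTensor_comp_rTensor]
    have h2 : ∀ q : A ⊗[k] (C ⊗[k] V), f.lTensor (A ⊗[k] C) ((TensorProduct.assoc k A C V).symm q) =
        (TensorProduct.assoc k A C W).symm ((f.lTensor C).lTensor A q) := by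
      intro q
      induction q with
      | zero => simp
      | add x y hx hy => simp only [map_add, hx, hy]
      | tmul a w =>
        induction w with
        | zero => simp
        | add x y hx hy => simp only [TensorProduct.tmul_add, map_add, hx, hy]
        | tmul c v => simp
    change E.ρ.rTensor W (f.lTensor A p.1) =
      (TensorProduct.assoc k A C W).symm (W.coact.lTensor A (f.lTensor A p.1))
    rw [h1, hp, h2, ← LinearMap.lTensor_comp_apply, ← LinearMap.lTensor_comp_apply, hf]⟩
  map_add' p q := Subtype.ext (map_add _ _ _)
  map_smul' r p := Subtype.ext (by
    have h : ∀ (a : A) (x : A ⊗[k] V), f.lTensor A (a • x) = a • f.lTensor A x := by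
      intro a x
      induction x with
      | zero => simp
      | add x y hx hy => simp only [smul_add, map_add, hx, hy]
      | tmul x v => simp [TensorProduct.smul_tmul']
    exact h (r : A) p.1)

lemma assocMap_apply {V W : Comod k C} (f : V →ₗ[k] W)
    (hf : W.coact ∘ₗ f = f.lTensor C ∘ₗ V.coact) (p : E.assocModule V) :
    (E.assocMap f hf p : A ⊗[k] W) = f.lTensor A p.1 := rfl

lemma nonempty_assocEquiv {V W : Comod k C} (h : Comod.Iso V W) :
    Nonempty (E.assocModule V ≃ₗ[E.inv] E.assocModule W) := by
  obtain ⟨f, hf⟩ := h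
  have hg : V.coact ∘ₗ f.symm.toLinearMap = f.symm.toLinearMap.lTensor C ∘ₗ W.coact := by
    refine LinearMap.ext fun w => ?_
    have h1 := LinearMap.congr_fun hf (f.symm w)
    simp only [LinearMap.comp_apply, LinearEquiv.coe_coe, LinearEquiv.apply_symm_apply] at h1 ⊢
    rw [h1, ← LinearMap.lTensor_comp_apply]
    simp
  refine ⟨LinearEquiv.ofLinearMap (E.assocMap f.toLinearMap hf) (E.assocMap f.symm.toLinearMap hg)
    ?_ ?_⟩ <;>
  · refine LinearMap.ext fun p => Subtype.ext ?_
    rw [LinearMap.comp_apply, assocMap_apply, assocMap_apply, ← LinearMap.lTensor_comp_apply]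
    simp

/-- The inclusions and projections of the direct sum are colinear, and A □ - carries their biproduct
identities to B-modules. -/
lemma nonempty_assocSum (V W : Comod k C) :
    Nonempty (E.assocModule (V.sum W) ≃ₗ[E.inv] E.assocModule V × E.assocModule W) := by
  let i₁ : V →ₗ[k] V.sum W := LinearMap.inl k V W
  let i₂ : W →ₗ[k] V.sum W := LinearMap.inr k V W
  let q₁ : V.sum W →ₗ[k] V := LinearMap.fst k V W
  let q₂ : V.sum W →ₗ[k] W := LinearMap.snd k V W
  have hi₁ : (V.sum W).coact ∘ₗ i₁ = i₁.lTensor C ∘ₗ V.coact := by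
    ext v
    change sumCoact V.coact W.coact (v, 0) = _
    rw [sumCoact_apply, map_zero, map_zero, add_zero]
    rfl
  have hi₂ : (V.sum W).coact ∘ₗ i₂ = i₂.lTensor C ∘ₗ W.coact := by
    ext v
    change sumCoact V.coact W.coact (0, v) = _
    rw [sumCoact_apply, map_zero, map_zero, zero_add]
    rfl
  have h11 : q₁ ∘ₗ i₁ = LinearMap.id := rfl
  have h12 : q₁ ∘ₗ i₂ = 0 := rfl
  have h21 : q₂ ∘ₗ i₁ = 0 := rfl
  have h22 : q₂ ∘ₗ i₂ = LinearMap.id := rfl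
  have hs : i₁ ∘ₗ q₁ + i₂ ∘ₗ q₂ = LinearMap.id :=
    LinearMap.ext fun p => Prod.ext (add_zero p.1) (zero_add p.2)
  have hq₁ : V.coact ∘ₗ q₁ = q₁.lTensor C ∘ₗ (V.sum W).coact := by
    refine LinearMap.ext fun p => ?_
    change V.coact p.1 = q₁.lTensor C (i₁.lTensor C (V.coact p.1) + i₂.lTensor C (W.coact p.2))
    rw [map_add, ← LinearMap.lTensor_comp_apply, ← LinearMap.lTensor_comp_apply, h11, h12]
    simp
  have hq₂ : W.coact ∘ₗ q₂ = q₂.lTensor C ∘ₗ (V.sum W).coact := by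
    refine LinearMap.ext fun p => ?_
    change W.coact p.2 = q₂.lTensor C (i₁.lTensor C (V.coact p.1) + i₂.lTensor C (W.coact p.2))
    rw [map_add, ← LinearMap.lTensor_comp_apply, ← LinearMap.lTensor_comp_apply, h21, h22]
    simp
  refine ⟨LinearEquiv.ofLinearMap ((E.assocMap q₁ hq₁).prod (E.assocMap q₂ hq₂))
    ((E.assocMap i₁ hi₁).coprod (E.assocMap i₂ hi₂)) ?_ ?_⟩
  · refine LinearMap.ext fun p => Prod.ext (Subtype.ext ?_) (Subtype.ext ?_)
    · change q₁.lTensor A (i₁.lTensor A p.1.1 + i₂.lTensor A p.2.1) = p.1.1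
      rw [map_add, ← LinearMap.lTensor_comp_apply, ← LinearMap.lTensor_comp_apply, h11, h12]
      simp
    · change q₂.lTensor A (i₁.lTensor A p.1.1 + i₂.lTensor A p.2.1) = p.2.1
      rw [map_add, ← LinearMap.lTensor_comp_apply, ← LinearMap.lTensor_comp_apply, h21, h22]
      simp
  · refine LinearMap.ext fun p => Subtype.ext ?_
    change i₁.lTensor A (q₁.lTensor A p.1) + i₂.lTensor A (q₂.lTensor A p.1) = p.1
    rw [← LinearMap.lTensor_comp_apply, ← LinearMap.lTensor_comp_apply, ← LinearMap.add_apply,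
      ← LinearMap.lTensor_add, hs]
    simp

end Functorial

end GaloisExt


/-! ### Slices of tensors and the splitting of a strong connection -/

section Slices

variable {k C A : Type u} [Field k] [AddCommGroup C] [Module k C] [AddCommGroup A] [Module k A]

/-- Application of a functional to the left tensor factor. -/
def leftSlice (ξ : Module.Dual k A) : A ⊗[k] A →ₗ[k] A :=
  (TensorProduct.lid k A).toLinearMap ∘ₗ ξ.rTensor A

/-- Application of a functional to the right tensor factor. -/
def rightSlice (ξ : Module.Dual k A) : A ⊗[k] A →ₗ[k] A :=
  (TensorProduct.rid k A).toLinearMap ∘ₗ ξ.lTensor A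

lemma leftSlice_tmul (ξ : Module.Dual k A) (x y : A) : leftSlice ξ (x ⊗ₜ[k] y) = ξ x • y := by
  simp [leftSlice]

lemma rightSlice_tmul (ξ : Module.Dual k A) (x y : A) : rightSlice ξ (x ⊗ₜ[k] y) = ξ y • x := by
  simp [rightSlice]

lemma map_leftSlice (ξ : Module.Dual k A) (ρ : A →ₗ[k] A ⊗[k] C) (t : A ⊗[k] A) :
    ρ (leftSlice ξ t) = TensorProduct.lid k (A ⊗[k] C) (ξ.rTensor (A ⊗[k] C) (ρ.lTensor A t)) := by
  induction t with
  | zero => simp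
  | add x y hx hy => simp only [map_add, hx, hy]
  | tmul x y => simp [leftSlice_tmul]

lemma leftSlice_assoc (ξ : Module.Dual k A) (w : A ⊗[k] A) (c : C) :
    TensorProduct.lid k (A ⊗[k] C) (ξ.rTensor (A ⊗[k] C) (TensorProduct.assoc k A A C (w ⊗ₜ[k] c))) =
      leftSlice ξ w ⊗ₜ[k] c := by
  induction w with
  | zero => simp
  | add x y hx hy => simp only [map_add, TensorProduct.add_tmul, hx, hy]
  | tmul x y => simp [leftSlice_tmul, TensorProduct.smul_tmul']

lemma map_rightSlice (ξ : Module.Dual k A) (δ : A →ₗ[k] C ⊗[k] A) (t : A ⊗[k] A) :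
    δ (rightSlice ξ t) = TensorProduct.rid k (C ⊗[k] A) (ξ.lTensor (C ⊗[k] A) (δ.rTensor A t)) := by
  induction t with
  | zero => simp
  | add x y hx hy => simp only [map_add, hx, hy]
  | tmul x y => simp [rightSlice_tmul]

lemma rightSlice_assoc (ξ : Module.Dual k A) (w : A ⊗[k] A) (c : C) :
    TensorProduct.rid k (C ⊗[k] A) (ξ.lTensor (C ⊗[k] A)
      ((TensorProduct.assoc k C A A).symm (c ⊗ₜ[k] w))) = c ⊗ₜ[k] rightSlice ξ w := by
  induction w with
  | zero => simp
  | add x y hx hy => simp only [map_add, TensorProduct.tmul_add, hx, hy]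
  | tmul x y => simp [rightSlice_tmul]

end Slices

namespace GaloisExt

variable {k C A : Type u} [Field k] [AddCommGroup C] [Module k C] [Coalgebra k C]
  [Ring A] [Algebra k A] {E : GaloisExt k C A} {ℓ : C →ₗ[k] A ⊗[k] A}

/-- A functional on the left leg does not disturb right colinearity. The equation says that a row of
left slices is the coordinate vector of an element of A □ V. -/
lemma IsStrongConnection.ρ_leftSlice (hℓ : E.IsStrongConnection ℓ) (ξ : Module.Dual k A)
    {ι : Type*} [Fintype ι] (V : Comod k C) (b : Module.Basis ι k V) (i j : ι) :
    E.ρ (leftSlice ξ (ℓ (V.coeff b i j))) =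
      ∑ l, leftSlice ξ (ℓ (V.coeff b i l)) ⊗ₜ[k] V.coeff b l j := by
  have h := LinearMap.congr_fun hℓ.right_colinear (V.coeff b i j)
  simp only [LinearMap.comp_apply, V.comul_coeff, map_sum, LinearMap.rTensor_tmul,
    LinearEquiv.coe_coe] at h
  rw [map_leftSlice, h]
  simp only [map_sum, leftSlice_assoc]

lemma IsStrongConnection.leftCoact_rightSlice (hℓ : E.IsStrongConnection ℓ) (ξ : Module.Dual k A)
    {ι : Type*} [Fintype ι] (V : Comod k C) (b : Module.Basis ι k V) (i j : ι) :
    E.leftCoact (rightSlice ξ (ℓ (V.coeff b i j))) =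
      ∑ l, V.coeff b i l ⊗ₜ[k] rightSlice ξ (ℓ (V.coeff b l j)) := by
  have h := LinearMap.congr_fun hℓ.left_colinear (V.coeff b i j)
  simp only [LinearMap.comp_apply, V.comul_coeff, map_sum, LinearMap.lTensor_tmul,
    LinearEquiv.coe_coe] at h
  rw [map_rightSlice, h]
  simp only [map_sum, rightSlice_assoc]

/-- The strong connection on the matrix coefficients of `V` is given by finitely many elements `β`
of `A □^C V` and a left-colinear family `z` in `A`. -/
lemma IsStrongConnection.exists_splitting (hℓ : E.IsStrongConnection ℓ) {ι : Type*} [Fintype ι]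
    (V : Comod k C) (b : Module.Basis ι k V) :
    ∃ (n : ℕ) (β : Fin n → E.assocModule V) (z : ι → Fin n → A),
      (∀ i j, ℓ (V.coeff b i j) = ∑ t, z i t ⊗ₜ[k] comp A b j (β t).1) ∧
      ∀ i t, E.leftCoact (z i t) = ∑ l, V.coeff b i l ⊗ₜ[k] z l t := by
  classical
  let x := Module.Basis.ofVectorSpace k A
  choose F hF using fun i j => exists_tensor_expansion x (ℓ (V.coeff b i j))
  -- One finite set of basis vectors expands all the ℓ(c_ij) simultaneously.
  let G := Finset.univ.biUnion fun i => Finset.univ.biUnion fun j => F i j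
  have hG : ∀ i j, ℓ (V.coeff b i j) =
      ∑ s : G, x s ⊗ₜ[k] leftSlice (x.coord s) (ℓ (V.coeff b i j)) := by
    intro i j
    refine (hF i j G fun s hs => ?_).trans (Finset.sum_coe_sort G
      fun s => x s ⊗ₜ[k] leftSlice (x.coord s) (ℓ (V.coeff b i j))).symm
    exact Finset.mem_biUnion.2 ⟨i, Finset.mem_univ _,
      Finset.mem_biUnion.2 ⟨j, Finset.mem_univ _, hs⟩⟩
  -- For fixed s and i, the right legs over j assemble into a vector of A □ V; the β_t will be a
  -- basis of the span of these vectors.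
  let w : G × ι → A ⊗[k] V := fun p =>
    ∑ j, leftSlice (x.coord p.1) (ℓ (V.coeff b p.2 j)) ⊗ₜ[k] b j
  have hw : ∀ p, w p ∈ cotensor E.ρ V.coact := by
    intro p
    refine (mem_cotensor_iff (E := E) V b _).2 fun j => ?_
    simp only [w, comp_sum_tmul]
    exact hℓ.ρ_leftSlice _ V b p.2 j
  obtain ⟨n, β, γ, hβ⟩ := exists_finite_expansion _ w hw
  -- Substituting the expansion of w gives z_it = ∑_s γ_t(w_(s,i)) x_s. Writing it through the
  -- functionals a ↦ γ_t(a ⊗ v_l) makes it a sum of right slices of ℓ(c_il), where left colinearity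
  -- is visible.
  let g : Fin n → ι → Module.Dual k A := fun t l => γ t ∘ₗ (TensorProduct.mk k A V).flip (b l)
  refine ⟨n, β, fun i t => ∑ l, rightSlice (g t l) (ℓ (V.coeff b i l)), fun i j => ?_,
    fun i t => ?_⟩
  · have hz : ∀ t, ∑ l, rightSlice (g t l) (ℓ (V.coeff b i l)) =
        ∑ s : G, γ t (w (s, i)) • x s := by
      intro t
      simp only [w, map_sum, Finset.sum_smul]
      rw [Finset.sum_comm]
      refine Finset.sum_congr rfl fun l _ => ?_
      conv_lhs => rw [hG i l, map_sum]
      exact Finset.sum_congr rfl fun s _ => rightSlice_tmul _ _ _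
    simp only [hz, TensorProduct.sum_tmul, TensorProduct.smul_tmul]
    rw [Finset.sum_comm]
    simp only [← TensorProduct.tmul_sum, ← map_smul, ← map_sum]
    rw [hG i j]
    refine Finset.sum_congr rfl fun s _ => ?_
    refine congrArg _ (Eq.trans ?_ (congrArg (comp A b j) (hβ (s, i))))
    exact (comp_sum_tmul V b (fun j => leftSlice (x.coord s) (ℓ (V.coeff b i j))) j).symm
  · simp only [map_sum, hℓ.leftCoact_rightSlice _ V b, TensorProduct.tmul_sum]
    exact Finset.sum_comm

section Presentation

variable {ι : Type*} [Fintype ι] {V : Comod k C} {b : Module.Basis ι k V}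

/-- By the two coaction formulas ∑ p_i ⊗ z_i lies in A □ A, and multiplication maps A □ A into B. -/
lemma sum_comp_mul_mem_inv {z : ι → A} (hz : ∀ i, E.leftCoact (z i) = ∑ l, V.coeff b i l ⊗ₜ[k] z l)
    (p : E.assocModule V) : ∑ i, comp A b i p.1 * z i ∈ E.inv := by
  have hp : ∀ j, E.ρ (comp A b j p.1) = ∑ i, comp A b i p.1 ⊗ₜ[k] V.coeff b i j :=
    (mem_cotensor_iff V b p.1).1 p.2
  have h := E.mul_mem_inv (∑ i, comp A b i p.1 ⊗ₜ[k] z i) (by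
    rw [M, cotensor, LinearMap.mem_eqLocus]
    simp only [LinearMap.comp_apply, LinearEquiv.coe_coe, map_sum, LinearMap.rTensor_tmul,
      LinearMap.lTensor_tmul, hp, hz, TensorProduct.tmul_sum, TensorProduct.sum_tmul,
      TensorProduct.assoc_symm_tmul]
    exact Finset.sum_comm)
  simpa using h

/-- The coordinate functional on `A □^C V` given by a left-colinear family. -/
def coordFunctional (z : ι → A) (hz : ∀ i, E.leftCoact (z i) = ∑ l, V.coeff b i l ⊗ₜ[k] z l) :
    E.assocModule V →ₗ[E.inv] E.inv where
  toFun p := ⟨∑ i, comp A b i p.1 * z i, sum_comp_mul_mem_inv hz p⟩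
  map_add' p q := Subtype.ext (by
    simp only [Submodule.coe_add, map_add, add_mul, Finset.sum_add_distrib, Subalgebra.coe_add])
  map_smul' r p := Subtype.ext (by
    change ∑ i, comp A b i ((r : A) • p.1) * z i = (r : A) * ∑ i, comp A b i p.1 * z i
    simp only [comp_smul, Finset.mul_sum, mul_assoc])

/-- The matrix attached to a splitting of the strong connection. -/
def splittingMatrix {n : ℕ} (β : Fin n → E.assocModule V) (z : ι → Fin n → A)
    (hz : ∀ i t, E.leftCoact (z i t) = ∑ l, V.coeff b i l ⊗ₜ[k] z l t) :
    Matrix (Fin n) (Fin n) E.inv :=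
  Matrix.of fun s t => coordFunctional (fun i => z i t) (fun i => hz i t) (β s)

/-- A dual basis argument: the β_t generate A □ V, with coordinates p ↦ ∑ p_i z_it. -/
lemma isPresented_splittingMatrix (hℓ : E.IsStrongConnection ℓ) {n : ℕ}
    (β : Fin n → E.assocModule V) (z : ι → Fin n → A)
    (hβ : ∀ i j, ℓ (V.coeff b i j) = ∑ t, z i t ⊗ₜ[k] comp A b j (β t).1)
    (hz : ∀ i t, E.leftCoact (z i t) = ∑ l, V.coeff b i l ⊗ₜ[k] z l t) :
    IsPresented (E.assocModule V) (splittingMatrix β z hz) := by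
  classical
  refine ⟨LinearMap.pi fun t => coordFunctional (fun i => z i t) fun i => hz i t,
    Fintype.linearCombination E.inv β, ?_, ?_⟩
  · refine LinearMap.ext fun p => Subtype.ext ?_
    have h1 : ((Fintype.linearCombination E.inv β
        ((LinearMap.pi fun t => coordFunctional (fun i => z i t) fun i => hz i t) p) :
          E.assocModule V) : A ⊗[k] V) =
        ∑ t, (∑ i, comp A b i p.1 * z i t) • (β t).1 := by
      rw [Fintype.linearCombination_apply, Submodule.coe_sum]
      rfl
    rw [LinearMap.comp_apply, h1, LinearMap.id_apply, ← sum_comp_tmul V b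
      (∑ t, (∑ i, comp A b i p.1 * z i t) • (β t).1)]
    conv_rhs => rw [← sum_comp_tmul V b p.1]
    refine Finset.sum_congr rfl fun j _ => ?_
    congr 1
    simp only [map_sum, comp_smul, Finset.sum_mul, mul_assoc]
    rw [Finset.sum_comm]
    simp only [← Finset.mul_sum]
    -- The sum is the product of the two legs of ℓ(c_ij), that is, the counit of c_ij.
    have h2 : ∀ i, ∑ t, z i t * comp A b j (β t).1 = if i = j then 1 else 0 := by
      intro i
      have h3 := hℓ.mul (V.coeff b i j)
      rw [hβ, map_sum, V.counit_coeff b] at h3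
      simpa using h3
    simp [h2]
  · refine LinearMap.ext fun x => funext fun t => ?_
    rw [LinearMap.comp_apply, LinearMap.pi_apply, Fintype.linearCombination_apply, map_sum,
      Matrix.vecMulLinear_apply, Matrix.vecMul_eq_sum, Finset.sum_apply]
    exact Finset.sum_congr rfl fun s _ => by rw [map_smul]; rfl

end Presentation

/-- Needed also for m ≤ 1, where the numeral 2 wraps around in `Fin (m + 1)`. -/
lemma fin_sub_one_add_two (m : ℕ) (r : Fin (m + 1)) : r - 1 + 2 = r + 1 := by
  have h : (2 : Fin (m + 1)) = 1 + 1 := Fin.ext (by simp [Fin.val_add])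
  rw [h, ← add_assoc, sub_add_cancel]

/-- The same cyclic word in the β and z is bracketed in two ways: as matrix entries ∑_i β_si z_it,
or as legs ∑_t z_it ⊗ β_tj of ℓ(c_ij). -/
lemma map_matTrace_splittingMatrix {N : ℕ} {V : Comod k C} {b : Module.Basis (Fin N) k V} {n : ℕ}
    (β : Fin n → E.assocModule V) (z : Fin N → Fin n → A)
    (hβ : ∀ i j, ℓ (V.coeff b i j) = ∑ t, z i t ⊗ₜ[k] comp A b j (β t).1)
    (hz : ∀ i t, E.leftCoact (z i t) = ∑ l, V.coeff b i l ⊗ₜ[k] z l t) (m : ℕ) :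
    PiTensorProduct.map (fun _ => E.inv.val.toLinearMap) (matTrace k (splittingMatrix β z hz) m) =
      galoisElement ℓ V b m := by
  have h1 : ∀ p : Fin (m + 1) → Fin n, PiTensorProduct.map (fun _ => E.inv.val.toLinearMap)
      (PiTensorProduct.tprod k fun r => splittingMatrix β z hz (p r) (p (r + 1))) =
      ∑ i : Fin (m + 1) → Fin N, PiTensorProduct.tprod k fun r =>
        comp A b (i r) (β (p r)).1 * z (i r) (p (r + 1)) := by
    intro p
    rw [PiTensorProduct.map_tprod]
    exact MultilinearMap.map_sum (PiTensorProduct.tprod k)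
      fun r i => comp A b i (β (p r)).1 * z i (p (r + 1))
  have h2 : ∀ i : Fin (m + 1) → Fin N, PiTensorProduct.map (fun _ => LinearMap.mul' k A)
      (shift k A m (PiTensorProduct.tprod k fun r => ℓ (V.coeff b (i (r + 1)) (i (r + 2))))) =
      ∑ p : Fin (m + 1) → Fin n, PiTensorProduct.tprod k fun r =>
        comp A b (i (r + 1)) (β (p (r - 1))).1 * z (i (r + 1)) (p r) := by
    intro i
    simp only [hβ]
    rw [MultilinearMap.map_sum, map_sum, map_sum]
    refine Finset.sum_congr rfl fun p _ => ?_
    rw [shift_tprod, PiTensorProduct.map_tprod]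
    congr 1
    funext r
    rw [LinearMap.mul'_apply]
    rw [fin_sub_one_add_two]
  rw [matTrace, map_sum, galoisElement]
  simp only [h1, h2]
  -- The two expansions agree after opposite cyclic shifts of the families i and p.
  rw [Finset.sum_comm,
    ← (Equiv.arrowCongr (Equiv.subRight (1 : Fin (m + 1))) (Equiv.refl (Fin N))).sum_comp]
  refine Finset.sum_congr rfl fun i _ => ?_
  rw [← (Equiv.arrowCongr (Equiv.addRight (1 : Fin (m + 1))) (Equiv.refl (Fin n))).sum_comp]
  refine Finset.sum_congr rfl fun p _ => ?_
  congr 1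
  funext r
  simp [Equiv.arrowCongr, sub_eq_add_neg]

end GaloisExt


/-! ### The map from Rep(C) to K₀(B) -/

namespace GaloisExt

variable {k C A : Type u} [Field k] [AddCommGroup C] [Module k C] [Coalgebra k C]
  [Ring A] [Algebra k A] {E : GaloisExt k C A} {ℓ : C →ₗ[k] A ⊗[k] A}

/-- For every basis of `V`, the module `A □^C V` is presented by an idempotent whose traces are the
elements of the Chern-Galois character. -/
lemma IsStrongConnection.exists_isPresented (hℓ : E.IsStrongConnection ℓ) (V : Comod k C) {N : ℕ}
    (b : Module.Basis (Fin N) k V) :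
    ∃ (n : ℕ) (e : Matrix (Fin n) (Fin n) E.inv), IsPresented (E.assocModule V) e ∧
      ∀ m, PiTensorProduct.map (fun _ => E.inv.val.toLinearMap) (matTrace k e m) =
        galoisElement ℓ V b m := by
  obtain ⟨n, β, z, hβ, hz⟩ := hℓ.exists_splitting V b
  exact ⟨n, splittingMatrix β z hz, isPresented_splittingMatrix hℓ β z hβ hz,
    map_matTrace_splittingMatrix β z hβ hz⟩

lemma _root_.ChernWeil.IsPresented.finite {B : Type u} [Ring B] {P : Type u} [AddCommGroup P]
    [Module B P] {κ : Type} [Fintype κ] {e : Matrix κ κ B} (h : IsPresented P e) :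
    Module.Finite B P := by
  obtain ⟨i, s, h1, -⟩ := h
  exact Module.Finite.of_surjective s (Function.RightInverse.surjective (LinearMap.congr_fun h1))

lemma _root_.ChernWeil.IsPresented.projective {B : Type u} [Ring B] {P : Type u} [AddCommGroup P]
    [Module B P] {κ : Type} [Fintype κ] {e : Matrix κ κ B} (h : IsPresented P e) :
    Module.Projective B P := by
  obtain ⟨i, s, h1, -⟩ := h
  exact Module.Projective.of_split i s h1

/-- The isomorphism class of a finitely generated projective module. -/
def _root_.ChernWeil.FGProj.isoClass {B : Type u} [Ring B] (P : FGProj B) : FGProj.IsoClass B :=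
  Quotient.mk _ P

lemma _root_.ChernWeil.FGProj.isoClass_eq {B : Type u} [Ring B] {P Q : FGProj B}
    (h : Nonempty (P ≃ₗ[B] Q)) : P.isoClass = Q.isoClass :=
  Quotient.sound h

/-- The finitely generated projective module `A □^C V`. -/
def IsStrongConnection.assocProj (hℓ : E.IsStrongConnection ℓ) (V : Comod k C) : FGProj E.inv :=
  have h := hℓ.exists_isPresented V (Module.finBasis k V)
  { carrier := E.assocModule V
    fin := h.choose_spec.choose_spec.1.finite
    proj := h.choose_spec.choose_spec.1.projective }

/-- The map `[V] ↦ [A □^C V]` on isomorphism classes. -/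
def IsStrongConnection.assocHom (hℓ : E.IsStrongConnection ℓ) :
    Comod.IsoClass k C →+ KZero E.inv where
  toFun := Quotient.lift (fun V => KZero.mk (hℓ.assocProj V)) fun V W h =>
    congrArg Algebra.GrothendieckAddGroup.of (Quotient.sound (E.nonempty_assocEquiv h))
  map_zero' := by
    have : Subsingleton (A ⊗[k] PUnit.{u + 1}) := inferInstance
    have h : Nonempty (E.assocModule (Comod.zero : Comod k C) ≃ₗ[E.inv] PUnit.{u + 1}) := by
      have : Subsingleton (E.assocModule (Comod.zero : Comod k C)) :=
        ⟨fun x y => Subtype.ext (Subsingleton.elim (α := A ⊗[k] PUnit.{u + 1}) x.1 y.1)⟩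
      exact ⟨0, 0, fun _ => Subsingleton.elim _ _, fun _ => Subsingleton.elim _ _⟩
    have e : (hℓ.assocProj Comod.zero).isoClass = 0 := FGProj.isoClass_eq (Q := ⟨PUnit⟩) h
    exact (congrArg Algebra.GrothendieckAddGroup.of e).trans (map_zero _)
  map_add' := by
    rintro ⟨V⟩ ⟨W⟩
    have e : (hℓ.assocProj (V.sum W)).isoClass =
        (hℓ.assocProj V).isoClass + (hℓ.assocProj W).isoClass :=
      FGProj.isoClass_eq (Q := ⟨hℓ.assocProj V × hℓ.assocProj W⟩) (E.nonempty_assocSum V W)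
    exact (congrArg Algebra.GrothendieckAddGroup.of e).trans (map_add _ _ _)

theorem IsStrongConnection.existsUnique_associated (hℓ : E.IsStrongConnection ℓ) :
    ∃! F : Rep k C →+ KZero E.inv, E.IsAssociated F := by
  refine ⟨Algebra.GrothendieckAddGroup.lift hℓ.assocHom, fun V => ⟨hℓ.assocProj V,
    ⟨LinearEquiv.refl _ _⟩, grothendieck_lift_of hℓ.assocHom _⟩, fun F hF =>
      grothendieck_hom_ext ?_⟩
  rintro ⟨V⟩
  obtain ⟨P, ⟨f⟩, hP⟩ := hF V
  refine hP.trans (Eq.trans ?_ (grothendieck_lift_of hℓ.assocHom _).symm)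
  exact congrArg Algebra.GrothendieckAddGroup.of (Quotient.sound ⟨f⟩)

end GaloisExt


/-! ### Adding a factor at either end of a tensor -/

section ConsTensor

variable (k : Type u) [Field k] (W : Type u) [AddCommGroup W] [Module k W]

/-- Insertion of a vector in front of a tensor. -/
def consTensor (n : ℕ) : W →ₗ[k] (⨂[k] (_ : Fin n), W) →ₗ[k] ⨂[k] (_ : Fin (n + 1)), W :=
  (PiTensorProduct.lift (R := k) (s := fun _ : Fin n => W)
    (E := ⨂[k] (_ : Fin (n + 1)), W)).toLinearMap ∘ₗ
      (PiTensorProduct.tprod k (s := fun _ : Fin (n + 1) => W)).curryLeft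

/-- Insertion of a vector at the end of a tensor. -/
def snocTensor (m : ℕ) : TPow k W m ⊗[k] W →ₗ[k] TPow k W (m + 1) :=
  (TensorPower.mulEquiv (R := k) (M := W) (n := m + 1) (m := 1)).toLinearMap ∘ₗ
    (PiTensorProduct.subsingletonEquiv (R := k)
      (s := fun _ : Fin 1 => W) 0).symm.toLinearMap.lTensor (TPow k W m)

variable {k W}

lemma consTensor_tprod (n : ℕ) (w : W) (a : Fin n → W) :
    consTensor k W n w (PiTensorProduct.tprod k a) =
      PiTensorProduct.tprod k (Fin.cons w a : Fin (n + 1) → W) := by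
  simp [consTensor, MultilinearMap.curryLeft_apply]

lemma single_tprod (w : W) :
    (PiTensorProduct.subsingletonEquiv (R := k) (s := fun _ : Fin 1 => W) 0).symm w =
      PiTensorProduct.tprod k fun _ => w := by
  rw [LinearEquiv.symm_apply_eq, PiTensorProduct.subsingletonEquiv_apply_tprod]

lemma snocTensor_tprod (m : ℕ) (w : W) (a : Fin (m + 1) → W) :
    snocTensor k W m (PiTensorProduct.tprod k a ⊗ₜ[k] w) =
      PiTensorProduct.tprod k (Fin.snoc a w : Fin (m + 2) → W) := by
  rw [snocTensor, LinearMap.comp_apply, LinearMap.lTensor_tmul, LinearEquiv.coe_coe,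
    LinearEquiv.coe_coe, single_tprod]
  refine (TensorPower.tprod_mul_tprod (R := k) a fun _ : Fin 1 => w).trans ?_
  rw [Fin.append_right_eq_snoc]

lemma snocTensor_consTensor (m : ℕ) (x z : W) (w : TPow k W m) :
    snocTensor k W (m + 1) (consTensor k W (m + 1) x w ⊗ₜ[k] z) =
      consTensor k W (m + 2) x (snocTensor k W m (w ⊗ₜ[k] z)) := by
  induction w using PiTensorProduct.induction_on with
  | add x y hx hy => simp only [map_add, TensorProduct.add_tmul, hx, hy]
  | smul_tprod r a =>
    simp only [map_smul, ← TensorProduct.smul_tmul', consTensor_tprod, snocTensor_tprod,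
      Fin.cons_snoc_eq_snoc_cons]

lemma rot_snocTensor (m : ℕ) (t : TPow k W m ⊗[k] W) :
    PiTensorProduct.reindex k (fun _ : Fin (m + 2) => W) (finRotate (m + 2)) (snocTensor k W m t) =
      TensorProduct.lift (consTensor k W (m + 1)) (TensorProduct.comm k _ _ t) := by
  induction t with
  | zero => simp
  | add x y hx hy => simp only [map_add, hx, hy]
  | tmul w c =>
    rw [TensorProduct.comm_tmul, TensorProduct.lift.tmul]
    induction w using PiTensorProduct.induction_on with
    | add x y hx hy => simp only [map_add, TensorProduct.add_tmul, hx, hy]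
    | smul_tprod r a =>
      rw [← TensorProduct.smul_tmul', map_smul, map_smul, map_smul, snocTensor_tprod,
        consTensor_tprod, PiTensorProduct.reindex_tprod]
      congr 2
      funext i
      refine Fin.cases ?_ (fun s => ?_) i
      · rw [show (finRotate (m + 2)).symm 0 = Fin.last (m + 1) by
          rw [Equiv.symm_apply_eq, finRotate_last], Fin.snoc_last, Fin.cons_zero]
      · rw [show (finRotate (m + 2)).symm s.succ = s.castSucc by
          rw [Equiv.symm_apply_eq, finRotate_apply, Fin.coeSucc_eq_succ], Fin.snoc_castSucc,
          Fin.cons_succ]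

variable (k W) in
/-- Insertion of two vectors in front of a tensor. -/
def consTwo (n : ℕ) :
    W ⊗[k] W →ₗ[k] (⨂[k] (_ : Fin n), W) →ₗ[k] ⨂[k] (_ : Fin (n + 2)), W :=
  TensorProduct.lift ((LinearMap.llcomp k _ _ _ ∘ₗ consTensor k W (n + 1)).compl₂
    (consTensor k W n))

lemma consTwo_tmul (n : ℕ) (x y : W) (w : ⨂[k] (_ : Fin n), W) :
    consTwo k W n (x ⊗ₜ[k] y) w = consTensor k W (n + 1) x (consTensor k W n y w) := rfl

end ConsTensor

/-! ### Iterated coproducts, cotraces and characters -/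

section IterComul

variable {k C : Type u} [Field k] [AddCommGroup C] [Module k C] [Coalgebra k C]

lemma iterComul_zero (c : C) : iterComul k C 0 c = PiTensorProduct.tprod k fun _ => c :=
  single_tprod c

lemma iterComul_succ (m : ℕ) (c : C) : iterComul k C (m + 1) c =
    snocTensor k C m ((iterComul k C m).rTensor C (Coalgebra.comul c)) := by
  rw [snocTensor, LinearMap.comp_apply, ← LinearMap.comp_apply (f := LinearMap.lTensor _ _),
    LinearMap.lTensor_comp_rTensor]
  rfl

/-- Coassociativity: the recursion that splits off the last factor equally splits off the first. -/
lemma iterComul_succ' (m : ℕ) (c : C) : iterComul k C (m + 1) c =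
    TensorProduct.lift (consTensor k C (m + 1))
      ((iterComul k C m).lTensor C (Coalgebra.comul c)) := by
  induction m generalizing c with
  | zero =>
    rw [iterComul_succ]
    induction Coalgebra.comul (R := k) c with
    | zero => simp
    | add x y hx hy => simp only [map_add, hx, hy]
    | tmul x y =>
      rw [LinearMap.rTensor_tmul, LinearMap.lTensor_tmul, TensorProduct.lift.tmul, iterComul_zero,
        iterComul_zero, consTensor_tprod, snocTensor_tprod]
      congr 1
      funext r
      refine Fin.cases rfl (fun s => ?_) r
      obtain rfl : s = Fin.last 0 := Subsingleton.elim (α := Fin 1) _ _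
      rw [Fin.cons_succ, Fin.succ_last, Fin.snoc_last]
  | succ m ih =>
    have h1 : ∀ t : (C ⊗[k] C) ⊗[k] C, snocTensor k C (m + 1)
        ((TensorProduct.lift (consTensor k C (m + 1)) ∘ₗ (iterComul k C m).lTensor C).rTensor C t) =
        TensorProduct.lift (consTensor k C (m + 2))
          ((snocTensor k C m ∘ₗ (iterComul k C m).rTensor C).lTensor C
            (TensorProduct.assoc k C C C t)) := by
      intro t
      induction t with
      | zero => simp
      | add x y hx hy => simp only [map_add, hx, hy]
      | tmul u z =>
        induction u with
        | zero => simp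
        | add x y hx hy => simp only [TensorProduct.add_tmul, map_add, hx, hy]
        | tmul x y =>
          simp only [LinearMap.rTensor_tmul, LinearMap.lTensor_tmul, LinearMap.comp_apply,
            TensorProduct.lift.tmul, TensorProduct.assoc_tmul, snocTensor_consTensor]
    have h2 : iterComul k C (m + 1) = (TensorProduct.lift (consTensor k C (m + 1)) ∘ₗ
        (iterComul k C m).lTensor C) ∘ₗ Coalgebra.comul := LinearMap.ext ih
    have h3 : iterComul k C (m + 1) = (snocTensor k C m ∘ₗ
        (iterComul k C m).rTensor C) ∘ₗ Coalgebra.comul := LinearMap.ext (iterComul_succ m)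
    rw [iterComul_succ]
    conv_lhs => rw [h2, LinearMap.rTensor_comp_apply, h1, Coalgebra.coassoc_apply]
    conv_rhs => rw [h3, LinearMap.lTensor_comp_apply]

/-- On cotraces the iterated coproduct is invariant under rotations. -/
lemma rot_iterComul (m : ℕ) {c : C} (hc : c ∈ cotraces k C) :
    PiTensorProduct.reindex k (fun _ : Fin (m + 1) => C) (finRotate (m + 1)) (iterComul k C m c) =
      iterComul k C m c := by
  cases m with
  | zero => rw [iterComul_zero, PiTensorProduct.reindex_tprod]
  | succ m =>
    have hc' : TensorProduct.comm k C C (Coalgebra.comul c) = Coalgebra.comul (R := k) c :=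
      (LinearMap.mem_eqLocus.1 hc).symm
    conv_rhs => rw [iterComul_succ', ← hc']
    rw [iterComul_succ, rot_snocTensor]
    congr 1
    induction Coalgebra.comul (R := k) c with
    | zero => simp
    | add x y hx hy => simp only [map_add, hx, hy]
    | tmul x y => simp

variable (k C) in
/-- The coproduct of the first factor. -/
def splitFirst (m : ℕ) : TPow k C m →ₗ[k] TPow k C (m + 1) :=
  PiTensorProduct.lift (LinearMap.uncurryLeft (PiTensorProduct.lift.symm.toLinearMap ∘ₗ
    consTwo k C m ∘ₗ Coalgebra.comul))

lemma splitFirst_tprod (m : ℕ) (d : Fin (m + 1) → C) :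
    splitFirst k C m (PiTensorProduct.tprod k d) =
      consTwo k C m (Coalgebra.comul (d 0)) (PiTensorProduct.tprod k (Fin.tail d)) := by
  rw [splitFirst, PiTensorProduct.lift.tprod, LinearMap.uncurryLeft_apply]
  rfl

lemma splitFirst_consTensor (m : ℕ) (c : C) (w : TPow k C m) :
    splitFirst k C (m + 1) (consTensor k C (m + 1) c w) =
      consTwo k C (m + 1) (Coalgebra.comul c) w := by
  induction w using PiTensorProduct.induction_on with
  | add x y hx hy => simp only [map_add, hx, hy]
  | smul_tprod r a =>
    simp only [map_smul]
    rw [consTensor_tprod, splitFirst_tprod, Fin.cons_zero, Fin.tail_cons]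

/-- Coassociativity again, in the form that presents the first two factors as a single coproduct,
where bicolinearity of ℓ can be applied. -/
lemma iterComul_eq_splitFirst (m : ℕ) (c : C) :
    iterComul k C (m + 1) c = splitFirst k C m (iterComul k C m c) := by
  cases m with
  | zero =>
    rw [iterComul_zero, splitFirst_tprod, iterComul_succ']
    induction Coalgebra.comul (R := k) c with
    | zero => simp
    | add x y hx hy => simp only [map_add, LinearMap.add_apply, hx, hy]
    | tmul x y =>
      rw [LinearMap.lTensor_tmul, TensorProduct.lift.tmul, consTwo_tmul, consTensor_tprod,
        iterComul_zero]
      congr 2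
      funext r
      obtain rfl : r = 0 := Subsingleton.elim (α := Fin 1) _ _
      rfl
  | succ m =>
    have h1 : ∀ t : (C ⊗[k] C) ⊗[k] C,
        TensorProduct.lift (consTwo k C (m + 1)) ((iterComul k C m).lTensor (C ⊗[k] C) t) =
        TensorProduct.lift (consTensor k C (m + 2))
          ((TensorProduct.lift (consTensor k C (m + 1)) ∘ₗ (iterComul k C m).lTensor C).lTensor C
            (TensorProduct.assoc k C C C t)) := by
      intro t
      induction t with
      | zero => simp
      | add x y hx hy => simp only [map_add, hx, hy]
      | tmul u z =>
        induction u with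
        | zero => simp
        | add x y hx hy => simp only [TensorProduct.add_tmul, map_add, hx, hy]
        | tmul x y =>
          simp only [LinearMap.lTensor_tmul, LinearMap.comp_apply, TensorProduct.lift.tmul,
            TensorProduct.assoc_tmul, consTwo_tmul]
    have h2 : iterComul k C (m + 1) = (TensorProduct.lift (consTensor k C (m + 1)) ∘ₗ
        (iterComul k C m).lTensor C) ∘ₗ Coalgebra.comul := LinearMap.ext (iterComul_succ' m)
    have h3 : ∀ t : C ⊗[k] C, splitFirst k C (m + 1) (TensorProduct.lift (consTensor k C (m + 1))
        ((iterComul k C m).lTensor C t)) = TensorProduct.lift (consTwo k C (m + 1))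
          ((iterComul k C m).lTensor (C ⊗[k] C) (Coalgebra.comul.rTensor C t)) := by
      intro t
      induction t with
      | zero => simp
      | add x y hx hy => simp only [map_add, hx, hy]
      | tmul x y =>
        simp only [LinearMap.lTensor_tmul, LinearMap.rTensor_tmul, TensorProduct.lift.tmul,
          splitFirst_consTensor]
    rw [iterComul_succ' m, h3, h1, Coalgebra.coassoc_apply, iterComul_succ' (m + 1)]
    conv_lhs => rw [h2, LinearMap.lTensor_comp_apply]

/-- A sum over index paths from p to q: Δ(c_pq) = ∑ c_pj ⊗ c_jq inserts one intermediate index at a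
time. -/
lemma iterComul_coeff (V : Comod k C) {ι : Type*} [Fintype ι] (b : Module.Basis ι k V) (m : ℕ)
    (p q : ι) : iterComul k C m (V.coeff b p q) =
      ∑ i : Fin m → ι, PiTensorProduct.tprod k fun r =>
        V.coeff b ((Fin.cons p i : Fin (m + 1) → ι) r) ((Fin.snoc i q : Fin (m + 1) → ι) r) := by
  induction m generalizing p q with
  | zero =>
    rw [iterComul_zero, Fintype.sum_unique]
    congr 1
    funext r
    obtain rfl : r = 0 := Subsingleton.elim (α := Fin 1) _ _
    rfl
  | succ m ih =>
    rw [iterComul_succ', V.comul_coeff, map_sum, map_sum,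
      ← (Fin.consEquiv fun _ : Fin (m + 1) => ι).sum_comp, Fintype.sum_prod_type]
    refine Finset.sum_congr rfl fun j _ => ?_
    rw [LinearMap.lTensor_tmul, TensorProduct.lift.tmul, ih, map_sum]
    refine Finset.sum_congr rfl fun i _ => ?_
    rw [consTensor_tprod]
    congr 1
    funext r
    change _ = V.coeff b ((Fin.cons p (Fin.cons j i : Fin (m + 1) → ι) : Fin (m + 2) → ι) r)
      ((Fin.snoc (Fin.cons j i : Fin (m + 1) → ι) q : Fin (m + 2) → ι) r)
    rw [← Fin.cons_snoc_eq_snoc_cons]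
    refine Fin.cases rfl (fun s => rfl) r

/-- Taking p = q and summing closes the paths up. -/
lemma iterComul_char (V : Comod k C) {N : ℕ} (b : Module.Basis (Fin N) k V) (m : ℕ) :
    iterComul k C m V.char =
      ∑ i : Fin (m + 1) → Fin N, PiTensorProduct.tprod k fun r => V.coeff b (i r) (i (r + 1)) := by
  rw [V.char_eq b, map_sum, ← (Fin.consEquiv fun _ : Fin (m + 1) => Fin N).sum_comp,
    Fintype.sum_prod_type]
  refine Finset.sum_congr rfl fun p _ => ?_
  rw [iterComul_coeff]
  refine Finset.sum_congr rfl fun i _ => ?_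
  congr 1
  funext r
  change _ = V.coeff b ((Fin.cons p i : Fin (m + 1) → Fin N) r)
    ((Fin.cons p i : Fin (m + 1) → Fin N) (r + 1))
  congr 1
  induction r using Fin.lastCases with
  | last => rw [Fin.snoc_last, Fin.last_add_one, Fin.cons_zero]
  | cast s => rw [Fin.snoc_castSucc, Fin.coeSucc_eq_succ, Fin.cons_succ]

end IterComul


/-! ### Operators on single factors, rotations and the regrouping map -/

section Powers

variable {k : Type u} [Field k]

section Slot

variable {W W' : Type u} [AddCommGroup W] [Module k W] [AddCommGroup W'] [Module k W']

variable (k) in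
/-- The endomorphism `f` of `W` acting on one factor of a tensor power. -/
def slot {n : ℕ} (s : Fin n) (f : W →ₗ[k] W) : (⨂[k] (_ : Fin n), W) →ₗ[k] ⨂[k] (_ : Fin n), W :=
  PiTensorProduct.map (Function.update (fun _ => LinearMap.id) s f)

lemma slot_tprod {n : ℕ} (s : Fin n) (f : W →ₗ[k] W) (a : Fin n → W) :
    slot k s f (PiTensorProduct.tprod k a) =
      PiTensorProduct.tprod k (Function.update a s (f (a s))) := by
  rw [slot, PiTensorProduct.map_tprod]
  congr 1
  funext r
  rcases eq_or_ne r s with rfl | h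
  · rw [Function.update_self, Function.update_self]
  · rw [Function.update_of_ne h, Function.update_of_ne h, LinearMap.id_apply]

lemma slot_sub {n : ℕ} (s : Fin n) (f : W →ₗ[k] W) :
    slot k s (LinearMap.id - f) = LinearMap.id - slot k s f := by
  rw [eq_sub_iff_add_eq, slot, slot, ← PiTensorProduct.map_update_add, sub_add_cancel,
    Function.update_eq_self_iff.2 rfl, PiTensorProduct.map_id]

/-- p ⊗ ⋯ ⊗ p is the composite of the operators p on the individual factors, each of which fixes x.
-/
lemma map_eq_self_of_slot {n : ℕ} {p : W →ₗ[k] W} {x : ⨂[k] (_ : Fin n), W}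
    (h : ∀ s, slot k s p x = x) : PiTensorProduct.map (fun _ => p) x = x := by
  have H : ∀ F : Finset (Fin n),
      PiTensorProduct.map (fun r => if r ∈ F then p else LinearMap.id) x = x := by
    intro F
    induction F using Finset.induction_on with
    | empty => simp [PiTensorProduct.map_id]
    | insert s F hs ih =>
      have e : (fun r => if r ∈ insert s F then p else LinearMap.id) = fun r =>
          (if r ∈ F then p else LinearMap.id) ∘ₗ Function.update (fun _ => LinearMap.id) s p r := by
        funext r
        rcases eq_or_ne r s with rfl | hr
        · rw [if_pos (Finset.mem_insert_self _ _), if_neg hs, Function.update_self,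
            LinearMap.id_comp]
        · rw [Function.update_of_ne hr, LinearMap.comp_id]
          simp only [Finset.mem_insert, hr, false_or]
      rw [e, PiTensorProduct.map_comp, LinearMap.comp_apply]
      exact (congrArg _ (h s)).trans ih
  simpa using H Finset.univ

/-- Over a field an injection has a linear retraction, whose tensor power is again a retraction. -/
lemma map_injective {f : W →ₗ[k] W'} (hf : Function.Injective f) (m : ℕ) :
    Function.Injective (PiTensorProduct.map fun _ : Fin (m + 1) => f) := by
  obtain ⟨g, hg⟩ := f.exists_leftInverse_of_injective (LinearMap.ker_eq_bot.2 hf)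
  refine Function.LeftInverse.injective (g := PiTensorProduct.map fun _ => g) fun x => ?_
  rw [← LinearMap.comp_apply, ← PiTensorProduct.map_comp, hg, PiTensorProduct.map_id,
    LinearMap.id_apply]

lemma map_map {W'' : Type u} [AddCommGroup W''] [Module k W''] (g : W' →ₗ[k] W'') (f : W →ₗ[k] W')
    {n : ℕ} (x : ⨂[k] (_ : Fin n), W) :
    PiTensorProduct.map (fun _ => g) (PiTensorProduct.map (fun _ => f) x) =
      PiTensorProduct.map (fun _ => g ∘ₗ f) x := by
  rw [PiTensorProduct.map_comp, LinearMap.comp_apply]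

lemma map_consTensor (f : W →ₗ[k] W') (n : ℕ) (w : W) (x : ⨂[k] (_ : Fin n), W) :
    PiTensorProduct.map (fun _ => f) (consTensor k W n w x) =
      consTensor k W' n (f w) (PiTensorProduct.map (fun _ => f) x) := by
  induction x using PiTensorProduct.induction_on with
  | add x y hx hy => simp only [map_add, hx, hy]
  | smul_tprod r a =>
    simp only [map_smul, consTensor_tprod, PiTensorProduct.map_tprod]
    congr 2
    funext r
    refine Fin.cases rfl (fun s => rfl) r

lemma map_consTwo (f : W →ₗ[k] W') (n : ℕ) (z : W ⊗[k] W) (x : ⨂[k] (_ : Fin n), W) :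
    PiTensorProduct.map (fun _ => f) (consTwo k W n z x) =
      consTwo k W' n (TensorProduct.map f f z) (PiTensorProduct.map (fun _ => f) x) := by
  induction z with
  | zero => simp
  | add z w hz hw => simp only [map_add, LinearMap.add_apply, hz, hw]
  | tmul z w =>
    rw [TensorProduct.map_tmul, consTwo_tmul, consTwo_tmul, map_consTensor, map_consTensor]

end Slot

section Ring

variable {B B' : Type u} [Ring B] [Algebra k B] [Ring B'] [Algebra k B']

lemma rot_map (f : B →ₗ[k] B') (m : ℕ) (x : TPow k B m) :
    rot k B' m (PiTensorProduct.map (fun _ => f) x) =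
      PiTensorProduct.map (fun _ => f) (rot k B m x) :=
  (PiTensorProduct.map_reindex (fun _ => f) (finRotate (m + 1)) x).symm

lemma face_map (f : B →ₐ[k] B') (m : ℕ) (i : Fin (m + 1)) (x : TPow k B (m + 1)) :
    face k B' m i (PiTensorProduct.map (fun _ => f.toLinearMap) x) =
      PiTensorProduct.map (fun _ => f.toLinearMap) (face k B m i x) := by
  induction x using PiTensorProduct.induction_on with
  | add x y hx hy => simp only [map_add, hx, hy]
  | smul_tprod r a =>
    simp only [map_smul, PiTensorProduct.map_tprod, face_tprod]
    congr 2
    funext r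
    rcases eq_or_ne r i with rfl | h
    · simp only [Function.update_self, AlgHom.toLinearMap_apply, map_mul]
    · simp only [Function.update_of_ne h]

lemma slot_rot (m : ℕ) (s : Fin (m + 1)) (f : B →ₗ[k] B) (x : TPow k B m) :
    slot k s f (rot k B m x) = rot k B m (slot k (s - 1) f x) := by
  induction x using PiTensorProduct.induction_on with
  | add x y hx hy => simp only [map_add, hx, hy]
  | smul_tprod r a =>
    simp only [map_smul, rot_tprod, slot_tprod]
    congr 2
    funext r
    rcases eq_or_ne r s with rfl | h
    · simp only [Function.update_self]
    · rw [Function.update_of_ne h, Function.update_of_ne fun e => h (sub_left_injective e)]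

lemma face_succ_rot (m : ℕ) (i : Fin m) (x : TPow k B (m + 1)) :
    face k B m i.succ (rot k B (m + 1) x) = rot k B m (face k B m i.castSucc x) := by
  induction x using PiTensorProduct.induction_on with
  | add x y hx hy => simp only [map_add, hx, hy]
  | smul_tprod r a =>
    simp only [map_smul, rot_tprod, face_tprod]
    congr 2
    funext r
    have e : r - 1 = i.castSucc ↔ r = i.succ := by
      rw [← fin_succ_sub_one, sub_left_inj]
    by_cases h : r = i.succ
    · subst h
      rw [Function.update_self, e.2 rfl, Function.update_self, fin_succ_sub_one,
        ← Fin.succ_castSucc, fin_succ_sub_one]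
    · rw [Function.update_of_ne h, Function.update_of_ne (mt e.1 h), succAbove_succ_sub_one]

/-- Since d_{i+1} rot = rot d_i, the first face of a rotation-invariant tensor determines the
others. -/
lemma face_eq_of_rot {m : ℕ} {x : TPow k B (m + 1)} {y : TPow k B m} (hx : rot k B (m + 1) x = x)
    (hy : rot k B m y = y) (h : face k B m 0 x = y) (i : Fin (m + 1)) : face k B m i x = y := by
  induction i using Fin.induction with
  | zero => exact h
  | succ i ih => rw [← hx, face_succ_rot, ih, hy]

open Fin.NatCast in
lemma slot_eq_zero_of_rot {m : ℕ} {f : B →ₗ[k] B} {x : TPow k B m} (hx : rot k B m x = x)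
    {s : Fin (m + 1)} (h : slot k s f x = 0) (r : Fin (m + 1)) : slot k r f x = 0 := by
  have H : ∀ j : ℕ, slot k (s + (j : Fin (m + 1))) f x = 0 := by
    intro j
    induction j with
    | zero => rwa [Nat.cast_zero, add_zero]
    | succ j ih =>
      rw [← hx, slot_rot, Nat.cast_succ, ← add_assoc, add_sub_cancel_right, ih, map_zero]
  have := H (r - s : Fin (m + 1)).val
  rwa [Fin.cast_val_eq_self, add_sub_cancel] at this

end Ring

section Shift

variable {A : Type u} [Ring A] [Algebra k A] {X : Type u} [AddCommGroup X] [Module k X]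

lemma tpow_ext {n : ℕ} {f g : (⨂[k] (_ : Fin n), A ⊗[k] A) →ₗ[k] X}
    (h : ∀ x y : Fin n → A, f (PiTensorProduct.tprod k fun r => x r ⊗ₜ[k] y r) =
      g (PiTensorProduct.tprod k fun r => x r ⊗ₜ[k] y r)) : f = g := by
  refine PiTensorProduct.ext_of_span_eq_top (γ := fun _ : Fin n => A × A)
    (g := fun _ q => q.1 ⊗ₜ[k] q.2) (fun _ => ?_) fun j => h (fun r => (j r).1) fun r => (j r).2
  rw [← TensorProduct.span_tmul_eq_top k A A]
  congr 1
  ext t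
  simp

lemma rot_shift (m : ℕ) (x : TPow k (A ⊗[k] A) m) :
    rot k (A ⊗[k] A) m (shift k A m x) = shift k A m (rot k (A ⊗[k] A) m x) := by
  have H : rot k (A ⊗[k] A) m ∘ₗ shift k A m = shift k A m ∘ₗ rot k (A ⊗[k] A) m :=
    tpow_ext fun x y => by
      rw [LinearMap.comp_apply, LinearMap.comp_apply, shift_tprod, rot_tprod, rot_tprod,
        shift_tprod]
  exact LinearMap.congr_fun H x

variable (k A) in
/-- `(x₀ ⊗ y₀) ⊗ ⋯ ⊗ (xₘ ⊗ yₘ) ↦ yₘx₀ ⊗ y₀x₁ ⊗ ⋯ ⊗ yₘ₋₁xₘ`. -/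
def shiftMul (m : ℕ) : TPow k (A ⊗[k] A) m →ₗ[k] TPow k A m :=
  PiTensorProduct.map (fun _ => LinearMap.mul' k A) ∘ₗ shift k A m

lemma shiftMul_tprod (m : ℕ) (x y : Fin (m + 1) → A) :
    shiftMul k A m (PiTensorProduct.tprod k fun r => x r ⊗ₜ[k] y r) =
      PiTensorProduct.tprod k fun r => y (r - 1) * x r := by
  rw [shiftMul, LinearMap.comp_apply, shift_tprod, PiTensorProduct.map_tprod]
  rfl

/-- Joining the first two factors produces y_m (x y) x₀ from z = x ⊗ y, so the inserted tensor
enters only through its product. -/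
lemma face_zero_shiftMul_aux (m : ℕ) (z : A ⊗[k] A) (x y : Fin (m + 1) → A) :
    face k A m 0 (shiftMul k A (m + 1) (consTensor k (A ⊗[k] A) (m + 1) z
      (PiTensorProduct.tprod k fun r => x r ⊗ₜ[k] y r))) =
    PiTensorProduct.tprod k (Function.update (fun r => y (r - 1) * x r) 0
      (y (0 - 1) * LinearMap.mul' k A z * x 0)) := by
  induction z with
  | zero => simp [(PiTensorProduct.tprod k).map_update_zero]
  | add z w hz hw =>
    simp only [map_add, LinearMap.add_apply, hz, hw, mul_add, add_mul,
      MultilinearMap.map_update_add]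
  | tmul a b =>
    rw [consTensor_tprod]
    have e : (Fin.cons (a ⊗ₜ[k] b) fun r => x r ⊗ₜ[k] y r : Fin (m + 2) → A ⊗[k] A) =
        fun r => (Fin.cons a x : Fin (m + 2) → A) r ⊗ₜ[k] (Fin.cons b y : Fin (m + 2) → A) r := by
      funext r
      refine Fin.cases rfl (fun s => rfl) r
    rw [e, shiftMul_tprod, face_tprod]
    congr 1
    funext r
    refine Fin.cases ?_ (fun s => ?_) r
    · rw [Function.update_self, Function.update_self, fin_succ_sub_one, fin_zero_sub_one,
        show (0 : Fin (m + 1)).castSucc = 0 from rfl, fin_zero_sub_one, ← Fin.succ_last]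
      simp only [Fin.cons_zero, Fin.cons_succ, LinearMap.mul'_apply, mul_assoc]
    · rw [Function.update_of_ne (Fin.succ_ne_zero s), Function.update_of_ne (Fin.succ_ne_zero s),
        show (0 : Fin (m + 1)).castSucc.succAbove s.succ = s.succ.succ from rfl, fin_succ_sub_one,
        fin_succ_sub_one, ← Fin.succ_castSucc]
      rfl

lemma face_zero_shiftMul (m : ℕ) {z : A ⊗[k] A} {r : k} (hz : LinearMap.mul' k A z = r • 1)
    (w : TPow k (A ⊗[k] A) m) :
    face k A m 0 (shiftMul k A (m + 1) (consTensor k (A ⊗[k] A) (m + 1) z w)) =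
      r • shiftMul k A m w := by
  have H : face k A m 0 ∘ₗ shiftMul k A (m + 1) ∘ₗ consTensor k (A ⊗[k] A) (m + 1) z =
      r • shiftMul k A m :=
    tpow_ext fun x y => by
      simp only [LinearMap.comp_apply]
      rw [face_zero_shiftMul_aux, hz, LinearMap.smul_apply, shiftMul_tprod, mul_smul_comm, mul_one,
        smul_mul_assoc, MultilinearMap.map_update_smul]
      congr 2
      exact Function.update_eq_self (0 : Fin (m + 1)) fun r => y (r - 1) * x r
  exact LinearMap.congr_fun H w

variable (k A) in
/-- `(x ⊗ y) ⊗ (x' ⊗ y') ↦ (x ⊗ y') ⊗ (y ⊗ x')`. -/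
def outer (Y Z : Type u) [AddCommGroup Y] [Module k Y] [AddCommGroup Z] [Module k Z] :
    (A ⊗[k] Y) ⊗[k] (Z ⊗[k] A) ≃ₗ[k] (A ⊗[k] A) ⊗[k] (Y ⊗[k] Z) :=
  (TensorProduct.congr (LinearEquiv.refl k _) (TensorProduct.comm k Z A)).trans
    (TensorProduct.tensorTensorTensorComm k A Y A Z)

lemma outer_tmul {Y Z : Type u} [AddCommGroup Y] [Module k Y] [AddCommGroup Z] [Module k Z]
    (x x' : A) (y : Y) (z : Z) : outer k A Y Z ((x ⊗ₜ[k] y) ⊗ₜ[k] (z ⊗ₜ[k] x')) =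
      (x ⊗ₜ[k] x') ⊗ₜ[k] (y ⊗ₜ[k] z) := by
  simp [outer]

lemma outer_symm_tmul {Y Z : Type u} [AddCommGroup Y] [Module k Y] [AddCommGroup Z] [Module k Z]
    (x x' : A) (y : Y) (z : Z) : (outer k A Y Z).symm ((x ⊗ₜ[k] x') ⊗ₜ[k] (y ⊗ₜ[k] z)) =
      (x ⊗ₜ[k] y) ⊗ₜ[k] (z ⊗ₜ[k] x') := by
  rw [LinearEquiv.symm_apply_eq, outer_tmul]

/-- After regrouping, factor 1 consists of the two inner legs of the first two tensors. The zeros on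
the right are placeholders that occur only in the overwritten factor. -/
lemma shift_consTwo_aux (m : ℕ) (a a' : A) (v : A ⊗[k] A) (x y : Fin m → A) :
    shift k A (m + 1) (consTwo k (A ⊗[k] A) m ((outer k A A A).symm ((a ⊗ₜ[k] a') ⊗ₜ[k] v))
      (PiTensorProduct.tprod k fun r => x r ⊗ₜ[k] y r)) =
    PiTensorProduct.tprod k (Function.update (fun r : Fin (m + 2) =>
      (Fin.cons 0 (Fin.cons a' y) : Fin (m + 2) → A) (r - 1) ⊗ₜ[k]
        (Fin.cons a (Fin.cons 0 x) : Fin (m + 2) → A) r) 1 v) := by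
  induction v with
  | zero => simp [(PiTensorProduct.tprod k).map_update_zero]
  | add z w hz hw =>
    rw [TensorProduct.tmul_add, map_add, map_add, LinearMap.add_apply, map_add, hz, hw,
      MultilinearMap.map_update_add]
  | tmul b b' =>
    rw [outer_symm_tmul, consTwo_tmul, consTensor_tprod, consTensor_tprod]
    have e : (Fin.cons (a ⊗ₜ[k] b) (Fin.cons (b' ⊗ₜ[k] a') fun r => x r ⊗ₜ[k] y r) :
        Fin (m + 2) → A ⊗[k] A) = fun r => (Fin.cons a (Fin.cons b' x) : Fin (m + 2) → A) r ⊗ₜ[k]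
          (Fin.cons b (Fin.cons a' y) : Fin (m + 2) → A) r := by
      funext r
      refine Fin.cases rfl (fun s => Fin.cases rfl (fun t => rfl) s) r
    rw [e, shift_tprod]
    congr 1
    funext r
    refine Fin.cases ?_ (fun s => Fin.cases ?_ (fun t => ?_) s) r
    · rw [Function.update_of_ne Fin.zero_ne_one, fin_zero_sub_one, ← Fin.succ_last]
      rfl
    · rw [show (0 : Fin (m + 1)).succ = 1 from rfl, Function.update_self, sub_self]
      rfl
    · have h : t.succ.succ ≠ 1 := fun e => Fin.succ_ne_zero t (Fin.succ_injective _ e)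
      rw [Function.update_of_ne h, fin_succ_sub_one, ← Fin.succ_castSucc]
      rfl

/-- An operator on factor 1 acts only on the inner legs isolated by `outer`; if it kills these, it
kills the regrouped tensor. -/
lemma slot_shift_consTwo (m : ℕ) (q : A ⊗[k] A →ₗ[k] A ⊗[k] A) {z : (A ⊗[k] A) ⊗[k] (A ⊗[k] A)}
    (hz : q.lTensor (A ⊗[k] A) (outer k A A A z) = 0) (w : ⨂[k] (_ : Fin m), A ⊗[k] A) :
    slot k 1 q (shift k A (m + 1) (consTwo k (A ⊗[k] A) m z w)) = 0 := by
  have H : ∀ t, slot k 1 q ∘ₗ shift k A (m + 1) ∘ₗ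
      consTwo k (A ⊗[k] A) m ((outer k A A A).symm t) =
      shift k A (m + 1) ∘ₗ consTwo k (A ⊗[k] A) m
        ((outer k A A A).symm (q.lTensor (A ⊗[k] A) t)) := by
    intro t
    induction t with
    | zero => simp
    | add s t hs ht => simp only [map_add, LinearMap.comp_add, hs, ht]
    | tmul u v =>
      induction u with
      | zero => simp
      | add s t hs ht => simp only [TensorProduct.add_tmul, map_add, LinearMap.comp_add, hs, ht]
      | tmul a a' =>
        refine tpow_ext fun x y => ?_
        simp only [LinearMap.comp_apply, LinearMap.lTensor_tmul, shift_consTwo_aux]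
        rw [slot_tprod, Function.update_self, Function.update_idem]
  have h := LinearMap.congr_fun (H (outer k A A A z)) w
  rw [hz, LinearEquiv.symm_apply_apply] at h
  simpa using h

end Shift

end Powers


/-- A linear map `f` over a field has a generalized inverse. -/
lemma exists_generalizedInverse {k W W' : Type*} [Field k] [AddCommGroup W] [Module k W]
    [AddCommGroup W'] [Module k W'] (f : W →ₗ[k] W') :
    ∃ s : W' →ₗ[k] W, ∀ w, f (s (f w)) = f w := by
  obtain ⟨r, hr⟩ := f.rangeRestrict.exists_rightInverse_of_surjective f.range_rangeRestrict
  obtain ⟨l, hl⟩ := (LinearMap.range f).subtype.exists_leftInverse_of_injective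
    (LinearMap.range f).ker_subtype
  refine ⟨r ∘ₗ l, fun w => ?_⟩
  have h1 : l (f w) = f.rangeRestrict w := LinearMap.congr_fun hl (f.rangeRestrict w)
  have h2 := congrArg Subtype.val (LinearMap.congr_fun hr (f.rangeRestrict w))
  rw [LinearMap.comp_apply, h1]
  exact h2

/-! ### Chern-Weil cycles and comparison of the characters -/

namespace GaloisExt

variable {k C A : Type u} [Field k] [AddCommGroup C] [Module k C] [Coalgebra k C]
  [Ring A] [Algebra k A] {E : GaloisExt k C A} {ℓ : C →ₗ[k] A ⊗[k] A}

lemma rot_weilElement (ℓ : C →ₗ[k] A ⊗[k] A) (m : ℕ) {c : C} (hc : c ∈ cotraces k C) :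
    rot k (A ⊗[k] A) m (weilElement ℓ m c) = weilElement ℓ m c := by
  rw [weilElement, LinearMap.comp_apply, LinearMap.comp_apply, rot_shift]
  congr 1
  exact (PiTensorProduct.map_reindex (fun _ => ℓ) (finRotate (m + 1)) _).symm.trans
    (congrArg _ (rot_iterComul m hc))

/-- The image of the Chern-Weil element in the tensor powers of `A`. -/
def weilImage (ℓ : C →ₗ[k] A ⊗[k] A) (m : ℕ) : C →ₗ[k] TPow k A m :=
  PiTensorProduct.map (fun _ => LinearMap.mul' k A) ∘ₗ weilElement ℓ m

lemma rot_weilImage (ℓ : C →ₗ[k] A ⊗[k] A) (m : ℕ) {c : C} (hc : c ∈ cotraces k C) :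
    rot k A m (weilImage ℓ m c) = weilImage ℓ m c :=
  (PiTensorProduct.map_reindex (fun _ => LinearMap.mul' k A) (finRotate (m + 1)) _).symm.trans
    (congrArg _ (rot_weilElement ℓ m hc))

/-- The face multiplies the two legs of ℓ(c₍₁₎), which gives the counit of c₍₁₎, and counitality
removes one factor of the iterated coproduct. -/
lemma IsStrongConnection.face_zero_weilImage (hℓ : E.IsStrongConnection ℓ) (m : ℕ) (c : C) :
    face k A m 0 (weilImage ℓ (m + 1) c) = weilImage ℓ m c := by
  have H : ∀ t : C ⊗[k] C, face k A m 0 (shiftMul k A (m + 1) (PiTensorProduct.map (fun _ => ℓ)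
      (TensorProduct.lift (consTensor k C (m + 1)) ((iterComul k C m).lTensor C t)))) =
      weilImage ℓ m (TensorProduct.lid k C (Coalgebra.counit.rTensor C t)) := by
    intro t
    induction t with
    | zero => simp
    | add x y hx hy => simp only [map_add, hx, hy]
    | tmul x y =>
      rw [LinearMap.lTensor_tmul, TensorProduct.lift.tmul, map_consTensor,
        face_zero_shiftMul m (hℓ.mul x), LinearMap.rTensor_tmul, TensorProduct.lid_tmul,
        map_smul]
      rfl
  have h := H (Coalgebra.comul c)
  rw [Coalgebra.rTensor_counit_comul, TensorProduct.lid_tmul, one_smul, ← iterComul_succ'] at h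
  exact h

lemma IsStrongConnection.face_weilImage (hℓ : E.IsStrongConnection ℓ) (m : ℕ) (i : Fin (m + 1))
    {c : C} (hc : c ∈ cotraces k C) :
    face k A m i (weilImage ℓ (m + 1) c) = weilImage ℓ m c :=
  face_eq_of_rot (rot_weilImage ℓ _ hc) (rot_weilImage ℓ _ hc) (hℓ.face_zero_weilImage m c) i

set_option maxSynthPendingDepth 5 in
/-- The linear map `A ⊗ A → A ⊗ C ⊗ A` whose kernel is `A □^C A`. -/
def defect (E : GaloisExt k C A) : A ⊗[k] A →ₗ[k] (A ⊗[k] C) ⊗[k] A :=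
  E.ρ.rTensor A - (TensorProduct.assoc k A C A).symm.toLinearMap ∘ₗ E.leftCoact.lTensor A

set_option maxSynthPendingDepth 5 in
lemma mem_M_iff (t : A ⊗[k] A) : t ∈ E.M ↔ E.defect t = 0 := by
  rw [defect, LinearMap.sub_apply, sub_eq_zero]
  exact LinearMap.mem_eqLocus

lemma IsStrongConnection.ρ_lTensor (hℓ : E.IsStrongConnection ℓ) (c : C) :
    E.ρ.lTensor A (ℓ c) = TensorProduct.assoc k A A C (ℓ.rTensor C (Coalgebra.comul c)) :=
  LinearMap.congr_fun hℓ.right_colinear c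

lemma IsStrongConnection.leftCoact_rTensor (hℓ : E.IsStrongConnection ℓ) (c : C) :
    E.leftCoact.rTensor A (ℓ c) =
      (TensorProduct.assoc k C A A).symm (ℓ.lTensor C (Coalgebra.comul c)) :=
  LinearMap.congr_fun hℓ.left_colinear c

/-- Right colinearity places the extra factor c₍₂₎ after ℓ(c₍₁₎), left colinearity places c₍₁₎
before ℓ(c₍₂₎); after the flip the two agree because the coproduct of c is symmetric. -/
lemma IsStrongConnection.comm_mem_M (hℓ : E.IsStrongConnection ℓ) {c : C} (hc : c ∈ cotraces k C) :
    TensorProduct.comm k A A (ℓ c) ∈ E.M := by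
  have h1 : ∀ t : A ⊗[k] A, E.ρ.rTensor A (TensorProduct.comm k A A t) =
      TensorProduct.comm k _ _ (E.ρ.lTensor A t) := by
    intro t
    induction t with
    | zero => simp
    | add x y hx hy => simp only [map_add, hx, hy]
    | tmul x y => simp
  have h2 : ∀ t : A ⊗[k] A, E.leftCoact.lTensor A (TensorProduct.comm k A A t) =
      TensorProduct.comm k _ _ (E.leftCoact.rTensor A t) := by
    intro t
    induction t with
    | zero => simp
    | add x y hx hy => simp only [map_add, hx, hy]
    | tmul x y => simp
  have h3 : ∀ s : C ⊗[k] C,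
      TensorProduct.comm k _ _ (TensorProduct.assoc k A A C (ℓ.rTensor C s)) =
      (TensorProduct.assoc k A C A).symm (TensorProduct.comm k _ _
        ((TensorProduct.assoc k C A A).symm (ℓ.lTensor C (TensorProduct.comm k C C s)))) := by
    intro s
    induction s with
    | zero => simp
    | add x y hx hy => simp only [map_add, hx, hy]
    | tmul c d =>
      rw [LinearMap.rTensor_tmul, TensorProduct.comm_tmul, LinearMap.lTensor_tmul]
      induction ℓ c with
      | zero => simp
      | add x y hx hy => simp only [TensorProduct.add_tmul, TensorProduct.tmul_add, map_add, hx, hy]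
      | tmul x y => simp
  have hc' : TensorProduct.comm k C C (Coalgebra.comul c) = Coalgebra.comul (R := k) c :=
    (LinearMap.mem_eqLocus.1 hc).symm
  refine LinearMap.mem_eqLocus.2 ?_
  rw [LinearMap.comp_apply, h1, h2, hℓ.ρ_lTensor, h3, hc', hℓ.leftCoact_rTensor]
  rfl

-- The inner legs c₍₁₎⟨2⟩ ⊗ c₍₂₎⟨1⟩ satisfy the cotensor equation even with the outer legs kept:
-- either coaction gives ℓ(c₍₁₎), c₍₂₎, ℓ(c₍₃₎), by coassociativity. No trace condition enters here.
set_option maxSynthPendingDepth 5 in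
lemma IsStrongConnection.defect_outer (hℓ : E.IsStrongConnection ℓ) (c : C) :
    E.defect.lTensor (A ⊗[k] A) (outer k A A A (TensorProduct.map ℓ ℓ (Coalgebra.comul c))) =
      0 := by
  have h1 : ∀ s t : A ⊗[k] A, (E.ρ.rTensor A).lTensor (A ⊗[k] A) (outer k A A A (s ⊗ₜ[k] t)) =
      outer k A (A ⊗[k] C) A (E.ρ.lTensor A s ⊗ₜ[k] t) := by
    intro s t
    induction s with
    | zero => simp
    | add x y hx hy => simp only [TensorProduct.add_tmul, map_add, hx, hy]
    | tmul x y =>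
      induction t with
      | zero => simp
      | add x y hx hy => simp only [TensorProduct.tmul_add, map_add, hx, hy]
      | tmul x' y' => simp only [LinearMap.lTensor_tmul, LinearMap.rTensor_tmul, outer_tmul]
  have h2 : ∀ s t : A ⊗[k] A,
      (E.leftCoact.lTensor A).lTensor (A ⊗[k] A) (outer k A A A (s ⊗ₜ[k] t)) =
      outer k A A (C ⊗[k] A) (s ⊗ₜ[k] E.leftCoact.rTensor A t) := by
    intro s t
    induction s with
    | zero => simp
    | add x y hx hy => simp only [TensorProduct.add_tmul, map_add, hx, hy]
    | tmul x y =>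
      induction t with
      | zero => simp
      | add x y hx hy => simp only [TensorProduct.tmul_add, map_add, hx, hy]
      | tmul x' y' => simp only [LinearMap.lTensor_tmul, LinearMap.rTensor_tmul, outer_tmul]
  have h3 : ∀ (s t : A ⊗[k] A) (d : C),
      outer k A (A ⊗[k] C) A (TensorProduct.assoc k A A C (s ⊗ₜ[k] d) ⊗ₜ[k] t) =
      (TensorProduct.assoc k A C A).symm.toLinearMap.lTensor (A ⊗[k] A)
        (outer k A A (C ⊗[k] A) (s ⊗ₜ[k] (TensorProduct.assoc k C A A).symm (d ⊗ₜ[k] t))) := by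
    intro s t d
    induction s with
    | zero => simp
    | add x y hx hy => simp only [TensorProduct.add_tmul, map_add, hx, hy]
    | tmul x y =>
      induction t with
      | zero => simp
      | add x y hx hy => simp only [TensorProduct.tmul_add, map_add, hx, hy]
      | tmul x' y' =>
        simp only [TensorProduct.assoc_tmul, TensorProduct.assoc_symm_tmul, outer_tmul,
          LinearMap.lTensor_tmul, LinearEquiv.coe_coe]
  have h4 : ∀ u : (C ⊗[k] C) ⊗[k] C,
      outer k A (A ⊗[k] C) A (TensorProduct.map ((TensorProduct.assoc k A A C).toLinearMap ∘ₗ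
        ℓ.rTensor C) ℓ u) =
      (TensorProduct.assoc k A C A).symm.toLinearMap.lTensor (A ⊗[k] A)
        (outer k A A (C ⊗[k] A) (TensorProduct.map ℓ
          ((TensorProduct.assoc k C A A).symm.toLinearMap ∘ₗ ℓ.lTensor C)
            (TensorProduct.assoc k C C C u))) := by
    intro u
    induction u with
    | zero => simp
    | add x y hx hy => simp only [map_add, hx, hy]
    | tmul u c₃ =>
      induction u with
      | zero => simp
      | add x y hx hy => simp only [TensorProduct.add_tmul, map_add, hx, hy]
      | tmul c₁ c₂ =>
        simp only [TensorProduct.assoc_tmul, TensorProduct.map_tmul, LinearMap.comp_apply,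
          LinearMap.rTensor_tmul, LinearMap.lTensor_tmul, LinearEquiv.coe_coe, h3]
  have h5 : ∀ s : C ⊗[k] C,
      (E.ρ.rTensor A).lTensor (A ⊗[k] A) (outer k A A A (TensorProduct.map ℓ ℓ s)) =
      outer k A (A ⊗[k] C) A (TensorProduct.map ((TensorProduct.assoc k A A C).toLinearMap ∘ₗ
        ℓ.rTensor C) ℓ (Coalgebra.comul.rTensor C s)) := by
    intro s
    induction s with
    | zero => simp
    | add x y hx hy => simp only [map_add, hx, hy]
    | tmul x y =>
      rw [TensorProduct.map_tmul, h1, hℓ.ρ_lTensor]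
      rfl
  have h6 : ∀ s : C ⊗[k] C,
      (E.leftCoact.lTensor A).lTensor (A ⊗[k] A) (outer k A A A (TensorProduct.map ℓ ℓ s)) =
      outer k A A (C ⊗[k] A) (TensorProduct.map ℓ
          ((TensorProduct.assoc k C A A).symm.toLinearMap ∘ₗ ℓ.lTensor C)
            (Coalgebra.comul.lTensor C s)) := by
    intro s
    induction s with
    | zero => simp
    | add x y hx hy => simp only [map_add, hx, hy]
    | tmul x y =>
      rw [TensorProduct.map_tmul, h2, hℓ.leftCoact_rTensor]
      rfl
  rw [defect, LinearMap.lTensor_sub, LinearMap.sub_apply, LinearMap.lTensor_comp_apply, h5, h6, h4,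
    Coalgebra.coassoc_apply, sub_self]

set_option maxSynthPendingDepth 5 in
lemma IsStrongConnection.slot_weilElement (hℓ : E.IsStrongConnection ℓ) (m : ℕ) {c : C}
    (hc : c ∈ cotraces k C) (g : (A ⊗[k] C) ⊗[k] A →ₗ[k] A ⊗[k] A) (s : Fin (m + 1)) :
    slot k s (g ∘ₗ E.defect) (weilElement ℓ m c) = 0 := by
  cases m with
  | zero =>
    -- With a single factor both legs come from the same ℓ(c), so the cotrace condition itself
    -- replaces coassociativity.
    have h : weilElement ℓ 0 c =
        PiTensorProduct.tprod k fun _ => TensorProduct.comm k A A (ℓ c) := by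
      rw [weilElement, LinearMap.comp_apply, LinearMap.comp_apply, iterComul_zero,
        PiTensorProduct.map_tprod, ← single_tprod, ← single_tprod]
      induction ℓ c with
      | zero => simp only [map_zero]
      | add x y hx hy => simp only [map_add, hx, hy]
      | tmul x y =>
        rw [single_tprod, single_tprod]
        exact shift_tprod 0 (fun _ => x) fun _ => y
    rw [h, slot_tprod, LinearMap.comp_apply, (mem_M_iff _).1 (hℓ.comm_mem_M hc), map_zero,
      MultilinearMap.map_update_zero]
  | succ m =>
    -- Rotation invariance reduces to factor 1, whose legs come from the first two factors of the
    -- iterated coproduct.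
    refine slot_eq_zero_of_rot (rot_weilElement ℓ _ hc) (s := 1) ?_ s
    rw [weilElement, LinearMap.comp_apply, LinearMap.comp_apply, iterComul_eq_splitFirst]
    induction iterComul k C m c using PiTensorProduct.induction_on with
    | add x y hx hy => simp only [map_add, hx, hy, add_zero]
    | smul_tprod r a =>
      rw [map_smul, map_smul, map_smul, map_smul, splitFirst_tprod, map_consTwo,
        slot_shift_consTwo, smul_zero]
      rw [LinearMap.lTensor_comp_apply, hℓ.defect_outer, map_zero]

set_option maxSynthPendingDepth 5 in
/-- The elements `cₘ(ℓ)(c)` lie in the tensor powers of `A □^C A`. -/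
lemma IsStrongConnection.exists_retraction (hℓ : E.IsStrongConnection ℓ) :
    ∃ p : A ⊗[k] A →ₗ[k] E.M, ∀ m, ∀ c ∈ cotraces k C,
      PiTensorProduct.map (fun _ => E.M.subtype)
        (PiTensorProduct.map (fun _ => p) (weilElement ℓ m c)) = weilElement ℓ m c := by
  obtain ⟨g, hg⟩ := exists_generalizedInverse E.defect
  -- Since defect ∘ g ∘ defect = defect, the map id - g ∘ defect takes values in ker defect = M; it
  -- is the identity on each factor of the Chern-Weil element because the defect vanishes there.
  refine ⟨(LinearMap.id - g ∘ₗ E.defect).codRestrict E.M fun w => ?_, fun m c hc => ?_⟩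
  · rw [map_map, LinearMap.subtype_comp_codRestrict]
    refine map_eq_self_of_slot fun s => ?_
    rw [slot_sub, LinearMap.sub_apply, hℓ.slot_weilElement m hc, sub_zero, LinearMap.id_apply]
  · rw [mem_M_iff, LinearMap.sub_apply, map_sub, LinearMap.comp_apply, hg, LinearMap.id_apply,
      sub_self]

lemma val_aug (m : ℕ) (x : TPow k E.M m) :
    PiTensorProduct.map (fun _ => E.inv.val.toLinearMap) (PiTensorProduct.map (fun _ => E.aug) x) =
      PiTensorProduct.map (fun _ => LinearMap.mul' k A)
        (PiTensorProduct.map (fun _ => E.M.subtype) x) := by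
  rw [map_map, map_map]
  rfl

lemma val_injective (m : ℕ) : Function.Injective
    (PiTensorProduct.map (R := k) fun _ : Fin (m + 1) => E.inv.val.toLinearMap) :=
  map_injective Subtype.val_injective m

lemma IsStrongConnection.isConstant (hℓ : E.IsStrongConnection ℓ) {c : C} (hc : c ∈ cotraces k C)
    {x : (m : ℕ) → TPow k E.inv m}
    (hx : ∀ m, PiTensorProduct.map (fun _ => E.inv.val.toLinearMap) (x m) = weilImage ℓ m c) :
    (tensorModule k E.inv).IsConstant x where
  face m i := val_injective m <| (face_map E.inv.val m i _).symm.trans <| by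
    rw [hx, hx, hℓ.face_weilImage m i hc]
  rot m := val_injective m <| (rot_map E.inv.val.toLinearMap m _).symm.trans <| by
    rw [hx, rot_weilImage ℓ m hc]

/-- A single retraction p onto M works for all c, so the chain is linear in c. -/
theorem IsStrongConnection.existsUnique_chernWeil (hℓ : E.IsStrongConnection ℓ) (n : ℕ) :
    ∃! chw : cotraces k C →ₗ[k] HC k E.inv (2 * n), E.IsChernWeil ℓ n chw := by
  obtain ⟨p, hp⟩ := hℓ.exists_retraction
  have hmem : ∀ c : cotraces k C, chernChain n (fun m => PiTensorProduct.map (fun _ => E.aug)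
      (PiTensorProduct.map (fun _ => p) (weilElement ℓ m c))) ∈ cycles k E.inv (2 * n) := fun c =>
    chernChain_mem_cycles (hℓ.isConstant c.2 fun m => by
      rw [val_aug, hp m c c.2]
      rfl) n
  let f : cotraces k C →ₗ[k] cycles k E.inv (2 * n) :=
    { toFun := fun c => ⟨_, hmem c⟩
      map_add' := fun c d => Subtype.ext <| by
        simp only [Submodule.coe_add, map_add, chernChain_add]
      map_smul' := fun r c => Subtype.ext <| by
        simp only [Submodule.coe_smul, map_smul, chernChain_smul, RingHom.id_apply] }
  refine ⟨Submodule.mkQ _ ∘ₗ f, fun c => ⟨_, fun m => hp m c c.2, hmem c, rfl⟩, fun chw h => ?_⟩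
  refine LinearMap.ext fun c => ?_
  obtain ⟨x, hx, H⟩ := h c
  -- The lift to M^{⊗(m+1)} is unique, because this space embeds in (A ⊗ A)^{⊗(m+1)}.
  have e : x = fun m => PiTensorProduct.map (fun _ => p) (weilElement ℓ m c) :=
    funext fun m => map_injective E.M.injective_subtype m ((hx m).trans (hp m c c.2).symm)
  subst e
  exact H.unique ⟨hmem c, rfl⟩

/-- The Chern-Galois element is the sum over closed paths for the iterated coproduct of the
character, with the indices shifted by one place. -/
lemma galoisElement_eq (ℓ : C →ₗ[k] A ⊗[k] A) (V : Comod k C) {N : ℕ}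
    (b : Module.Basis (Fin N) k V) (m : ℕ) : galoisElement ℓ V b m = weilImage ℓ m V.char := by
  rw [weilImage, LinearMap.comp_apply, weilElement, LinearMap.comp_apply, LinearMap.comp_apply,
    iterComul_char V b m,
    map_sum, map_sum, map_sum, galoisElement,
    ← ((Equiv.addRight (1 : Fin (m + 1))).arrowCongr (Equiv.refl (Fin N))).sum_comp]
  refine Finset.sum_congr rfl fun i _ => ?_
  rw [PiTensorProduct.map_tprod]
  congr 3
  funext r
  change ℓ (V.coeff b (i (r + 1 + -1)) (i (r + 2 + -1))) = _
  rw [← sub_eq_add_neg, ← sub_eq_add_neg, add_sub_cancel_right, ← sub_add_eq_add_sub,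
    fin_sub_one_add_two]

/-- A Chern-Weil map represents the Chern-Galois cycles of a representation. -/
lemma IsChernWeil.represents {n : ℕ} {chw : cotraces k C →ₗ[k] HC k E.inv (2 * n)}
    (h : E.IsChernWeil ℓ n chw) (V : Comod k C) {N : ℕ} (b : Module.Basis (Fin N) k V) :
    ∃ x : (m : ℕ) → TPow k E.inv m,
      (∀ m, PiTensorProduct.map (fun _ => E.inv.val.toLinearMap) (x m) =
        galoisElement ℓ V b m) ∧
      Represents (chernChain n x) (chw (chi k C (Rep.mk V))) := by
  obtain ⟨x, hx, H⟩ := h (chi k C (Rep.mk V))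
  exact ⟨_, fun m => by
    rw [val_aug, hx, chi_mk, galoisElement_eq]
    rfl, H⟩

lemma IsChernGalois.eq_of_represents {n : ℕ} {chg : Rep k C →+ HC k E.inv (2 * n)}
    (h : E.IsChernGalois ℓ n chg) {V : Comod k C} {N : ℕ} {b : Module.Basis (Fin N) k V}
    {x : (m : ℕ) → TPow k E.inv m}
    (hx : ∀ m, PiTensorProduct.map (fun _ => E.inv.val.toLinearMap) (x m) = galoisElement ℓ V b m)
    {z : HC k E.inv (2 * n)} (hz : Represents (chernChain n x) z) : z = chg (Rep.mk V) := by
  obtain ⟨y, hy, H⟩ := h V N b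
  have e : x = y := funext fun m => val_injective m ((hx m).trans (hy m).symm)
  subst e
  exact hz.unique H

/-- The composite of the Chern-Weil map with χ has the required property; in particular the chain
depends on V only through its character, and not on the basis. -/
theorem IsStrongConnection.existsUnique_chernGalois (hℓ : E.IsStrongConnection ℓ) (n : ℕ) :
    ∃! chg : Rep k C →+ HC k E.inv (2 * n), E.IsChernGalois ℓ n chg := by
  obtain ⟨chw, h, -⟩ := hℓ.existsUnique_chernWeil n
  refine ⟨chw.toAddMonoidHom.comp (chi k C), fun V N b => h.represents V b, fun chg h' =>
    grothendieck_hom_ext ?_⟩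
  rintro ⟨V⟩
  obtain ⟨x, hx, H⟩ := h.represents V (Module.finBasis k V)
  exact (h'.eq_of_represents hx H).symm

/-- The Chern class of A □ V may be computed from any presentation; for the one given by the strong
connection the chain is the Chern-Galois chain. -/
lemma IsStrongConnection.chernCharacter_eq (hℓ : E.IsStrongConnection ℓ) {n : ℕ}
    {F : Rep k C →+ KZero E.inv} {ch : KZero E.inv →+ HC k E.inv (2 * n)}
    {chg : Rep k C →+ HC k E.inv (2 * n)} (hF : E.IsAssociated F) (hch : IsChernCharacter n ch)
    (hchg : E.IsChernGalois ℓ n chg) (V : Comod k C) :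
    ch (F (Rep.mk V)) = chg (Rep.mk V) := by
  obtain ⟨P, ⟨f⟩, hP⟩ := hF V
  obtain ⟨N, e, he, hx⟩ := hℓ.exists_isPresented V (Module.finBasis k V)
  rw [hP]
  exact hchg.eq_of_represents hx (hch.isChernClass P _ e (he.congr f.symm))

end GaloisExt

end

end ChernWeil

theorem mainTheorem4 {k C A : Type u} [Field k] [AddCommGroup C] [Module k C] [Coalgebra k C]
    [Ring A] [Algebra k A] (E : ChernWeil.GaloisExt k C A) (ℓ : C →ₗ[k] A ⊗[k] A)
    (hℓ : E.IsStrongConnection ℓ) (n : ℕ) :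
    (∃! F : ChernWeil.Rep k C →+ ChernWeil.KZero E.inv, E.IsAssociated F) ∧
    (∃! ch : ChernWeil.KZero E.inv →+ ChernWeil.HC k E.inv (2 * n),
      ChernWeil.IsChernCharacter n ch) ∧
    (∃! chw : ChernWeil.cotraces k C →ₗ[k] ChernWeil.HC k E.inv (2 * n),
      E.IsChernWeil ℓ n chw) ∧
    (∃! chg : ChernWeil.Rep k C →+ ChernWeil.HC k E.inv (2 * n), E.IsChernGalois ℓ n chg) ∧
    ∀ (F : ChernWeil.Rep k C →+ ChernWeil.KZero E.inv)
      (ch : ChernWeil.KZero E.inv →+ ChernWeil.HC k E.inv (2 * n))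
      (chw : ChernWeil.cotraces k C →ₗ[k] ChernWeil.HC k E.inv (2 * n))
      (chg : ChernWeil.Rep k C →+ ChernWeil.HC k E.inv (2 * n)),
      E.IsAssociated F → ChernWeil.IsChernCharacter n ch → E.IsChernWeil ℓ n chw →
      E.IsChernGalois ℓ n chg →
      ∀ V : ChernWeil.Rep k C, ch (F V) = chg V ∧ chw (ChernWeil.chi k C V) = chg V := by
  refine ⟨hℓ.existsUnique_associated, ChernWeil.existsUnique_chernCharacter n,
    hℓ.existsUnique_chernWeil n, hℓ.existsUnique_chernGalois n,
    fun F ch chw chg hF hch hchw hchg V => ⟨?_, ?_⟩⟩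
  -- All maps are additive, so agreement on classes of comodules suffices.
  · refine DFunLike.congr_fun (f := ch.comp F) (g := chg) (ChernWeil.grothendieck_hom_ext ?_) V
    rintro ⟨V⟩
    exact hℓ.chernCharacter_eq hF hch hchg V
  · refine DFunLike.congr_fun (f := chw.toAddMonoidHom.comp (ChernWeil.chi k C)) (g := chg)
      (ChernWeil.grothendieck_hom_ext ?_) V
    rintro ⟨V⟩
    obtain ⟨x, hx, H⟩ := hchw.represents V (Module.finBasis k V)
    exact hchg.eq_of_represents hx H
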